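/- Let $K_n$ be the complete graph on $n$ vertices, and let $f\colon E(K_n)\to\{1,2,\dots,\binom n2\}$ be a bijection (an edge ordering) chosen uniformly at random. Regard a Hamiltonian path of $K_n$ as directed, that is, as a permutation $v_1,\dots,v_n$ of the vertices, and call it $f$-increasing if the labels of its successive edges increase: $f(v_1v_2)<f(v_2v_3)<\dots<f(v_{n-1}v_n)$. Let $H_n$ be the number of $f$-increasing Hamiltonian paths. Then, as $n\to\infty$, $$\Pr[\text{an } f\text{-increasing Hamiltonian path exists in } K_n]\;\ge\;\frac1e+o(1).$$ Moreover, $\mathbb E[H_n]=n$ for every $n\ge 1$, and $\mathbb E[H_n^2]=(1+o(1))\,e\,n^2$ as $n\to\infty$. -/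

import Mathlib

open MeasureTheory

/-- The edge set `E(K_n)` of the complete graph `⊤` on the `n` vertices `Fin n`. -/
abbrev EdgeOfK (n : ℕ) : Type := (⊤ : SimpleGraph (Fin n)).edgeSet

/-- An edge ordering of `K_n`: a bijection `E(K_n) → {1, 2, …, n choose 2}`. -/
abbrev EdgeOrdering (n : ℕ) : Type := EdgeOfK n ≃ Finset.Icc 1 (n.choose 2)

/-- Every set of edge orderings is an event. -/
instance EdgeOrdering.measurableSpace (n : ℕ) : MeasurableSpace (EdgeOrdering n) := ⊤

/-- The law of a uniformly random edge ordering of `K_n`. -/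
noncomputable def randomOrdering (n : ℕ) : Measure (EdgeOrdering n) :=
  ProbabilityTheory.uniformOn Set.univ

/-- There are as many edges as labels, so that edge orderings exist. -/
instance EdgeOrdering.nonempty (n : ℕ) : Nonempty (EdgeOrdering n) := by
  classical
  refine ⟨Fintype.equivOfCardEq ?_⟩
  have h : Fintype.card (EdgeOfK n) = n.choose 2 := by
    rw [← SimpleGraph.edgeFinset_card]
    convert SimpleGraph.card_edgeFinset_top_eq_card_choose_two (V := Fin n)
    simp
  rw [h]
  simp

/-- The random edge ordering has a genuine probability distribution. -/
instance randomOrdering.isProbabilityMeasure (n : ℕ) :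
    IsProbabilityMeasure (randomOrdering n) :=
  ProbabilityTheory.isProbabilityMeasure_uniformOn Set.finite_univ Set.univ_nonempty

/-- A (directed) Hamiltonian path of `K_n` is a permutation `σ` of the vertices: it visits
`σ 0, σ 1, …, σ (n - 1)` in this order. Its `i`-th edge, for `0 ≤ i < n - 1`, joins
`σ i` to `σ (i + 1)`. -/
def pathEdge {n : ℕ} (σ : Equiv.Perm (Fin n)) (i : Fin (n - 1)) : EdgeOfK n :=
  ⟨s(σ ⟨i.1, by omega⟩, σ ⟨i.1 + 1, by omega⟩), by
    rw [SimpleGraph.mem_edgeSet]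
    intro h
    simpa using σ.injective h⟩

/-- The Hamiltonian path `σ` is `f`-increasing: the labels of its successive edges form an
increasing sequence. -/
def IsIncreasing {n : ℕ} (f : EdgeOrdering n) (σ : Equiv.Perm (Fin n)) : Prop :=
  StrictMono fun i : Fin (n - 1) => f (pathEdge σ i)

/-- `H_n`, the number of `f`-increasing (directed) Hamiltonian paths of `K_n`. -/
noncomputable def numIncreasing {n : ℕ} (f : EdgeOrdering n) : ℕ :=
  Nat.card {σ : Equiv.Perm (Fin n) // IsIncreasing f σ}

/-!
The proof is the second moment method. Let `H` be the number of increasing Hamiltonian paths. Each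
path is increasing with probability `1 / (n - 1)!`, whence `E[H] = n`, and by Cauchy–Schwarz
`E[H]² ≤ E[H²] · P[H > 0]` (`sq_integral_numIncreasing_le`). Everything therefore reduces to
`E[H²] ~ e n²`.

By symmetry `E[H²]` is `n!` times the sum over permutations `τ` of the probability that the identity
path and the path `τ` are both increasing. If they share `k` edges, their union has `2 (n - 1) - k`
edges, and the probability is the number of ways of merging the two chains of edges into one chain,
with the shared edges in common places, divided by `(2 (n - 1) - k)!` (`card_isIncreasing_pair`).

A merged order splits its shared edges into maximal runs of neighbouring places. Both paths traverse
such a run as one block, in the same direction, except that a block of a single edge may also be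
traversed in opposite directions. The sequence of blocks is the *type* of the merged order. With
`c` blocks and `m = n - 1 - k`, a pair of a permutation and a merged order of a given type amounts to
a choice of `c` of `2 m + 1` slots for the blocks, a choice of which `m` of the other `2 m` places
belong to the first path, and a permutation that follows the blocks and shares no further edge
(`typeCount_eq`). At most `(m + 1 - c)!` permutations follow the blocks. As soon as the blocks are
well separated, which fails only for a vanishing proportion of the choices (`tendsto_badCount_div`),
a proportion tending to `e⁻²` of them has no further shared edge: removing the prescribed part
leaves a uniformly random permutation, and in such a permutation no two neighbouring positions carry
neighbouring values with probability tending to `e⁻²` (`tendsto_card_noConsec`,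
`eventually_card_tightExtensions`).

Hence a fixed type contributes `e⁻² 2 ^ (c - k) / c!` to the limit of `E[H²] / n²`
(`tendsto_typeTerm`). Summing over the sequences of blocks, `∑ 2 ^ (-k) = (3 / 2) ^ c`, the total is
`e⁻² ∑ 3 ^ c / c! = e`. The limit and the sum are interchanged by dominated convergence for the types
with `k ≤ 12 m`, where a contribution is at most `(13 / 14) ^ k 16 ^ c / c!` (`bulk_le`). No summable
bound holds for all types at once; those with `k > 12 m` contribute `O(1 / n)` altogether
(`tsum_ofReal_tailTerm_le`).
-/

section

open Finset

/-! ### Uniform edge orderings and the two moments -/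

theorem card_edgeOfK (n : ℕ) : Fintype.card (EdgeOfK n) = n.choose 2 := by
  classical
  rw [← SimpleGraph.edgeFinset_card]
  convert SimpleGraph.card_edgeFinset_top_eq_card_choose_two (V := Fin n)
  simp

theorem card_edgeOrdering (n : ℕ) : Fintype.card (EdgeOrdering n) = (n.choose 2).factorial := by
  classical
  obtain ⟨e⟩ := EdgeOrdering.nonempty n
  rw [Fintype.card_equiv e, card_edgeOfK]

/-- Expectation with respect to the uniform edge ordering is an average. -/
theorem integral_randomOrdering (n : ℕ) (F : EdgeOrdering n → ℝ) :
    ∫ f, F f ∂(randomOrdering n) = (∑ f, F f) / (n.choose 2).factorial := by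
  classical
  have : MeasurableSingletonClass (EdgeOrdering n) := ⟨fun _ => trivial⟩
  rw [MeasureTheory.integral_fintype (Integrable.of_finite), Finset.sum_div]
  refine Finset.sum_congr rfl fun f _ => ?_
  have : (randomOrdering n).real {f} = 1 / (n.choose 2).factorial := by
    unfold randomOrdering
    rw [Measure.real, ProbabilityTheory.uniformOn_univ, Measure.count_singleton, card_edgeOrdering]
    simp
  rw [this, smul_eq_mul]
  ring

theorem randomOrdering_real (n : ℕ) (p : EdgeOrdering n → Prop) [DecidablePred p] :
    (randomOrdering n).real {f | p f} = (#{f | p f} : ℝ) / (n.choose 2).factorial := by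
  classical
  have : MeasurableSingletonClass (EdgeOrdering n) := ⟨fun _ => trivial⟩
  have h : ∫ f, Set.indicator {f | p f} (fun _ => (1 : ℝ)) f ∂(randomOrdering n)
      = (randomOrdering n).real {f | p f} := by
    rw [integral_indicator (by trivial)]
    simp
  rw [← h, integral_randomOrdering]
  congr 1
  simp [Set.indicator_apply]

/-- The relative order that a uniformly random labelling induces on `u` distinct edges is
uniformly random: each of the `u!` orders occurs equally often. -/
theorem card_strictMono_comp {E : Type*} [Fintype E] [DecidableEq E] {L : Type*} [LinearOrder L]
    [Fintype L] {u : ℕ} (g : Fin u → E) (hg : Function.Injective g) :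
    #{f : E ≃ L | StrictMono (f ∘ g)} * u.factorial = Fintype.card (E ≃ L) := by
  classical
  have key : ∀ ρ : Equiv.Perm (Fin u),
      #{f : E ≃ L | StrictMono (f ∘ g ∘ ρ)} = #{f : E ≃ L | StrictMono (f ∘ g)} := by
    intro ρ
    -- permute the edges in the range of `g` according to `ρ`
    let e : Equiv.Perm E := ρ.viaFintypeEmbedding ⟨g, hg⟩
    have he : ∀ i, e (g i) = g (ρ i) := fun i =>
      Equiv.Perm.viaFintypeEmbedding_apply_image ρ ⟨g, hg⟩ i
    refine Finset.card_bij (fun f _ => e.trans f) ?_ ?_ ?_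
    · intro f hf
      simp only [mem_filter, mem_univ, true_and] at hf ⊢
      convert hf using 1
      ext i
      simp [he]
    · intro f _ f' _ h
      exact Equiv.ext fun x => by
        have := congrArg (fun k => k (e.symm x)) h
        simpa using this
    · intro f hf
      refine ⟨e.symm.trans f, ?_, ?_⟩
      · simp only [mem_filter, mem_univ, true_and] at hf ⊢
        convert hf using 1
        ext i
        simp [← he]
      · ext x; simp
  have part : Fintype.card (E ≃ L) = ∑ ρ : Equiv.Perm (Fin u),
      #{f : E ≃ L | StrictMono (f ∘ g ∘ ρ)} := by
    rw [← Finset.card_biUnion]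
    · rw [← Finset.card_univ]
      congr 1
      ext f
      simp only [mem_univ, mem_biUnion, mem_filter, true_and, true_iff]
      refine ⟨Tuple.sort (f ∘ g), ?_⟩
      have h1 := Tuple.monotone_sort (f ∘ g)
      exact h1.strictMono_of_injective
        (((f.injective.comp hg)).comp (Equiv.injective _))
    · intro ρ _ ρ' _ hne
      rw [Function.onFun, Finset.disjoint_left]
      intro f hf hf'
      simp only [mem_filter, mem_univ, true_and] at hf hf'
      apply hne
      have := Tuple.unique_monotone (f := f ∘ g) (σ := ρ) (τ := ρ') hf.monotone hf'.monotone
      exact Equiv.ext fun i => (f.injective.comp hg) (congrFun this i)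
  rw [part, Finset.sum_congr rfl (fun ρ _ => key ρ)]
  simp [Fintype.card_perm, mul_comm]

theorem pathEdge_injective {n : ℕ} (σ : Equiv.Perm (Fin n)) : Function.Injective (pathEdge σ) := by
  intro i j h
  have h' := congrArg Subtype.val h
  simp only [pathEdge, Sym2.eq_iff, EmbeddingLike.apply_eq_iff_eq, Fin.mk.injEq] at h'
  ext
  omega

open Classical in
theorem numIncreasing_eq {n : ℕ} (f : EdgeOrdering n) :
    numIncreasing f = #{σ : Equiv.Perm (Fin n) | IsIncreasing f σ} := by
  rw [numIncreasing, Nat.card_eq_fintype_card, Fintype.card_subtype]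

open Classical in
/-- Each path is increasing with probability `1 / (n - 1)!`. -/
theorem card_isIncreasing {n : ℕ} (σ : Equiv.Perm (Fin n)) :
    #{f : EdgeOrdering n | IsIncreasing f σ} * (n - 1).factorial = (n.choose 2).factorial := by
  rw [← card_edgeOrdering]
  convert card_strictMono_comp (L := Finset.Icc 1 (n.choose 2)) (pathEdge σ)
    (pathEdge_injective σ)
  exact Iff.rfl

theorem integral_numIncreasing (n : ℕ) (hn : 1 ≤ n) :
    ∫ f, (numIncreasing f : ℝ) ∂(randomOrdering n) = n := by
  classical
  rw [integral_randomOrdering]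
  have h1 : ∑ f : EdgeOrdering n, numIncreasing f
      = ∑ σ : Equiv.Perm (Fin n), #{f : EdgeOrdering n | IsIncreasing f σ} := by
    simp_rw [numIncreasing_eq, Finset.card_filter]
    exact Finset.sum_comm
  have h2 : (∑ f : EdgeOrdering n, numIncreasing f) * (n - 1).factorial
      = n.factorial * (n.choose 2).factorial := by
    rw [h1, Finset.sum_mul, Finset.sum_congr rfl fun σ _ => card_isIncreasing σ]
    simp [Fintype.card_perm]
  obtain ⟨k, rfl⟩ : ∃ k, n = k + 1 := ⟨n - 1, by omega⟩
  rw [Nat.factorial_succ, Nat.add_sub_cancel] at h2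
  have h3 : (∑ f : EdgeOrdering (k + 1), numIncreasing f) = (k + 1) * ((k + 1).choose 2).factorial := by
    have := Nat.factorial_pos k
    exact Nat.eq_of_mul_eq_mul_right this (by rw [h2]; ring)
  have h4 : ((∑ f : EdgeOrdering (k + 1), (numIncreasing f : ℝ)))
      = ((k + 1 : ℕ) : ℝ) * ((k + 1).choose 2).factorial := by
    exact_mod_cast h3
  rw [h4]
  field_simp

/-- Relabelling the vertices of `K_n` relabels its edges. -/
def edgeRelabel {n : ℕ} (π : Equiv.Perm (Fin n)) : Equiv.Perm (EdgeOfK n) :=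
  (SimpleGraph.Iso.mapEdgeSet (G := (⊤ : SimpleGraph (Fin n))) (G' := ⊤)
    ⟨π, by intro a b; simp⟩)

theorem edgeRelabel_pathEdge {n : ℕ} (π σ : Equiv.Perm (Fin n)) (i : Fin (n - 1)) :
    edgeRelabel π (pathEdge σ i) = pathEdge (π * σ) i := by
  apply Subtype.ext
  rfl

open Classical in
/-- By symmetry one of the two paths in the second moment may be taken to be the identity. -/
theorem integral_numIncreasing_sq (n : ℕ) :
    ∫ f, (numIncreasing f : ℝ) ^ 2 ∂(randomOrdering n) =
      n.factorial * ∑ τ : Equiv.Perm (Fin n),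
        (#{f : EdgeOrdering n | IsIncreasing f 1 ∧ IsIncreasing f τ} : ℝ)
          / (n.choose 2).factorial := by
  rw [integral_randomOrdering, ← Finset.sum_div, ← mul_div_assoc]
  congr 1
  have hsymm : ∀ σ τ : Equiv.Perm (Fin n),
      #{f : EdgeOrdering n | IsIncreasing f σ ∧ IsIncreasing f (σ * τ)}
        = #{f : EdgeOrdering n | IsIncreasing f 1 ∧ IsIncreasing f τ} := by
    intro σ τ
    refine Finset.card_bij (fun f _ => (edgeRelabel σ).trans f) ?_ ?_ ?_
    · intro f hf
      refine mem_filter.2 ⟨mem_univ _, ?_⟩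
      simpa [IsIncreasing, edgeRelabel_pathEdge] using (mem_filter.1 hf).2
    · intro f _ f' _ h
      exact Equiv.ext fun x => by
        have := congrArg (fun k => k ((edgeRelabel σ).symm x)) h
        simpa using this
    · intro f hf
      refine ⟨(edgeRelabel σ).symm.trans f, ?_, ?_⟩
      · have h1 : ∀ τ' i, (edgeRelabel σ).symm (pathEdge (σ * τ') i) = pathEdge τ' i := by
          intro τ' i
          rw [Equiv.symm_apply_eq, edgeRelabel_pathEdge]
        have h2 : ∀ i, (edgeRelabel σ).symm (pathEdge σ i) = pathEdge 1 i := by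
          intro i
          rw [Equiv.symm_apply_eq, edgeRelabel_pathEdge, mul_one]
        refine mem_filter.2 ⟨mem_univ _, ?_⟩
        simpa [IsIncreasing, h1, h2] using (mem_filter.1 hf).2
      · ext x; simp
  have h1 : ∑ f : EdgeOrdering n, numIncreasing f ^ 2
      = n.factorial * ∑ τ : Equiv.Perm (Fin n),
        #{f : EdgeOrdering n | IsIncreasing f 1 ∧ IsIncreasing f τ} := by
    have h2 : ∀ f : EdgeOrdering n, numIncreasing f ^ 2 =
        ∑ σ : Equiv.Perm (Fin n), ∑ τ : Equiv.Perm (Fin n),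
          if IsIncreasing f σ ∧ IsIncreasing f (σ * τ) then 1 else 0 := by
      intro f
      rw [numIncreasing_eq, sq, Finset.card_filter, Finset.sum_mul_sum]
      refine Finset.sum_congr rfl fun σ _ => ?_
      rw [← Equiv.sum_comp (Equiv.mulLeft σ)]
      refine Finset.sum_congr rfl fun τ _ => ?_
      by_cases ha : IsIncreasing f σ <;> by_cases hb : IsIncreasing f (σ * τ) <;> simp [ha, hb]
    simp_rw [h2]
    rw [Finset.sum_comm]
    have h3 : ∀ σ : Equiv.Perm (Fin n), (∑ f : EdgeOrdering n, ∑ τ : Equiv.Perm (Fin n),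
          if IsIncreasing f σ ∧ IsIncreasing f (σ * τ) then 1 else 0)
        = ∑ τ : Equiv.Perm (Fin n),
        #{f : EdgeOrdering n | IsIncreasing f 1 ∧ IsIncreasing f τ} := by
      intro σ
      rw [Finset.sum_comm]
      refine Finset.sum_congr rfl fun τ _ => ?_
      rw [← hsymm σ τ, Finset.card_filter]
    rw [Finset.sum_congr rfl fun σ _ => h3 σ]
    simp [Fintype.card_perm]
  exact_mod_cast h1

/-- The second moment method: `E[H]² ≤ E[H²] · P[H > 0]`. -/
theorem sq_integral_numIncreasing_le (n : ℕ) :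
    (∫ f, (numIncreasing f : ℝ) ∂(randomOrdering n)) ^ 2 ≤
      (∫ f, (numIncreasing f : ℝ) ^ 2 ∂(randomOrdering n)) *
        (randomOrdering n).real {f | ∃ σ : Equiv.Perm (Fin n), IsIncreasing f σ} := by
  classical
  rw [integral_randomOrdering, integral_randomOrdering, randomOrdering_real]
  -- Cauchy–Schwarz for `H` and the indicator of `H > 0`
  have h := Finset.sum_mul_sq_le_sq_mul_sq Finset.univ (fun f : EdgeOrdering n => (numIncreasing f : ℝ))
    (fun f => if ∃ σ : Equiv.Perm (Fin n), IsIncreasing f σ then 1 else 0)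
  have h1 : ∀ f : EdgeOrdering n, (numIncreasing f : ℝ) *
      (if ∃ σ : Equiv.Perm (Fin n), IsIncreasing f σ then 1 else 0) = numIncreasing f := by
    intro f
    split_ifs with hf
    · simp
    · have : numIncreasing f = 0 := by
        rw [numIncreasing_eq, Finset.card_eq_zero, Finset.filter_eq_empty_iff]
        exact fun σ _ hσ => hf ⟨σ, hσ⟩
      simp [this]
  simp_rw [h1] at h
  have h2 : ∑ f : EdgeOrdering n, (if ∃ σ : Equiv.Perm (Fin n), IsIncreasing f σ then (1 : ℝ) else 0) ^ 2
      = #{f : EdgeOrdering n | ∃ σ : Equiv.Perm (Fin n), IsIncreasing f σ} := by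
    rw [Finset.card_filter]
    push_cast
    refine Finset.sum_congr rfl fun f _ => ?_
    split_ifs <;> simp
  rw [h2] at h
  rw [div_pow, div_mul_div_comm, ← sq]
  gcongr

/-! ### Permutations without neighbouring values at neighbouring positions -/

/-- Two natural numbers differ by exactly one. -/
def Consec (a b : ℕ) : Prop := a + 1 = b ∨ b + 1 = a

instance (a b : ℕ) : Decidable (Consec a b) := inferInstanceAs (Decidable (_ ∨ _))

/-- The value of a permutation of `Fin n` at a natural number, the identity outside `Fin n`. -/
def permVal {n : ℕ} (τ : Equiv.Perm (Fin n)) (p : ℕ) : ℕ := if h : p < n then τ ⟨p, h⟩ else p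

theorem permVal_of_lt {n : ℕ} (τ : Equiv.Perm (Fin n)) {p : ℕ} (h : p < n) :
    permVal τ p = τ ⟨p, h⟩ := dif_pos h

theorem permVal_coe {n : ℕ} (τ : Equiv.Perm (Fin n)) (p : Fin n) :
    permVal τ p = τ p := dif_pos p.2

theorem permVal_lt {n : ℕ} (τ : Equiv.Perm (Fin n)) {p : ℕ} (h : p < n) : permVal τ p < n := by
  rw [permVal_of_lt τ h]; exact Fin.is_lt _

theorem permVal_injective {n : ℕ} (τ : Equiv.Perm (Fin n)) : Function.Injective (permVal τ) := by
  intro p q h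
  unfold permVal at h
  split_ifs at h with h1 h2 h2
  · simpa [Fin.val_inj] using h
  · omega
  · omega
  · exact h

/-- The positions `p` at which the path `τ` uses an edge `{v, v + 1}` of the identity path. -/
def consecPos {n : ℕ} (τ : Equiv.Perm (Fin n)) : Finset ℕ :=
  {p ∈ range (n - 1) | Consec (permVal τ p) (permVal τ (p + 1))}

theorem card_consecPos_le {n : ℕ} (τ : Equiv.Perm (Fin n)) : #(consecPos τ) ≤ n - 1 :=
  (card_filter_le _ _).trans (card_range _).le

/-- Insert the value `v` at position `p` into a permutation, shifting larger positions and
larger values up by one. -/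
def insertPerm {n : ℕ} (p v : Fin (n + 1)) (π : Equiv.Perm (Fin n)) : Equiv.Perm (Fin (n + 1)) :=
  (finSuccEquiv' p).trans ((Equiv.optionCongr π).trans (finSuccEquiv' v).symm)

theorem insertPerm_self {n : ℕ} (p v : Fin (n + 1)) (π : Equiv.Perm (Fin n)) :
    insertPerm p v π p = v := by
  simp [insertPerm]

theorem insertPerm_succAbove {n : ℕ} (p v : Fin (n + 1)) (π : Equiv.Perm (Fin n)) (x : Fin n) :
    insertPerm p v π (p.succAbove x) = v.succAbove (π x) := by
  simp [insertPerm]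

theorem insertPerm_bijective {n : ℕ} (p : Fin (n + 1)) :
    Function.Bijective fun x : Fin (n + 1) × Equiv.Perm (Fin n) => insertPerm p x.1 x.2 := by
  rw [Fintype.bijective_iff_injective_and_card]
  refine ⟨?_, by simp [Fintype.card_perm, Nat.factorial_succ]⟩
  rintro ⟨v, π⟩ ⟨v', π'⟩ h
  have hv : v = v' := by
    have := congrArg (fun σ => σ p) h
    simpa [insertPerm_self] using this
  subst hv
  refine Prod.ext rfl (Equiv.ext fun x => ?_)
  have := congrArg (fun σ => σ (p.succAbove x)) h
  simpa [insertPerm_succAbove] using this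

theorem permVal_insertPerm_self {n : ℕ} (p v : Fin (n + 1)) (π : Equiv.Perm (Fin n)) :
    permVal (insertPerm p v π) p = v := by
  rw [permVal_coe, insertPerm_self]

theorem permVal_insertPerm_of_lt {n : ℕ} (p v : Fin (n + 1)) (π : Equiv.Perm (Fin n)) {q : ℕ}
    (hq : q < p) : permVal (insertPerm p v π) q
      = if permVal π q < v then permVal π q else permVal π q + 1 := by
  have hqn : q < n := by omega
  have h1 : (⟨q, by omega⟩ : Fin (n + 1)) = p.succAbove ⟨q, hqn⟩ := by
    rw [Fin.succAbove_of_castSucc_lt]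
    · rfl
    · exact hq
  rw [permVal_of_lt _ (by omega : q < n + 1), h1, insertPerm_succAbove, permVal_of_lt π hqn]
  simp only [Fin.succAbove, Fin.lt_def, Fin.val_castSucc]
  split_ifs <;> simp

theorem mem_consecPos {n : ℕ} (τ : Equiv.Perm (Fin n)) (p : ℕ) :
    p ∈ consecPos τ ↔ p + 1 < n ∧ Consec (permVal τ p) (permVal τ (p + 1)) := by
  rw [consecPos, mem_filter, mem_range]
  constructor <;> rintro ⟨h1, h2⟩ <;> exact ⟨by omega, h2⟩

/-- If the value `v`, inserted right after position `i`, is consecutive to the value at `i`, then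
there are two possibilities for `v`, and consecutive values at earlier positions were consecutive
already before the insertion. -/
theorem subset_consecPos_insertPerm {n i : ℕ} (hi : i < n) {J : Finset ℕ} (hJ : ∀ q ∈ J, q < i)
    (v : Fin (n + 1)) (π : Equiv.Perm (Fin n))
    (h : insert i J ⊆ consecPos (insertPerm ⟨i + 1, by omega⟩ v π)) :
    (v.1 = permVal π i ∨ v.1 = permVal π i + 1) ∧ J ⊆ consecPos π := by
  have hval : ∀ q ≤ i, permVal (insertPerm ⟨i + 1, by omega⟩ v π) q
      = if permVal π q < v then permVal π q else permVal π q + 1 := fun q hq =>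
    permVal_insertPerm_of_lt _ _ _ (by simp; omega)
  have hself : permVal (insertPerm ⟨i + 1, by omega⟩ v π) (i + 1) = v :=
    permVal_insertPerm_self ⟨i + 1, by omega⟩ v π
  constructor
  · have h1 := ((mem_consecPos _ _).1 (h (mem_insert_self i J))).2
    rw [hself, hval i le_rfl] at h1
    unfold Consec at h1
    split_ifs at h1 <;> omega
  · intro q hq
    have hqi := hJ q hq
    have h1 := ((mem_consecPos _ _).1 (h (mem_insert_of_mem hq))).2
    rw [hval q (by omega), hval (q + 1) (by omega)] at h1
    refine (mem_consecPos _ _).2 ⟨by omega, ?_⟩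
    unfold Consec at h1 ⊢
    split_ifs at h1 <;> omega

/-- Inserting right after position `i` one of the two values consecutive to the value at `i` makes
`i` a consecutive position. It separates no other pair of consecutive values, except possibly the
value at `i` from the one at `i - 1`; hence the gap between `J` and `i`. -/
theorem consecPos_insertPerm_subset {n i : ℕ} (hi : i < n) {J : Finset ℕ}
    (hJ : ∀ q ∈ J, q + 1 < i) (v : Fin (n + 1)) (π : Equiv.Perm (Fin n))
    (hv : v.1 = permVal π i ∨ v.1 = permVal π i + 1) (h : J ⊆ consecPos π) :
    insert i J ⊆ consecPos (insertPerm ⟨i + 1, by omega⟩ v π) := by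
  have hval : ∀ q ≤ i, permVal (insertPerm ⟨i + 1, by omega⟩ v π) q
      = if permVal π q < v then permVal π q else permVal π q + 1 := fun q hq =>
    permVal_insertPerm_of_lt _ _ _ (by simp; omega)
  have hself : permVal (insertPerm ⟨i + 1, by omega⟩ v π) (i + 1) = v :=
    permVal_insertPerm_self ⟨i + 1, by omega⟩ v π
  intro q hq
  rw [mem_insert] at hq
  rcases hq with rfl | hq
  · refine (mem_consecPos _ _).2 ⟨by omega, ?_⟩
    rw [hself, hval q le_rfl]
    unfold Consec
    split_ifs <;> omega
  · have hqi := hJ q hq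
    have h1 := ((mem_consecPos _ _).1 (h hq)).2
    refine (mem_consecPos _ _).2 ⟨by omega, ?_⟩
    rw [hval q (by omega), hval (q + 1) (by omega)]
    have n1 : permVal π q ≠ permVal π i := fun h => by
      have := permVal_injective π h; omega
    have n2 : permVal π (q + 1) ≠ permVal π i := fun h => by
      have := permVal_injective π h; omega
    unfold Consec at h1 ⊢
    split_ifs <;> omega

/-- There are exactly two values that can be inserted right after position `i` so as to be
consecutive to the value at `i`. -/
theorem card_insert_values {n : ℕ} (S : Finset (Equiv.Perm (Fin n))) {i : ℕ} (hi : i < n) :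
    #{x : Fin (n + 1) × Equiv.Perm (Fin n) |
      (x.1.1 = permVal x.2 i ∨ x.1.1 = permVal x.2 i + 1) ∧ x.2 ∈ S} = 2 * #S := by
  have : ({x : Fin (n + 1) × Equiv.Perm (Fin n) |
      (x.1.1 = permVal x.2 i ∨ x.1.1 = permVal x.2 i + 1) ∧ x.2 ∈ S} : Finset _)
      = S.biUnion fun π => {(⟨permVal π i, by have := permVal_lt π hi; omega⟩, π),
        (⟨permVal π i + 1, by have := permVal_lt π hi; omega⟩, π)} := by
    ext ⟨v, π⟩
    simp only [mem_filter, mem_univ, true_and, mem_biUnion, mem_insert, mem_singleton,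
      Prod.mk.injEq, Fin.ext_iff]
    constructor
    · rintro ⟨h1, h2⟩
      exact ⟨π, h2, by tauto⟩
    · rintro ⟨π', h1, h2⟩
      rcases h2 with ⟨h2, rfl⟩ | ⟨h2, rfl⟩ <;> exact ⟨by tauto, h1⟩
  rw [this, card_biUnion]
  · rw [sum_congr rfl (g := fun _ => 2), sum_const, smul_eq_mul, mul_comm]
    intro π _
    rw [card_pair]
    simp
  · intro π _ π' _ hne
    rw [Function.onFun, Finset.disjoint_left]
    rintro ⟨v, ρ⟩ h1 h2
    simp only [mem_insert, mem_singleton, Prod.mk.injEq] at h1 h2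
    apply hne
    rcases h1 with ⟨-, h1⟩ | ⟨-, h1⟩ <;> rcases h2 with ⟨-, h2⟩ | ⟨-, h2⟩ <;> rw [← h1, ← h2]

theorem card_subset_consecPos_succ {n i : ℕ} (hi : i < n) (J : Finset ℕ) :
    #{σ : Equiv.Perm (Fin (n + 1)) | insert i J ⊆ consecPos σ} =
      #{x : Fin (n + 1) × Equiv.Perm (Fin n) |
        insert i J ⊆ consecPos (insertPerm ⟨i + 1, by omega⟩ x.1 x.2)} := by
  symm
  refine Finset.card_bij (fun x _ => insertPerm ⟨i + 1, by omega⟩ x.1 x.2) ?_ ?_ ?_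
  · intro x hx
    simpa using hx
  · intro x _ y _ h
    exact (insertPerm_bijective _).1 h
  · intro σ hσ
    obtain ⟨x, hx⟩ := (insertPerm_bijective (⟨i + 1, by omega⟩ : Fin (n + 1))).2 σ
    exact ⟨x, by simpa [hx] using hσ, hx⟩

/-- Forcing the values at the positions `i` and `i + 1` to be consecutive for all `i` in `J` removes
`#J` degrees of freedom, up to the two orders of each pair. -/
theorem card_subset_consecPos_le (J : Finset ℕ) : ∀ n : ℕ, J ⊆ range (n - 1) →
    #{σ : Equiv.Perm (Fin n) | J ⊆ consecPos σ} ≤ 2 ^ #J * (n - #J).factorial := by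
  induction J using Finset.induction_on_max with
  | empty => intro n _; simp [Fintype.card_perm]
  | insert i J hJ ih =>
    intro n hn
    have hi := mem_range.1 (hn (mem_insert_self i J))
    obtain ⟨n, rfl⟩ : ∃ k, n = k + 1 := ⟨n - 1, by omega⟩
    rw [Nat.add_sub_cancel] at hi
    have hni : i ∉ J := fun h => lt_irrefl _ (hJ i h)
    rw [card_insert_of_notMem hni, card_subset_consecPos_succ hi, Nat.add_sub_add_right, pow_succ']
    have hJn : J ⊆ range (n - 1) := fun q hq => by
      have := hJ q hq
      rw [mem_range]; omega
    calc _ ≤ #{x : Fin (n + 1) × Equiv.Perm (Fin n) |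
          (x.1.1 = permVal x.2 i ∨ x.1.1 = permVal x.2 i + 1) ∧
            x.2 ∈ ({σ : Equiv.Perm (Fin n) | J ⊆ consecPos σ} : Finset _)} := by
          refine card_le_card fun x hx => ?_
          rw [mem_filter] at hx ⊢
          have := subset_consecPos_insertPerm hi hJ x.1 x.2 hx.2
          exact ⟨mem_univ _, this.1, by simpa using this.2⟩
      _ = 2 * #{σ : Equiv.Perm (Fin n) | J ⊆ consecPos σ} := card_insert_values _ hi
      _ ≤ 2 * (2 ^ #J * (n - #J).factorial) := by gcongr; exact ih n hJn
      _ = _ := by ring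

/-- Equality holds in `card_subset_consecPos_le` if the pairs of positions are disjoint. -/
theorem le_card_subset_consecPos (J : Finset ℕ) : ∀ n : ℕ, J ⊆ range (n - 1) →
    (∀ i ∈ J, i + 1 ∉ J) →
    2 ^ #J * (n - #J).factorial ≤ #{σ : Equiv.Perm (Fin n) | J ⊆ consecPos σ} := by
  induction J using Finset.induction_on_max with
  | empty => intro n _; simp [Fintype.card_perm]
  | insert i J hJ ih =>
    intro n hn hm
    have hi := mem_range.1 (hn (mem_insert_self i J))
    obtain ⟨n, rfl⟩ : ∃ k, n = k + 1 := ⟨n - 1, by omega⟩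
    rw [Nat.add_sub_cancel] at hi
    have hni : i ∉ J := fun h => lt_irrefl _ (hJ i h)
    rw [card_insert_of_notMem hni, card_subset_consecPos_succ hi, Nat.add_sub_add_right, pow_succ']
    have hJn : J ⊆ range (n - 1) := fun q hq => by
      have := hJ q hq
      rw [mem_range]; omega
    have hJ' : ∀ q ∈ J, q + 1 < i := fun q hq => by
      have h1 := hJ q hq
      have h2 := hm q (mem_insert_of_mem hq)
      rw [mem_insert, not_or] at h2
      have := h2.1
      omega
    have hm' : ∀ q ∈ J, q + 1 ∉ J := fun q hq h =>
      hm q (mem_insert_of_mem hq) (mem_insert_of_mem h)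
    calc 2 * 2 ^ #J * (n - #J).factorial = 2 * (2 ^ #J * (n - #J).factorial) := by ring
      _ ≤ 2 * #{σ : Equiv.Perm (Fin n) | J ⊆ consecPos σ} := by gcongr; exact ih n hJn hm'
      _ = #{x : Fin (n + 1) × Equiv.Perm (Fin n) |
          (x.1.1 = permVal x.2 i ∨ x.1.1 = permVal x.2 i + 1) ∧
            x.2 ∈ ({σ : Equiv.Perm (Fin n) | J ⊆ consecPos σ} : Finset _)} :=
          (card_insert_values _ hi).symm
      _ ≤ _ := by
          refine card_le_card fun x hx => ?_
          rw [mem_filter] at hx ⊢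
          exact ⟨mem_univ _, consecPos_insertPerm_subset hi hJ' x.1 x.2 hx.2.1
            (by simpa using hx.2.2)⟩

/-- The permutations of `Fin n` without two consecutive positions carrying consecutive values. -/
def noConsec (n : ℕ) : Finset (Equiv.Perm (Fin n)) := {σ | consecPos σ = ∅}

theorem sum_choose_consecPos (n j : ℕ) :
    ∑ σ : Equiv.Perm (Fin n), (#(consecPos σ)).choose j =
      ∑ J ∈ powersetCard j (range (n - 1)), #{σ : Equiv.Perm (Fin n) | J ⊆ consecPos σ} := by
  simp_rw [Finset.card_filter]
  rw [Finset.sum_comm]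
  refine Finset.sum_congr rfl fun σ _ => ?_
  rw [← card_powersetCard, ← Finset.card_filter]
  congr 1
  ext J
  simp only [mem_powersetCard, mem_filter]
  constructor
  · rintro ⟨h1, h2⟩
    exact ⟨⟨h1.trans (filter_subset _ _), h2⟩, h1⟩
  · rintro ⟨⟨_, h2⟩, h1⟩
    exact ⟨h1, h2⟩

/-- The `j`-th binomial moment of the number of consecutive positions of a random permutation. -/
noncomputable def binomialMoment (n j : ℕ) : ℝ :=
  (∑ σ : Equiv.Perm (Fin n), ((#(consecPos σ)).choose j : ℝ)) / n.factorial

theorem binomialMoment_nonneg (n j : ℕ) : 0 ≤ binomialMoment n j := by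
  unfold binomialMoment; positivity

theorem choose_mul_factorial_div {n j : ℕ} (hj : j < n) :
    (((n - 1).choose j : ℝ) * (n - j).factorial) / n.factorial
      = (1 / j.factorial) * (1 - j / n) := by
  obtain ⟨k, rfl⟩ : ∃ k, n = j + k + 1 := ⟨n - 1 - j, by omega⟩
  have h1 : j + k + 1 - 1 = j + k := by omega
  have h2 : j + k + 1 - j = k + 1 := by omega
  rw [h1, h2, Nat.choose_eq_factorial_div_factorial (by omega), Nat.cast_div
    (Nat.factorial_mul_factorial_dvd_factorial (by omega)) (by positivity),
    Nat.add_sub_cancel_left, Nat.factorial_succ k, Nat.factorial_succ (j + k)]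
  push_cast
  field_simp
  ring

theorem binomialMoment_le {n j : ℕ} (hj : j < n) :
    binomialMoment n j ≤ 2 ^ j / j.factorial * (1 - j / n) := by
  have h : (∑ σ : Equiv.Perm (Fin n), (#(consecPos σ)).choose j) ≤
      (n - 1).choose j * (2 ^ j * (n - j).factorial) := by
    rw [sum_choose_consecPos]
    refine (Finset.sum_le_card_nsmul _ _ (2 ^ j * (n - j).factorial) fun J hJ => ?_).trans ?_
    · rw [mem_powersetCard] at hJ
      rw [← hJ.2]
      exact card_subset_consecPos_le J n hJ.1
    · simp
  have h' : (∑ σ : Equiv.Perm (Fin n), ((#(consecPos σ)).choose j : ℝ)) ≤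
      (n - 1).choose j * (2 ^ j * (n - j).factorial) := by exact_mod_cast h
  calc binomialMoment n j ≤ ((n - 1).choose j * (2 ^ j * (n - j).factorial)) / n.factorial := by
        unfold binomialMoment; gcongr
    _ = 2 ^ j * ((((n - 1).choose j : ℝ) * (n - j).factorial) / n.factorial) := by ring
    _ = _ := by rw [choose_mul_factorial_div hj]; ring

theorem binomialMoment_eq_zero {n j : ℕ} (hj : n ≤ j) (hn : 1 ≤ n) : binomialMoment n j = 0 := by
  unfold binomialMoment
  rw [Finset.sum_eq_zero, zero_div]
  intro σ _
  have := card_consecPos_le σ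
  rw [Nat.choose_eq_zero_of_lt (by omega), Nat.cast_zero]

theorem binomialMoment_le' {n : ℕ} (hn : 1 ≤ n) (j : ℕ) :
    binomialMoment n j ≤ 2 ^ j / j.factorial := by
  rcases lt_or_ge j n with h | h
  · refine (binomialMoment_le h).trans (mul_le_of_le_one_right (by positivity) ?_)
    have : (0 : ℝ) ≤ j / n := by positivity
    linarith
  · rw [binomialMoment_eq_zero h hn]; positivity

/-- Few sets of positions contain two neighbouring positions. -/
theorem card_exists_neighbours_le (n j : ℕ) :
    #{J ∈ powersetCard (j + 2) (range n) | ∃ i ∈ J, i + 1 ∈ J} ≤ n * n.choose j := by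
  have : ({J ∈ powersetCard (j + 2) (range n) | ∃ i ∈ J, i + 1 ∈ J} : Finset _) ⊆
      (range n ×ˢ powersetCard j (range n)).image fun x => insert x.1 (insert (x.1 + 1) x.2) := by
    intro J hJ
    simp only [mem_filter, mem_powersetCard] at hJ
    obtain ⟨⟨h1, h2⟩, i, hi, hi'⟩ := hJ
    refine mem_image.2 ⟨(i, (J.erase i).erase (i + 1)), ?_, ?_⟩
    · simp only [mem_product, mem_powersetCard]
      refine ⟨h1 hi, ((erase_subset _ _).trans (erase_subset _ _)).trans h1, ?_⟩
      rw [card_erase_of_mem (mem_erase.2 ⟨by omega, hi'⟩), card_erase_of_mem hi]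
      omega
    · simp only
      rw [insert_erase (mem_erase.2 ⟨by omega, hi'⟩), insert_erase hi]
  calc _ ≤ _ := card_le_card this
    _ ≤ _ := card_image_le
    _ = _ := by simp

/-- The sets of positions without neighbours already give the main term of the binomial moment. -/
theorem le_binomialMoment {n j : ℕ} (hj : j + 2 < n) :
    2 ^ (j + 2) / (j + 2).factorial * (1 - (j + 2 : ℕ) / n)
      - 2 ^ (j + 2) * ((n : ℝ) / ((n - j) * (n - j - 1))) ≤ binomialMoment n (j + 2) := by
  set a := 2 ^ (j + 2) * (n - (j + 2)).factorial with ha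
  set B : Finset (Finset ℕ) :=
    {J ∈ powersetCard (j + 2) (range (n - 1)) | ∃ i ∈ J, i + 1 ∈ J} with hB
  have h : (n - 1).choose (j + 2) * a ≤
      (∑ σ : Equiv.Perm (Fin n), (#(consecPos σ)).choose (j + 2)) + n * n.choose j * a := by
    have h1 : #B ≤ n * n.choose j := (card_exists_neighbours_le (n - 1) j).trans
      (Nat.mul_le_mul (Nat.sub_le _ _) (Nat.choose_le_choose _ (Nat.sub_le _ _)))
    have h2 : ∑ J ∈ powersetCard (j + 2) (range (n - 1)), a ≤
        ∑ J ∈ powersetCard (j + 2) (range (n - 1)),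
          (#{σ : Equiv.Perm (Fin n) | J ⊆ consecPos σ} + if ∃ i ∈ J, i + 1 ∈ J then a else 0) := by
      refine Finset.sum_le_sum fun J hJ => ?_
      rw [mem_powersetCard] at hJ
      split_ifs with hb
      · omega
      · push Not at hb
        rw [ha, ← hJ.2, add_zero]
        exact le_card_subset_consecPos J n hJ.1 hb
    rw [sum_const, card_powersetCard, card_range, smul_eq_mul, sum_add_distrib,
      ← sum_choose_consecPos, ← sum_filter, sum_const, smul_eq_mul] at h2
    exact h2.trans (Nat.add_le_add_left (Nat.mul_le_mul_right a h1) _)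
  have h' : ((n - 1).choose (j + 2) : ℝ) * a ≤
      (∑ σ : Equiv.Perm (Fin n), ((#(consecPos σ)).choose (j + 2) : ℝ)) + n * n.choose j * a := by
    exact_mod_cast h
  have hf : (0 : ℝ) < n.factorial := by positivity
  have h3 : (n - 1).choose (j + 2) * a / (n.factorial : ℝ) =
      2 ^ (j + 2) / (j + 2).factorial * (1 - (j + 2 : ℕ) / n) := by
    rw [ha]; push_cast
    have := choose_mul_factorial_div hj
    push_cast at this
    rw [show ((n - 1).choose (j + 2) : ℝ) * (2 ^ (j + 2) * ((n - (j + 2)).factorial : ℝ))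
      / n.factorial = 2 ^ (j + 2) * ((((n - 1).choose (j + 2) : ℝ) * (n - (j + 2)).factorial)
        / n.factorial) by ring, this]
    ring
  have h4 : (n * n.choose j * a / n.factorial : ℝ) ≤
      2 ^ (j + 2) * ((n : ℝ) / ((n - j) * (n - j - 1))) := by
    obtain ⟨k, rfl⟩ : ∃ k, n = j + k + 3 := ⟨n - 3 - j, by omega⟩
    rw [ha, Nat.choose_eq_factorial_div_factorial (by omega), Nat.cast_div
      (Nat.factorial_mul_factorial_dvd_factorial (by omega)) (by positivity),
      show j + k + 3 - j = k + 3 by omega, show j + k + 3 - (j + 2) = k + 1 by omega,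
      Nat.factorial_succ (k + 2), Nat.factorial_succ (k + 1)]
    push_cast
    have hj1 : (1 : ℝ) ≤ j.factorial := by exact_mod_cast Nat.factorial_pos j
    have e1 : ((j : ℝ) + k + 3) * (((j + k + 3).factorial : ℝ) / (j.factorial * (((k : ℝ) + 2 + 1) *
        (((k : ℝ) + 1 + 1) * (k + 1).factorial)))) * (2 ^ (j + 2) * ((k + 1).factorial : ℝ))
        / (j + k + 3).factorial = (1 / j.factorial) * (2 ^ (j + 2) * (((j : ℝ) + k + 3) /
        (((k : ℝ) + 3) * (k + 2)))) := by
      field_simp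
      ring
    have e2 : ((j : ℝ) + k + 3 - j) * (j + k + 3 - j - 1) = ((k : ℝ) + 3) * (k + 2) := by ring
    rw [e1, e2]
    refine mul_le_of_le_one_left (by positivity) ?_
    rw [div_le_one (by positivity)]
    exact hj1
  have h5 : (n - 1).choose (j + 2) * a / (n.factorial : ℝ) ≤
      binomialMoment n (j + 2) + n * n.choose j * a / n.factorial := by
    unfold binomialMoment
    rw [← add_div]
    gcongr
  linarith

theorem binomialMoment_of_lt_two {n j : ℕ} (hj : j < 2) (hn : j < n) :
    binomialMoment n j = 2 ^ j / j.factorial * (1 - j / n) := by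
  refine le_antisymm (binomialMoment_le hn) ?_
  have h : (n - 1).choose j * (2 ^ j * (n - j).factorial) ≤
      ∑ σ : Equiv.Perm (Fin n), (#(consecPos σ)).choose j := by
    rw [sum_choose_consecPos]
    refine le_trans ?_ (Finset.card_nsmul_le_sum _ _ (2 ^ j * (n - j).factorial) fun J hJ => ?_)
    · simp
    · rw [mem_powersetCard] at hJ
      rw [← hJ.2]
      refine le_card_subset_consecPos J n hJ.1 fun i hi hi' => ?_
      have h1 := card_le_card (show {i, i + 1} ⊆ J by
        intro x hx; simp at hx; rcases hx with rfl | rfl <;> assumption)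
      rw [card_pair (by omega)] at h1
      omega
  have h' : ((n - 1).choose j * (2 ^ j * (n - j).factorial) : ℝ) ≤
      (∑ σ : Equiv.Perm (Fin n), ((#(consecPos σ)).choose j : ℝ)) := by exact_mod_cast h
  calc _ = 2 ^ j * ((((n - 1).choose j : ℝ) * (n - j).factorial) / n.factorial) := by
        rw [choose_mul_factorial_div hn]; ring
    _ = ((n - 1).choose j * (2 ^ j * (n - j).factorial)) / n.factorial := by ring
    _ ≤ _ := by unfold binomialMoment; gcongr

open Filter Topology in
theorem tendsto_binomialMoment (j : ℕ) :
    Tendsto (fun n => binomialMoment n j) atTop (𝓝 (2 ^ j / j.factorial)) := by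
  have hup : Tendsto (fun n : ℕ => (2 : ℝ) ^ j / j.factorial * (1 - j / n)) atTop
      (𝓝 (2 ^ j / j.factorial)) := by
    have := (tendsto_const_div_atTop_nhds_zero_nat (j : ℝ)).const_sub 1
    simpa using this.const_mul ((2 : ℝ) ^ j / j.factorial)
  rcases lt_or_ge j 2 with h | h
  · refine hup.congr' ?_
    filter_upwards [eventually_gt_atTop j] with n hn
    rw [binomialMoment_of_lt_two h hn]
  · obtain ⟨j, rfl⟩ : ∃ k, j = k + 2 := ⟨j - 2, by omega⟩
    have hz : Tendsto (fun n : ℕ => (n : ℝ) / ((n - j) * (n - j - 1))) atTop (𝓝 0) := by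
      have h1 : Tendsto (fun n : ℕ => (n : ℝ)) atTop atTop := tendsto_natCast_atTop_atTop
      have h2 : Tendsto (fun n : ℕ => (n : ℝ) - j) atTop atTop :=
        tendsto_atTop_add_const_right _ _ h1
      have h3 : Tendsto (fun n : ℕ => (n : ℝ) - j - 1) atTop atTop :=
        tendsto_atTop_add_const_right _ _ h2
      have h4 : Tendsto (fun n : ℕ => (1 + j * ((n : ℝ) - j)⁻¹) * ((n : ℝ) - j - 1)⁻¹) atTop
          (𝓝 ((1 + j * 0) * 0)) :=
        ((h2.inv_tendsto_atTop.const_mul (j : ℝ)).const_add 1).mul h3.inv_tendsto_atTop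
      rw [mul_zero] at h4
      refine h4.congr' ?_
      filter_upwards [eventually_gt_atTop (j + 1)] with n hn
      have hn' : (j : ℝ) + 1 < n := by exact_mod_cast hn
      have : (n : ℝ) - j ≠ 0 := by linarith
      have : (n : ℝ) - j - 1 ≠ 0 := by linarith
      field_simp
      ring
    have hlow := hup.sub (hz.const_mul ((2 : ℝ) ^ (j + 2)))
    rw [mul_zero, sub_zero] at hlow
    refine tendsto_of_tendsto_of_tendsto_of_le_of_le' hlow hup ?_ ?_
    · filter_upwards [eventually_gt_atTop (j + 2)] with n hn
      exact le_binomialMoment hn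
    · filter_upwards [eventually_gt_atTop (j + 2)] with n hn
      exact binomialMoment_le hn

/-- Inclusion–exclusion. -/
theorem card_noConsec_div {n : ℕ} (hn : 1 ≤ n) :
    (#(noConsec n) : ℝ) / n.factorial = ∑' j, (-1) ^ j * binomialMoment n j := by
  rw [tsum_eq_sum (s := range n)]
  · simp_rw [binomialMoment, ← mul_div_assoc]
    rw [← Finset.sum_div]
    congr 1
    simp_rw [Finset.mul_sum]
    rw [Finset.sum_comm, noConsec, Finset.card_filter]
    push_cast
    refine Finset.sum_congr rfl fun σ _ => ?_
    have hX := card_consecPos_le σ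
    have h := Int.alternating_sum_range_choose (n := #(consecPos σ))
    have h2 : ∑ j ∈ range n, ((-1 : ℤ) ^ j * ((#(consecPos σ)).choose j : ℤ)) =
        ∑ j ∈ range (#(consecPos σ) + 1), ((-1 : ℤ) ^ j * ((#(consecPos σ)).choose j : ℤ)) := by
      symm
      refine Finset.sum_subset (fun x hx => ?_) fun x _ hx => ?_
      · rw [mem_range] at *; omega
      · rw [mem_range] at hx
        rw [Nat.choose_eq_zero_of_lt (by omega)]; simp
    rw [h] at h2
    have h3 : ∑ j ∈ range n, ((-1 : ℝ) ^ j * ((#(consecPos σ)).choose j : ℝ)) =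
        ((if #(consecPos σ) = 0 then 1 else 0 : ℤ) : ℝ) := by
      rw [← h2]; push_cast; rfl
    rw [h3]
    simp only [card_eq_zero]
    split_ifs <;> simp
  · intro j hj
    rw [mem_range, not_lt] at hj
    rw [binomialMoment_eq_zero hj hn, mul_zero]

open Filter Topology in
/-- A uniformly random permutation has no two consecutive positions with consecutive values with
probability tending to `e⁻²`. -/
theorem tendsto_card_noConsec :
    Tendsto (fun n => (#(noConsec n) : ℝ) / n.factorial) atTop (𝓝 (Real.exp (-2))) := by
  have h : Tendsto (fun n => ∑' j, (-1 : ℝ) ^ j * binomialMoment n j) atTop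
      (𝓝 (∑' j : ℕ, (-1 : ℝ) ^ j * (2 ^ j / j.factorial))) := by
    refine tendsto_tsum_of_dominated_convergence (bound := fun j : ℕ => (2 : ℝ) ^ j / j.factorial)
      (Real.summable_pow_div_factorial 2) (fun j => (tendsto_binomialMoment j).const_mul _) ?_
    filter_upwards [eventually_ge_atTop 1] with n hn j
    rw [norm_mul, norm_pow, norm_neg, norm_one, one_pow, one_mul, Real.norm_of_nonneg
      (binomialMoment_nonneg n j)]
    exact binomialMoment_le' hn j
  have hs : (∑' j : ℕ, (-1 : ℝ) ^ j * (2 ^ j / j.factorial)) = Real.exp (-2) := by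
    rw [Real.exp_eq_exp_ℝ, NormedSpace.exp_eq_tsum_div]
    refine tsum_congr fun j => ?_
    rw [show (-2 : ℝ) = -1 * 2 by norm_num, mul_pow]
    ring
  rw [hs] at h
  refine h.congr' ?_
  filter_upwards [eventually_ge_atTop 1] with n hn
  rw [card_noConsec_div hn]

/-! ### Permutations with prescribed values -/

/-- The permutations that agree with `ψ` on `Q`. -/
def agreeing {n : ℕ} (Q : Finset (Fin n)) (ψ : Fin n → Fin n) : Finset (Equiv.Perm (Fin n)) :=
  {τ | ∀ p ∈ Q, τ p = ψ p}

theorem mem_agreeing {n : ℕ} {Q : Finset (Fin n)} {ψ : Fin n → Fin n} {τ : Equiv.Perm (Fin n)} :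
    τ ∈ agreeing Q ψ ↔ ∀ p ∈ Q, τ p = ψ p := by simp [agreeing]

theorem card_agreeing_perm {n : ℕ} (Q : Finset (Fin n)) (φ : Equiv.Perm (Fin n)) :
    #(agreeing Q φ) = (n - #Q).factorial := by
  have h : Fintype.card (Equiv.Perm {p : Fin n // p ∉ Q}) = (n - #Q).factorial := by
    rw [Fintype.card_perm, Fintype.card_subtype_compl]
    simp
  rw [← h, ← card_univ]
  symm
  refine Finset.card_bij (fun ρ _ => φ * Equiv.Perm.ofSubtype ρ) ?_ ?_ ?_
  · intro ρ _
    rw [mem_agreeing]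
    intro p hp
    rw [Equiv.Perm.mul_apply, Equiv.Perm.ofSubtype_apply_of_not_mem]
    simpa using hp
  · intro ρ _ ρ' _ h
    exact Equiv.Perm.ofSubtype_injective (mul_left_cancel h)
  · intro τ hτ
    rw [mem_agreeing] at hτ
    have h1 : ∀ p, p ∉ Q ↔ (φ⁻¹ * τ) p ∉ Q := by
      intro p
      constructor
      · intro hp hq
        have := hτ _ hq
        rw [Equiv.Perm.mul_apply, Equiv.Perm.inv_def, Equiv.apply_symm_apply] at this
        have := τ.injective this
        rw [Equiv.Perm.mul_apply] at hq
        exact hp (this ▸ hq)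
      · intro hp hq
        apply hp
        rw [Equiv.Perm.mul_apply, hτ p hq, Equiv.Perm.inv_def, Equiv.symm_apply_apply]
        exact hq
    refine ⟨(φ⁻¹ * τ).subtypePerm (fun p => (h1 p).symm), mem_univ _, ?_⟩
    rw [Equiv.Perm.ofSubtype_subtypePerm, mul_inv_cancel_left]
    intro p hp hq
    apply hp
    rw [Equiv.Perm.mul_apply, hτ p hq, Equiv.Perm.inv_def, Equiv.symm_apply_apply]

/-- The function `ψ` need not be injective on `Q`; if it is not, no permutation agrees with it. -/
theorem card_agreeing_le {n : ℕ} (Q : Finset (Fin n)) (ψ : Fin n → Fin n) :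
    #(agreeing Q ψ) ≤ (n - #Q).factorial := by
  rcases (agreeing Q ψ).eq_empty_or_nonempty with h | ⟨φ, hφ⟩
  · rw [h]; simp
  · rw [mem_agreeing] at hφ
    rw [← card_agreeing_perm Q φ]
    refine card_le_card fun τ hτ => ?_
    rw [mem_agreeing] at hτ ⊢
    exact fun p hp => (hτ p hp).trans (hφ p hp).symm

/-- The places where an order embedding `Fin N → Fin n` skips a value. -/
def skips {N n : ℕ} (e : Fin N ↪o Fin n) : Finset ℕ :=
  {x ∈ range (N - 1) | ¬ ∃ (h : x + 1 < N), (e ⟨x, by omega⟩ : ℕ) + 1 = e ⟨x + 1, h⟩}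

/-- Each skip of `e` is caused by an element of `R` missing from its range. -/
theorem card_skips_le {N n : ℕ} (e : Fin N ↪o Fin n) (R : Finset (Fin n))
    (he : ∀ v, v ∉ R → ∃ x, e x = v) : #(skips e) ≤ #R := by
  classical
  have key : ∀ x ∈ skips e, ∃ h : x < N, (e ⟨x, h⟩ : ℕ) + 1 ∈ R.image Fin.val := by
    intro x hx
    rw [skips, mem_filter, mem_range] at hx
    obtain ⟨hx1, hx2⟩ := hx
    have hlt : x + 1 < N := by omega
    have h1 : e ⟨x, by omega⟩ < e ⟨x + 1, hlt⟩ := e.strictMono (by simp [Fin.lt_def])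
    have h2 : (e ⟨x, by omega⟩ : ℕ) + 1 ≠ e ⟨x + 1, hlt⟩ := fun h => hx2 ⟨hlt, h⟩
    have h3 : (e ⟨x, by omega⟩ : ℕ) + 1 < e ⟨x + 1, hlt⟩ := by
      rw [Fin.lt_def] at h1; omega
    refine ⟨by omega, mem_image.2 ⟨⟨e ⟨x, by omega⟩ + 1, by omega⟩, ?_, rfl⟩⟩
    by_contra hv
    obtain ⟨y, hy⟩ := he _ hv
    have h4 : e ⟨x, by omega⟩ < e y := by rw [hy, Fin.lt_def]; simp
    have h5 : e y < e ⟨x + 1, hlt⟩ := by rw [hy, Fin.lt_def]; exact h3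
    rw [e.lt_iff_lt, Fin.lt_def] at h4 h5
    simp at h4 h5
    omega
  rw [← card_image_of_injective R Fin.val_injective]
  refine card_le_card_of_injOn (fun x => if h : x < N then (e ⟨x, h⟩ : ℕ) + 1 else 0) ?_ ?_
  · intro x hx
    obtain ⟨h, h'⟩ := key x hx
    simpa only [dif_pos h, mem_coe] using h'
  · intro x hx y hy hxy
    obtain ⟨h1, -⟩ := key x hx
    obtain ⟨h2, -⟩ := key y hy
    simp only [dif_pos h1, dif_pos h2] at hxy
    have h3 : e ⟨x, h1⟩ = e ⟨y, h2⟩ := Fin.ext (by omega)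
    simpa using e.injective h3

theorem consec_of_orderEmbedding {N n : ℕ} (e : Fin N ↪o Fin n) {x y : Fin N}
    (h : Consec (e x) (e y)) : Consec x y := by
  have key : ∀ x y : Fin N, (e x : ℕ) + 1 = e y → (x : ℕ) + 1 = y := by
    intro x y h
    have h1 : x < y := by rw [← e.lt_iff_lt, Fin.lt_def]; omega
    rw [Fin.lt_def] at h1
    by_contra h2
    have h3 : x < ⟨x + 1, by omega⟩ := by simp [Fin.lt_def]
    have h4 : (⟨x + 1, by omega⟩ : Fin N) < y := by rw [Fin.lt_def]; simp; omega
    rw [← e.lt_iff_lt, Fin.lt_def] at h3 h4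
    omega
  rcases h with h | h
  · exact Or.inl (key x y h)
  · exact Or.inr (key y x h)

/-- The permutations `τ` extending `φ` on `Q` all of whose consecutive positions lie in `Q`. -/
def tightExtensions {n : ℕ} (Q : Finset (Fin n)) (φ : Equiv.Perm (Fin n)) :
    Finset (Equiv.Perm (Fin n)) :=
  {τ ∈ agreeing Q φ | ∀ p ∈ consecPos τ, p ∈ Q.image Fin.val ∧ p + 1 ∈ Q.image Fin.val}

/-- The extensions of `φ` with a consecutive pair of positions of which exactly one lies in `Q`. -/
def mixedExtensions {n : ℕ} (Q : Finset (Fin n)) (φ : Equiv.Perm (Fin n)) :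
    Finset (Equiv.Perm (Fin n)) :=
  {τ ∈ agreeing Q φ | ∃ p q : Fin n, p ∈ Q ∧ q ∉ Q ∧ Consec p q ∧ Consec (τ p) (τ q)}

/-- A mixed extension takes one more prescribed value, next to an element of `Q` in position and in
value, which leaves at most four choices for each element of `Q`. -/
theorem card_mixedExtensions_le {n : ℕ} (Q : Finset (Fin n)) (φ : Equiv.Perm (Fin n)) :
    #(mixedExtensions Q φ) ≤ 4 * #Q * (n - #Q - 1).factorial := by
  classical
  let cand : Fin n → Finset (Fin n) := fun p => {q | Consec p q}
  have hcand : ∀ p, #(cand p) ≤ 2 := by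
    intro p
    calc #(cand p) = #((cand p).map Fin.valEmbedding) := (card_map _).symm
      _ ≤ #({(p : ℕ) + 1, (p : ℕ) - 1} : Finset ℕ) := by
          refine card_le_card fun x hx => ?_
          obtain ⟨q, hq, rfl⟩ := mem_map.1 hx
          have hq' : Consec p q := (mem_filter.1 hq).2
          unfold Consec at hq'
          simp only [Fin.valEmbedding_apply, mem_insert, mem_singleton]
          omega
      _ ≤ 2 := card_le_two
  have hsub : mixedExtensions Q φ ⊆ Q.biUnion fun p => ((cand p).filter (· ∉ Q)).biUnion fun q =>
      (cand (φ p)).biUnion fun v => agreeing (insert q Q) (Function.update φ q v) := by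
    intro τ hτ
    rw [mixedExtensions, mem_filter, mem_agreeing] at hτ
    obtain ⟨h1, p, q, hp, hq, h2, h3⟩ := hτ
    simp only [mem_biUnion, mem_filter, cand, mem_univ, true_and]
    refine ⟨p, hp, q, ⟨h2, hq⟩, τ q, ?_, ?_⟩
    · rw [← h1 p hp]; exact h3
    · rw [mem_agreeing]
      intro x hx
      by_cases hxq : x = q
      · subst hxq; simp
      · rw [Function.update_of_ne hxq]
        exact h1 x ((mem_insert.1 hx).resolve_left hxq)
  refine (card_le_card hsub).trans ?_
  refine (card_biUnion_le_card_mul _ _ (2 * (2 * (n - #Q - 1).factorial)) ?_).trans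
    (by apply le_of_eq; ring)
  intro p hp
  refine (card_biUnion_le_card_mul _ _ (2 * (n - #Q - 1).factorial) ?_).trans
    (Nat.mul_le_mul_right _ ((card_filter_le _ _).trans (hcand p)))
  intro q hq
  rw [mem_filter] at hq
  refine (card_biUnion_le_card_mul _ _ (n - #Q - 1).factorial ?_).trans
    (Nat.mul_le_mul_right _ (hcand _))
  intro v _
  refine (card_agreeing_le _ _).trans ?_
  rw [card_insert_of_notMem hq.2, Nat.sub_add_eq]

/-- The permutations with a consecutive position in `S`, or a consecutive position whose smaller
value lies in `T`. -/
def seamPerms (N : ℕ) (S T : Finset ℕ) : Finset (Equiv.Perm (Fin N)) :=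
  {π | ∃ x ∈ consecPos π, x ∈ S ∨ min (permVal π x) (permVal π (x + 1)) ∈ T}

theorem card_seamPerms_le {N : ℕ} (S T : Finset ℕ) :
    #(seamPerms N S T) ≤ (#S * N + N * #T) * (2 * (N - 2).factorial) := by
  classical
  let good : ℕ → ℕ → Finset (Equiv.Perm (Fin N)) := fun x y =>
    {π | x + 1 < N ∧ ((permVal π x = y ∧ permVal π (x + 1) = y + 1) ∨
      (permVal π x = y + 1 ∧ permVal π (x + 1) = y))}
  have pair : ∀ x y z : ℕ, #({π : Equiv.Perm (Fin N) | x + 1 < N ∧ permVal π x = y ∧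
      permVal π (x + 1) = z} : Finset _) ≤ (N - 2).factorial := by
    intro x y z
    rcases ({π : Equiv.Perm (Fin N) | x + 1 < N ∧ permVal π x = y ∧
      permVal π (x + 1) = z} : Finset _).eq_empty_or_nonempty with h | ⟨π₀, h0⟩
    · rw [h]; simp
    · simp only [mem_filter, mem_univ, true_and] at h0
      obtain ⟨hx, hy, hz⟩ := h0
      have hc : #({⟨x, by omega⟩, ⟨x + 1, hx⟩} : Finset (Fin N)) = 2 := card_pair (by simp)
      have := card_agreeing_perm ({⟨x, by omega⟩, ⟨x + 1, hx⟩} : Finset (Fin N)) π₀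
      rw [hc] at this
      rw [← this]
      refine card_le_card fun π hπ => ?_
      simp only [mem_filter, mem_univ, true_and] at hπ
      rw [mem_agreeing]
      intro p hp
      rw [mem_insert, mem_singleton] at hp
      rw [Fin.ext_iff, ← permVal_coe, ← permVal_coe]
      rcases hp with rfl | rfl
      · exact hπ.2.1.trans hy.symm
      · exact hπ.2.2.trans hz.symm
  have hgood : ∀ x y, #(good x y) ≤ 2 * (N - 2).factorial := by
    intro x y
    have : good x y ⊆ ({π : Equiv.Perm (Fin N) | x + 1 < N ∧ permVal π x = y ∧
        permVal π (x + 1) = y + 1} : Finset _) ∪ ({π : Equiv.Perm (Fin N) | x + 1 < N ∧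
        permVal π x = y + 1 ∧ permVal π (x + 1) = y} : Finset _) := by
      intro π hπ
      simp only [good, mem_filter, mem_univ, true_and, mem_union] at hπ ⊢
      tauto
    refine (card_le_card this).trans ((card_union_le _ _).trans ?_)
    have h1 := pair x y (y + 1)
    have h2 := pair x (y + 1) y
    omega
  have hsub : seamPerms N S T ⊆ ((S ×ˢ range N) ∪ (range N ×ˢ T)).biUnion
      fun z => good z.1 z.2 := by
    intro π hπ
    rw [seamPerms, mem_filter] at hπ
    obtain ⟨-, x, hx, hxy⟩ := hπ
    rw [mem_consecPos] at hx
    have h1 := permVal_lt π (show x < N by omega)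
    refine mem_biUnion.2 ⟨(x, min (permVal π x) (permVal π (x + 1))), ?_, ?_⟩
    · simp only [mem_union, mem_product, mem_range]
      rcases hxy with h | h
      · exact Or.inl ⟨h, by omega⟩
      · exact Or.inr ⟨by omega, h⟩
    · simp only [good, mem_filter, mem_univ, true_and]
      have := hx.2
      unfold Consec at this
      omega
  refine (card_le_card hsub).trans ((card_biUnion_le_card_mul _ _ _ fun z _ => hgood _ _).trans ?_)
  refine Nat.mul_le_mul_right _ ((card_union_le _ _).trans ?_)
  simp

/-- Restricting the extensions of `φ` to the free positions and values and relabelling these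
monotonically gives a uniformly random permutation of the remaining size, and changes the
property of having no shared edge only at the few seams. -/
theorem abs_card_tightExtensions_sub_le {n : ℕ} (Q : Finset (Fin n)) (φ : Equiv.Perm (Fin n)) :
    |(#(tightExtensions Q φ) : ℝ) - #(noConsec (n - #Q))| ≤
      4 * #Q * (n - #Q - 1).factorial + 4 * #Q * (n - #Q : ℕ) * (n - #Q - 2).factorial := by
  classical
  set N := n - #Q with hN
  have hQn : #Q ≤ n := by simpa using card_le_univ Q
  have hc1 : #(Qᶜ) = N := by rw [card_compl, Fintype.card_fin]
  have hc2 : #((Q.image φ)ᶜ) = N := by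
    rw [card_compl, Fintype.card_fin, card_image_of_injective _ φ.injective]
  set pos : Fin N ↪o Fin n := (Qᶜ).orderEmbOfFin hc1 with hpos
  set val : Fin N ↪o Fin n := ((Q.image φ)ᶜ).orderEmbOfFin hc2 with hval
  have pos_nmem : ∀ x, pos x ∉ Q := fun x => by
    have := (Qᶜ).orderEmbOfFin_mem hc1 x
    rwa [mem_compl] at this
  have val_nmem : ∀ x, val x ∉ Q.image φ := fun x => by
    have := ((Q.image φ)ᶜ).orderEmbOfFin_mem hc2 x
    rwa [mem_compl] at this
  have pos_surj : ∀ v, v ∉ Q → ∃ x, pos x = v := fun v hv => by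
    have := Finset.range_orderEmbOfFin (Qᶜ) hc1
    have h2 : v ∈ Set.range ((Qᶜ).orderEmbOfFin hc1) := by rw [this]; simpa using hv
    exact h2
  have val_surj : ∀ v, v ∉ Q.image φ → ∃ x, val x = v := fun v hv => by
    have := Finset.range_orderEmbOfFin ((Q.image φ)ᶜ) hc2
    have h2 : v ∈ Set.range (((Q.image φ)ᶜ).orderEmbOfFin hc2) := by
      rw [this]; exact mem_coe.2 (mem_compl.2 hv)
    exact h2
  -- every extension of `φ` restricts to a bijection of the free positions with the free values
  have hres : ∀ τ ∈ agreeing Q φ, ∃ π : Equiv.Perm (Fin N), ∀ x, val (π x) = τ (pos x) := by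
    intro τ hτ
    rw [mem_agreeing] at hτ
    have h1 : ∀ x, ∃ y, val y = τ (pos x) := by
      intro x
      apply val_surj
      intro h
      obtain ⟨p, hp, hpe⟩ := mem_image.1 h
      rw [← hτ p hp] at hpe
      exact pos_nmem x (τ.injective hpe ▸ hp)
    choose g hg using h1
    have hinj : Function.Injective g := by
      intro x y hxy
      have := hg x
      rw [hxy, hg y] at this
      exact (pos.injective (τ.injective this)).symm
    exact ⟨Equiv.ofBijective g (Finite.injective_iff_bijective.1 hinj), hg⟩
  choose! Ψ hΨ using hres
  have hΨinj : Set.InjOn Ψ (agreeing Q φ : Set (Equiv.Perm (Fin n))) := by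
    intro τ hτ τ' hτ' h
    ext1 p
    by_cases hp : p ∈ Q
    · rw [mem_agreeing.1 (mem_coe.1 hτ) p hp, mem_agreeing.1 (mem_coe.1 hτ') p hp]
    · obtain ⟨x, rfl⟩ := pos_surj p hp
      rw [← hΨ τ hτ, ← hΨ τ' hτ', h]
  have hΨim : (agreeing Q φ).image Ψ = univ := by
    rw [← card_eq_iff_eq_univ, card_image_of_injOn hΨinj, card_agreeing_perm,
      Fintype.card_perm, Fintype.card_fin]
  set S := skips pos
  set T := skips val
  have hS : #S ≤ #Q := card_skips_le pos Q pos_surj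
  have hT : #T ≤ #Q := by
    refine (card_skips_le val _ val_surj).trans ?_
    exact card_image_le
  have key1 : ∀ τ ∈ agreeing Q φ, τ ∉ mixedExtensions Q φ → Ψ τ ∈ noConsec N →
      τ ∈ tightExtensions Q φ := by
    intro τ hτ hm hno
    rw [tightExtensions, mem_filter]
    refine ⟨hτ, fun p hp => ?_⟩
    rw [mem_consecPos] at hp
    obtain ⟨hpn, hcon⟩ := hp
    set a : Fin n := ⟨p, by omega⟩ with ha
    set b : Fin n := ⟨p + 1, hpn⟩ with hb
    have hcon' : Consec (τ a) (τ b) := by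
      rw [permVal_of_lt τ (show p < n by omega), permVal_of_lt τ hpn] at hcon
      exact hcon
    have hab : Consec a b := Or.inl rfl
    have hab' : Consec b a := Or.inr rfl
    have hQa : a ∈ Q → p ∈ Q.image Fin.val := fun h => mem_image.2 ⟨a, h, rfl⟩
    have hQb : b ∈ Q → p + 1 ∈ Q.image Fin.val := fun h => mem_image.2 ⟨b, h, rfl⟩
    by_cases h1 : a ∈ Q <;> by_cases h2 : b ∈ Q
    · exact ⟨hQa h1, hQb h2⟩
    · exact absurd (mem_filter.2 ⟨hτ, a, b, h1, h2, hab, hcon'⟩) hm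
    · exact absurd (mem_filter.2 ⟨hτ, b, a, h2, h1, hab', Or.symm hcon'⟩) hm
    · exfalso
      obtain ⟨x, hx⟩ := pos_surj a h1
      obtain ⟨y, hy⟩ := pos_surj b h2
      have hxy : (x : ℕ) + 1 = y := by
        have h3 : Consec x y := consec_of_orderEmbedding pos (by rw [hx, hy]; exact hab)
        have h4 : x < y := by rw [← pos.lt_iff_lt, hx, hy, Fin.lt_def]; simp [ha, hb]
        rw [Fin.lt_def] at h4
        unfold Consec at h3
        omega
      have hc : Consec (Ψ τ x) (Ψ τ y) :=
        consec_of_orderEmbedding val (by rw [hΨ τ hτ, hΨ τ hτ, hx, hy]; exact hcon')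
      rw [noConsec, mem_filter] at hno
      have : (x : ℕ) ∈ consecPos (Ψ τ) := by
        rw [mem_consecPos]
        refine ⟨by omega, ?_⟩
        rw [hxy, permVal_coe, permVal_coe]
        exact hc
      rw [hno.2] at this
      simp at this
  have key2 : ∀ τ ∈ tightExtensions Q φ, Ψ τ ∉ seamPerms N S T → Ψ τ ∈ noConsec N := by
    intro τ hτ hseam
    rw [tightExtensions, mem_filter] at hτ
    obtain ⟨hτ, htight⟩ := hτ
    rw [noConsec, mem_filter]
    refine ⟨mem_univ _, ?_⟩
    rw [eq_empty_iff_forall_notMem]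
    intro x hx
    have hx' := hx
    rw [mem_consecPos] at hx'
    obtain ⟨hxN, hcon⟩ := hx'
    have hns : x ∉ S ∧ min (permVal (Ψ τ) x) (permVal (Ψ τ) (x + 1)) ∉ T := by
      constructor
      · exact fun h => hseam (mem_filter.2 ⟨mem_univ _, x, hx, Or.inl h⟩)
      · exact fun h => hseam (mem_filter.2 ⟨mem_univ _, x, hx, Or.inr h⟩)
    have hstep : (pos ⟨x, by omega⟩ : ℕ) + 1 = pos ⟨x + 1, hxN⟩ := by
      by_contra h
      refine hns.1 (mem_filter.2 ⟨mem_range.2 (by omega), ?_⟩)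
      rintro ⟨_, h'⟩
      exact h h'
    have hvstep : ∀ u v : Fin N, (u : ℕ) + 1 = v → (u : ℕ) ∉ T → (val u : ℕ) + 1 = val v := by
      intro u v huv hu
      by_contra h
      refine hu (mem_filter.2 ⟨mem_range.2 (by omega), ?_⟩)
      rintro ⟨_, h'⟩
      apply h
      convert h' using 3
      exact Fin.ext huv.symm
    have hvcon : Consec (val (Ψ τ ⟨x, by omega⟩)) (val (Ψ τ ⟨x + 1, hxN⟩)) := by
      rw [permVal_of_lt _ (show x < N by omega), permVal_of_lt _ hxN] at hcon
      have h2 := hns.2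
      rw [permVal_of_lt _ (show x < N by omega), permVal_of_lt _ hxN] at h2
      rcases hcon with h | h
      · left
        rw [min_eq_left (by omega)] at h2
        exact hvstep _ _ h h2
      · right
        rw [min_eq_right (by omega)] at h2
        exact hvstep _ _ h h2
    have hmem : (pos ⟨x, by omega⟩ : ℕ) ∈ consecPos τ := by
      rw [mem_consecPos]
      refine ⟨by rw [hstep]; exact Fin.is_lt _, ?_⟩
      rw [hstep, permVal_coe, permVal_coe, ← hΨ τ hτ, ← hΨ τ hτ]
      exact hvcon
    obtain ⟨q, hq, hqe⟩ := mem_image.1 (htight _ hmem).1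
    exact pos_nmem _ (Fin.ext hqe ▸ hq)
  have b1 : #(noConsec N) ≤ #(tightExtensions Q φ) + #(mixedExtensions Q φ) := by
    have : noConsec N ⊆ (tightExtensions Q φ ∪ mixedExtensions Q φ).image Ψ := by
      intro π hπ
      obtain ⟨τ, hτ, rfl⟩ := mem_image.1 (hΨim ▸ mem_univ π)
      refine mem_image_of_mem _ (mem_union.2 ?_)
      by_cases hm : τ ∈ mixedExtensions Q φ
      · exact Or.inr hm
      · exact Or.inl (key1 τ hτ hm hπ)
    exact (card_le_card this).trans (card_image_le.trans (card_union_le _ _))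
  have b2 : #(tightExtensions Q φ) ≤ #(noConsec N) + #(seamPerms N S T) := by
    have : (tightExtensions Q φ).image Ψ ⊆ noConsec N ∪ seamPerms N S T := by
      intro π hπ
      obtain ⟨τ, hτ, rfl⟩ := mem_image.1 hπ
      rw [mem_union]
      by_cases hm : Ψ τ ∈ seamPerms N S T
      · exact Or.inr hm
      · exact Or.inl (key2 τ hτ hm)
    rw [← card_image_of_injOn (s := tightExtensions Q φ)
      (hΨinj.mono fun τ hτ => (mem_filter.1 (mem_coe.1 hτ)).1)]
    exact (card_le_card this).trans (card_union_le _ _)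
  have b3 := card_mixedExtensions_le Q φ
  have b4 : #(seamPerms N S T) ≤ 4 * #Q * N * (N - 2).factorial := by
    refine (card_seamPerms_le S T).trans ?_
    calc _ ≤ (#Q * N + N * #Q) * (2 * (N - 2).factorial) := by gcongr
      _ = _ := by ring
  have b1' : (#(noConsec N) : ℝ) ≤ #(tightExtensions Q φ) + 4 * #Q * (N - 1).factorial := by
    exact_mod_cast b1.trans (Nat.add_le_add_left b3 _)
  have b2' : (#(tightExtensions Q φ) : ℝ) ≤ #(noConsec N) + 4 * #Q * N * (N - 2).factorial := by
    exact_mod_cast b2.trans (Nat.add_le_add_left b4 _)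
  have p1 : (0 : ℝ) ≤ 4 * #Q * (N - 1).factorial := by positivity
  have p2 : (0 : ℝ) ≤ 4 * #Q * N * (N - 2).factorial := by positivity
  rw [abs_le]
  constructor <;> linarith

open Filter Topology in
/-- Prescribing boundedly many values does not affect the limit probability `e⁻²` of having no
further shared edge, uniformly in the prescription. -/
theorem eventually_card_tightExtensions (r : ℕ) {ε : ℝ} (hε : 0 < ε) :
    ∀ᶠ n : ℕ in atTop, ∀ (Q : Finset (Fin n)) (φ : Equiv.Perm (Fin n)), #Q = r →
      |(#(tightExtensions Q φ) : ℝ) - Real.exp (-2) * (n - r).factorial|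
        ≤ ε * (n - r).factorial := by
  have hsub : Tendsto (fun n : ℕ => n - r) atTop atTop := tendsto_sub_atTop_nat r
  have h1 := tendsto_card_noConsec.comp hsub
  have h2 : Tendsto (fun N : ℕ => (8 * r : ℝ) / ((N : ℝ) - 1)) atTop (𝓝 0) :=
    Tendsto.div_atTop tendsto_const_nhds
      (tendsto_atTop_add_const_right _ _ tendsto_natCast_atTop_atTop)
  have h2' := h2.comp hsub
  filter_upwards [Metric.tendsto_nhds.1 h1 (ε / 2) (by positivity),
    Metric.tendsto_nhds.1 h2' (ε / 2) (by positivity), hsub.eventually_ge_atTop 2]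
    with n hn1 hn2 hn3 Q φ hQ
  have h3 := abs_card_tightExtensions_sub_le Q φ
  rw [hQ] at h3
  simp only [Function.comp] at hn1 hn2
  obtain ⟨k, hk⟩ : ∃ k, n - r = k + 2 := ⟨n - r - 2, by omega⟩
  rw [hk] at h3 hn1 hn2 ⊢
  rw [Real.dist_eq] at hn1 hn2
  rw [sub_zero, abs_of_nonneg (div_nonneg (by positivity)
    (by push_cast; have : (0 : ℝ) ≤ k := by positivity
        linarith))] at hn2
  have hf : (0 : ℝ) < (k + 2).factorial := by positivity
  have h4 : |(#(noConsec (k + 2)) : ℝ) - Real.exp (-2) * (k + 2).factorial|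
      ≤ ε / 2 * (k + 2).factorial := by
    have : (#(noConsec (k + 2)) : ℝ) - Real.exp (-2) * (k + 2).factorial =
        ((#(noConsec (k + 2)) : ℝ) / (k + 2).factorial - Real.exp (-2)) * (k + 2).factorial := by
      field_simp
    rw [this, abs_mul, abs_of_pos hf]
    gcongr
  have h5 : (4 * r * (k + 2 - 1).factorial + 4 * r * (k + 2 : ℕ) * (k + 2 - 2).factorial : ℝ) ≤
      (8 * r : ℝ) / (((k + 2 : ℕ) : ℝ) - 1) * (k + 2).factorial := by
    rw [show k + 2 - 1 = k + 1 by omega, show k + 2 - 2 = k by omega, Nat.factorial_succ (k + 1),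
      Nat.factorial_succ k]
    push_cast
    rw [show (k : ℝ) + 2 - 1 = k + 1 by ring, div_mul_eq_mul_div, le_div_iff₀ (by positivity)]
    have : (0 : ℝ) ≤ r * k.factorial * (k + 1) := by positivity
    nlinarith
  have h6 : (8 * r : ℝ) / (((k + 2 : ℕ) : ℝ) - 1) * (k + 2).factorial ≤
      ε / 2 * (k + 2).factorial := by gcongr
  calc _ ≤ |(#(tightExtensions Q φ) : ℝ) - #(noConsec (k + 2))| +
        |(#(noConsec (k + 2)) : ℝ) - Real.exp (-2) * (k + 2).factorial| := abs_sub_le _ _ _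
    _ ≤ ε / 2 * (k + 2).factorial + ε / 2 * (k + 2).factorial :=
        add_le_add (h3.trans (h5.trans h6)) h4
    _ = _ := by ring

/-! ### Merging two increasing chains -/

/-- The rank of `p` with respect to `A`: the number of elements of `A` below `p`. -/
def below (A : Finset ℕ) (p : ℕ) : ℕ := #{q ∈ A | q < p}

theorem below_lt_card {A : Finset ℕ} {p : ℕ} (hp : p ∈ A) : below A p < #A :=
  card_lt_card (filter_ssubset.2 ⟨p, hp, lt_irrefl p⟩)

theorem below_lt_below {A : Finset ℕ} {p q : ℕ} (hp : p ∈ A) (h : p < q) :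
    below A p < below A q := by
  refine card_lt_card ⟨fun x hx => ?_, fun hsub => ?_⟩
  · rw [mem_filter] at hx ⊢
    exact ⟨hx.1, hx.2.trans h⟩
  · have := hsub (mem_filter.2 ⟨hp, h⟩)
    exact lt_irrefl p (mem_filter.1 this).2

theorem below_image {m : ℕ} {a : Fin m → ℕ} (ha : StrictMono a) (i : Fin m) :
    below (univ.image a) (a i) = i := by
  have : {q ∈ univ.image a | q < a i} = (Iio i).image a := by
    ext q
    simp only [mem_filter, mem_image, mem_univ, true_and, mem_Iio]
    constructor
    · rintro ⟨⟨j, rfl⟩, h⟩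
      exact ⟨j, ha.lt_iff_lt.1 h, rfl⟩
    · rintro ⟨j, hj, rfl⟩
      exact ⟨⟨j, rfl⟩, ha hj⟩
  rw [below, this, card_image_of_injective _ ha.injective, Fin.card_Iio]

/-- Each rank below `#A` is attained. -/
theorem exists_below_eq {A : Finset ℕ} {m : ℕ} (h : #A = m) (i : Fin m) :
    ∃ p ∈ A, below A p = i := by
  refine ⟨A.orderEmbOfFin h i, A.orderEmbOfFin_mem h i, ?_⟩
  have h1 : univ.image (A.orderEmbOfFin h) = A := by
    ext x
    simp only [mem_image, mem_univ, true_and]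
    have := Finset.range_orderEmbOfFin A h
    exact Set.ext_iff.1 this x
  have h2 := below_image (A.orderEmbOfFin h).strictMono i
  rwa [h1] at h2

/-- The ways of merging two chains `e₁`, `e₂` of `m` edges into one chain of `u` edges: `A` and
`B` are the sets of places taken by the edges of `e₁` and of `e₂`, and common places must carry
common edges. -/
def merges {E : Type*} {m : ℕ} (e₁ e₂ : Fin m → E) (u : ℕ) : Set (Finset ℕ × Finset ℕ) :=
  {x | #x.1 = m ∧ #x.2 = m ∧ x.1 ∪ x.2 = range u ∧
    ∀ p ∈ x.1 ∩ x.2, ∀ i j : Fin m, below x.1 p = i → below x.2 p = j → e₁ i = e₂ j}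

theorem merges_finite {E : Type*} {m : ℕ} (e₁ e₂ : Fin m → E) (u : ℕ) :
    (merges e₁ e₂ u).Finite := by
  refine Set.Finite.subset ((range u).powerset ×ˢ (range u).powerset).finite_toSet ?_
  rintro ⟨A, B⟩ ⟨-, -, h, -⟩
  simp only at h
  simp only [coe_product, Set.mem_prod, mem_coe, mem_powerset]
  rw [← h]
  exact ⟨subset_union_left, subset_union_right⟩

section Merging

variable {E : Type*} {m u : ℕ} {e₁ e₂ : Fin m → E}

/-- The merged chain described by a pair of sets of places. -/
theorem exists_mergedChain {x : Finset ℕ × Finset ℕ} (hx : x ∈ merges e₁ e₂ u) :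
    ∃ g : Fin u → E, (∀ p : Fin u, (p : ℕ) ∈ x.1 → ∀ i : Fin m, below x.1 p = i → g p = e₁ i) ∧
      ∀ p : Fin u, (p : ℕ) ∈ x.2 → ∀ i : Fin m, below x.2 p = i → g p = e₂ i := by
  obtain ⟨A, B⟩ := x
  obtain ⟨hA, hB, hU, hc⟩ := hx
  simp only at hA hB hU hc
  have : ∀ p : Fin u, ∃ e : E, ((p : ℕ) ∈ A → ∀ i : Fin m, below A p = i → e = e₁ i) ∧
      ((p : ℕ) ∈ B → ∀ i : Fin m, below B p = i → e = e₂ i) := by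
    intro p
    by_cases h1 : (p : ℕ) ∈ A
    · refine ⟨e₁ ⟨below A p, hA ▸ below_lt_card h1⟩, fun _ i hi => ?_, fun h2 j hj => ?_⟩
      · exact congrArg e₁ (Fin.ext hi)
      · exact hc p (mem_inter.2 ⟨h1, h2⟩) _ j rfl hj
    · have h2 : (p : ℕ) ∈ B := by
        have : (p : ℕ) ∈ A ∪ B := by rw [hU]; exact mem_range.2 p.2
        exact (mem_union.1 this).resolve_left h1
      refine ⟨e₂ ⟨below B p, hB ▸ below_lt_card h2⟩, fun h => absurd h h1, fun _ j hj => ?_⟩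
      exact congrArg e₂ (Fin.ext hj)
  choose g hg1 hg2 using this
  exact ⟨g, hg1, hg2⟩

theorem exists_place {A : Finset ℕ} (hA : #A = m) (hAu : A ⊆ range u) {g : Fin u → E}
    {e : Fin m → E} (hg : ∀ p : Fin u, (p : ℕ) ∈ A → ∀ i : Fin m, below A p = i → g p = e i)
    (i : Fin m) : ∃ p : Fin u, (p : ℕ) ∈ A ∧ below A p = i ∧ g p = e i := by
  obtain ⟨p, hp, hpi⟩ := exists_below_eq hA i
  exact ⟨⟨p, mem_range.1 (hAu hp)⟩, hp, hpi, hg ⟨p, mem_range.1 (hAu hp)⟩ hp i hpi⟩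

theorem strictMono_of_mergedChain {L : Type*} [LinearOrder L] {A : Finset ℕ} (hA : #A = m)
    (hAu : A ⊆ range u) {g : Fin u → E} {e : Fin m → E}
    (hg : ∀ p : Fin u, (p : ℕ) ∈ A → ∀ i : Fin m, below A p = i → g p = e i)
    {f : E → L} (hf : StrictMono (f ∘ g)) : StrictMono (f ∘ e) := by
  intro i j hij
  obtain ⟨p, hp, hpi, hpe⟩ := exists_place hA hAu hg i
  obtain ⟨q, hq, hqj, hqe⟩ := exists_place hA hAu hg j
  have hpq : p < q := by
    rcases lt_trichotomy p q with h | h | h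
    · exact h
    · subst h; rw [hpi] at hqj; rw [Fin.lt_def] at hij; omega
    · have := below_lt_below hq (Fin.lt_def.1 h)
      rw [Fin.lt_def] at hij; omega
  have := hf hpq
  simpa [hpe, hqe] using this

theorem mem_place_iff {A : Finset ℕ} (hA : #A = m) (hAu : A ⊆ range u) {g : Fin u → E}
    (hgi : Function.Injective g) {e : Fin m → E}
    (hg : ∀ p : Fin u, (p : ℕ) ∈ A → ∀ i : Fin m, below A p = i → g p = e i) (p : Fin u) :
    (p : ℕ) ∈ A ↔ ∃ i, g p = e i := by
  constructor
  · intro h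
    exact ⟨⟨below A p, hA ▸ below_lt_card h⟩, hg p h _ rfl⟩
  · rintro ⟨i, hi⟩
    obtain ⟨q, hq, -, hqe⟩ := exists_place hA hAu hg i
    rw [← hqe] at hi
    rw [hgi hi]
    exact hq

variable [DecidableEq E]

theorem image_mergedChain {x : Finset ℕ × Finset ℕ} (hx : x ∈ merges e₁ e₂ u) {g : Fin u → E}
    (hg1 : ∀ p : Fin u, (p : ℕ) ∈ x.1 → ∀ i : Fin m, below x.1 p = i → g p = e₁ i)
    (hg2 : ∀ p : Fin u, (p : ℕ) ∈ x.2 → ∀ i : Fin m, below x.2 p = i → g p = e₂ i) :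
    univ.image g = univ.image e₁ ∪ univ.image e₂ := by
  obtain ⟨A, B⟩ := x
  obtain ⟨hA, hB, hU, hc⟩ := hx
  simp only at hA hB hU hc hg1 hg2
  have hAu : A ⊆ range u := hU ▸ subset_union_left
  have hBu : B ⊆ range u := hU ▸ subset_union_right
  ext e
  simp only [mem_image, mem_univ, true_and, mem_union]
  constructor
  · rintro ⟨p, rfl⟩
    have : (p : ℕ) ∈ A ∪ B := by rw [hU]; exact mem_range.2 p.2
    rcases mem_union.1 this with h | h
    · exact Or.inl ⟨⟨below A p, hA ▸ below_lt_card h⟩, (hg1 p h _ rfl).symm⟩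
    · exact Or.inr ⟨⟨below B p, hB ▸ below_lt_card h⟩, (hg2 p h _ rfl).symm⟩
  · rintro (⟨i, rfl⟩ | ⟨i, rfl⟩)
    · obtain ⟨p, -, -, h⟩ := exists_place hA hAu hg1 i
      exact ⟨p, h⟩
    · obtain ⟨p, -, -, h⟩ := exists_place hB hBu hg2 i
      exact ⟨p, h⟩

variable [Fintype E] {L : Type*} [LinearOrder L] [Fintype L]

/-- The number of labellings that increase along both of two chains is governed by the number of
ways of merging the chains. -/
theorem card_strictMono_pair
    (hu : #(univ.image e₁ ∪ univ.image e₂) = u) :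
    #{f : E ≃ L | StrictMono (f ∘ e₁) ∧ StrictMono (f ∘ e₂)} * u.factorial =
      Fintype.card (E ≃ L) * (merges e₁ e₂ u).ncard := by
  classical
  have : Nonempty (Fin u → E) :=
    ⟨fun p => ((univ.image e₁ ∪ univ.image e₂).equivFinOfCardEq hu).symm p⟩
  choose! g hg1 hg2 using fun x (hx : x ∈ merges e₁ e₂ u) => exists_mergedChain hx
  set W := (merges_finite e₁ e₂ u).toFinset with hW
  have hWm : ∀ x, x ∈ W ↔ x ∈ merges e₁ e₂ u := fun x => Set.Finite.mem_toFinset _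
  have hginj : ∀ x ∈ W, Function.Injective (g x) := by
    intro x hx
    rw [hWm] at hx
    have him := image_mergedChain hx (hg1 x hx) (hg2 x hx)
    have : #(univ.image (g x)) = #(univ : Finset (Fin u)) := by
      rw [him, hu, card_univ, Fintype.card_fin]
    rw [card_image_iff] at this
    exact fun a b hab => this (mem_univ a) (mem_univ b) hab
  have hunion : ({f : E ≃ L | StrictMono (f ∘ e₁) ∧ StrictMono (f ∘ e₂)} : Finset (E ≃ L)) =
      W.biUnion fun x => {f : E ≃ L | StrictMono (f ∘ g x)} := by
    ext f
    simp only [mem_filter, mem_univ, true_and, mem_biUnion]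
    constructor
    · rintro ⟨hf1, hf2⟩
      -- list the union of the two chains in increasing order of labels
      set U := univ.image e₁ ∪ univ.image e₂ with hU
      have hc : #(U.image f) = u := by rw [card_image_of_injective _ f.injective, hu]
      set s : Fin u → E := fun p => f.symm ((U.image f).orderEmbOfFin hc p) with hs
      have hfs : StrictMono (f ∘ s) := by
        intro p q hpq
        simpa [hs] using hpq
      have hsurj : ∀ e ∈ U, ∃ p, s p = e := by
        intro e he
        have h3 : f e ∈ Set.range ((U.image f).orderEmbOfFin hc) := by
          rw [Finset.range_orderEmbOfFin]
          exact mem_coe.2 (mem_image_of_mem f he)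
        obtain ⟨p, hp⟩ := h3
        exact ⟨p, by simp [hs, hp]⟩
      have hsU : ∀ p, s p ∈ U := by
        intro p
        have h3 := (U.image f).orderEmbOfFin_mem hc p
        obtain ⟨e, he, hee⟩ := mem_image.1 h3
        simp only [hs, ← hee, Equiv.symm_apply_apply]
        exact he
      choose a ha using fun i => hsurj (e₁ i) (mem_union_left _ (mem_image_of_mem e₁ (mem_univ i)))
      choose b hb using fun i => hsurj (e₂ i) (mem_union_right _ (mem_image_of_mem e₂ (mem_univ i)))
      have hamono : StrictMono fun i => (a i : ℕ) := by
        intro i j hij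
        have := hf1 hij
        simp only [Function.comp, ← ha] at this
        exact Fin.lt_def.1 (hfs.lt_iff_lt.1 this)
      have hbmono : StrictMono fun i => (b i : ℕ) := by
        intro i j hij
        have := hf2 hij
        simp only [Function.comp, ← hb] at this
        exact Fin.lt_def.1 (hfs.lt_iff_lt.1 this)
      set x : Finset ℕ × Finset ℕ :=
        (univ.image fun i => (a i : ℕ), univ.image fun i => (b i : ℕ)) with hx
      have hx1 : ∀ p : Fin u, (p : ℕ) ∈ x.1 → ∀ i : Fin m, below x.1 p = i → s p = e₁ i := by
        intro p hp i hi
        obtain ⟨j, -, hj⟩ := mem_image.1 hp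
        rw [← hj, below_image hamono] at hi
        rw [← Fin.ext hi, ← ha]
        exact congrArg s (Fin.ext hj.symm)
      have hx2 : ∀ p : Fin u, (p : ℕ) ∈ x.2 → ∀ i : Fin m, below x.2 p = i → s p = e₂ i := by
        intro p hp i hi
        obtain ⟨j, -, hj⟩ := mem_image.1 hp
        rw [← hj, below_image hbmono] at hi
        rw [← Fin.ext hi, ← hb]
        exact congrArg s (Fin.ext hj.symm)
      have hxu : x.1 ∪ x.2 = range u := by
        ext p
        simp only [mem_union, mem_range]
        constructor
        · rintro (h | h) <;> obtain ⟨j, -, rfl⟩ := mem_image.1 h <;> exact Fin.is_lt _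
        · intro hp
          rcases mem_union.1 (hsU ⟨p, hp⟩) with h | h
          · obtain ⟨i, -, hi⟩ := mem_image.1 h
            rw [← ha] at hi
            refine Or.inl (mem_image.2 ⟨i, mem_univ i, ?_⟩)
            have := hfs.injective (congrArg f hi)
            rw [this]
          · obtain ⟨i, -, hi⟩ := mem_image.1 h
            rw [← hb] at hi
            refine Or.inr (mem_image.2 ⟨i, mem_univ i, ?_⟩)
            have := hfs.injective (congrArg f hi)
            rw [this]
      have hxm : x ∈ merges e₁ e₂ u := by
        refine ⟨?_, ?_, hxu, ?_⟩
        · rw [card_image_of_injective _ hamono.injective, card_univ, Fintype.card_fin]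
        · rw [card_image_of_injective _ hbmono.injective, card_univ, Fintype.card_fin]
        · intro p hp i j hi hj
          rw [mem_inter] at hp
          have hpu : p < u := by
            rw [← mem_range, ← hxu]; exact mem_union_left _ hp.1
          rw [← hx1 ⟨p, hpu⟩ hp.1 i hi, ← hx2 ⟨p, hpu⟩ hp.2 j hj]
      refine ⟨x, (hWm x).2 hxm, ?_⟩
      have : g x = s := by
        funext p
        have hp : (p : ℕ) ∈ x.1 ∪ x.2 := by rw [hxu]; exact mem_range.2 p.2
        rcases mem_union.1 hp with h | h
        · have hlt := below_lt_card h
          rw [hxm.1] at hlt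
          rw [hg1 x hxm p h ⟨_, hlt⟩ rfl, hx1 p h ⟨_, hlt⟩ rfl]
        · have hlt := below_lt_card h
          rw [hxm.2.1] at hlt
          rw [hg2 x hxm p h ⟨_, hlt⟩ rfl, hx2 p h ⟨_, hlt⟩ rfl]
      rw [this]
      exact hfs
    · rintro ⟨x, hx, hf⟩
      rw [hWm] at hx
      have hAu : x.1 ⊆ range u := hx.2.2.1 ▸ subset_union_left
      have hBu : x.2 ⊆ range u := hx.2.2.1 ▸ subset_union_right
      exact ⟨strictMono_of_mergedChain hx.1 hAu (hg1 x hx) hf,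
        strictMono_of_mergedChain hx.2.1 hBu (hg2 x hx) hf⟩
  have hdisj : (W : Set (Finset ℕ × Finset ℕ)).PairwiseDisjoint
      fun x => ({f : E ≃ L | StrictMono (f ∘ g x)} : Finset (E ≃ L)) := by
    intro x hx y hy hne
    rw [Function.onFun, Finset.disjoint_left]
    intro f hf hf'
    simp only [mem_filter, mem_univ, true_and] at hf hf'
    apply hne
    have hx' := (hWm x).1 hx
    have hy' := (hWm y).1 hy
    have hgg : g x = g y := by
      have hr : Set.range (f ∘ g x) = Set.range (f ∘ g y) := by
        have i1 := image_mergedChain hx' (hg1 x hx') (hg2 x hx')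
        have i2 := image_mergedChain hy' (hg1 y hy') (hg2 y hy')
        rw [Set.range_comp, Set.range_comp]
        congr 1
        have r : ∀ h : Fin u → E, Set.range h = ((univ.image h : Finset E) : Set E) := by
          intro h; simp
        rw [r, r, i1, i2]
      have := (hf.range_inj hf').1 hr
      funext p
      exact f.injective (congrFun this p)
    have hAx : x.1 ⊆ range u := hx'.2.2.1 ▸ subset_union_left
    have hBx : x.2 ⊆ range u := hx'.2.2.1 ▸ subset_union_right
    have hAy : y.1 ⊆ range u := hy'.2.2.1 ▸ subset_union_left
    have hBy : y.2 ⊆ range u := hy'.2.2.1 ▸ subset_union_right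
    have mem1 : ∀ p : Fin u, (p : ℕ) ∈ x.1 ↔ (p : ℕ) ∈ y.1 := fun p => by
      rw [mem_place_iff hx'.1 hAx (hginj x hx) (hg1 x hx'),
        mem_place_iff hy'.1 hAy (hginj y hy) (hg1 y hy'), hgg]
    have mem2 : ∀ p : Fin u, (p : ℕ) ∈ x.2 ↔ (p : ℕ) ∈ y.2 := fun p => by
      rw [mem_place_iff hx'.2.1 hBx (hginj x hx) (hg2 x hx'),
        mem_place_iff hy'.2.1 hBy (hginj y hy) (hg2 y hy'), hgg]
    refine Prod.ext ?_ ?_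
    · ext p
      exact ⟨fun h => (mem1 ⟨p, mem_range.1 (hAx h)⟩).1 h,
        fun h => (mem1 ⟨p, mem_range.1 (hAy h)⟩).2 h⟩
    · ext p
      exact ⟨fun h => (mem2 ⟨p, mem_range.1 (hBx h)⟩).1 h,
        fun h => (mem2 ⟨p, mem_range.1 (hBy h)⟩).2 h⟩
  rw [hunion, card_biUnion hdisj, sum_mul,
    sum_congr rfl fun x hx => card_strictMono_comp (L := L) (g x) (hginj x hx), sum_const,
    smul_eq_mul, mul_comm, Set.ncard_eq_toFinset_card _ (merges_finite e₁ e₂ u)]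

end Merging

/-- The `i`-th edge of the identity path is the `j`-th edge of the path `τ`. -/
def SharedEdge {n : ℕ} (τ : Equiv.Perm (Fin n)) (i j : ℕ) : Prop :=
  (permVal τ j = i ∧ permVal τ (j + 1) = i + 1) ∨ (permVal τ j = i + 1 ∧ permVal τ (j + 1) = i)

theorem pathEdge_one_eq_iff {n : ℕ} (τ : Equiv.Perm (Fin n)) (i j : Fin (n - 1)) :
    pathEdge 1 i = pathEdge τ j ↔ SharedEdge τ i j := by
  rw [SharedEdge, permVal_of_lt τ (show (j : ℕ) < n by omega),
    permVal_of_lt τ (show (j : ℕ) + 1 < n by omega), Subtype.ext_iff]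
  simp only [pathEdge, Equiv.Perm.coe_one, id, Sym2.eq_iff, Fin.ext_iff]
  constructor <;> rintro (h | h) <;> omega

/-- The identity path and the path `τ` share as many edges as `τ` has consecutive positions. -/
theorem card_union_pathEdge {n : ℕ} (τ : Equiv.Perm (Fin n)) :
    #(univ.image (pathEdge 1) ∪ univ.image (pathEdge τ)) = 2 * (n - 1) - #(consecPos τ) := by
  classical
  have h : univ.image (pathEdge (1 : Equiv.Perm (Fin n))) ∩ univ.image (pathEdge τ) =
      ({j : Fin (n - 1) | (j : ℕ) ∈ consecPos τ} : Finset _).image (pathEdge τ) := by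
    ext e
    simp only [mem_inter, mem_image, mem_univ, true_and, mem_filter]
    constructor
    · rintro ⟨⟨i, hi⟩, j, rfl⟩
      refine ⟨j, ?_, rfl⟩
      rw [pathEdge_one_eq_iff] at hi
      rw [mem_consecPos]
      refine ⟨by omega, ?_⟩
      unfold SharedEdge at hi
      unfold Consec
      omega
    · rintro ⟨j, hj, rfl⟩
      refine ⟨?_, j, rfl⟩
      rw [mem_consecPos] at hj
      have h1 := permVal_lt τ (show (j : ℕ) < n by omega)
      have h2 := permVal_lt τ hj.1
      have h3 := hj.2
      unfold Consec at h3
      refine ⟨⟨min (permVal τ j) (permVal τ (j + 1)), by omega⟩, ?_⟩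
      rw [pathEdge_one_eq_iff]
      unfold SharedEdge
      simp only
      omega
  have h1 := card_union_add_card_inter (univ.image (pathEdge (1 : Equiv.Perm (Fin n))))
    (univ.image (pathEdge τ))
  rw [h, card_image_of_injective _ (pathEdge_injective _),
    card_image_of_injective _ (pathEdge_injective _),
    card_image_of_injective _ (pathEdge_injective _), card_univ, Fintype.card_fin] at h1
  have h2 : #({j : Fin (n - 1) | (j : ℕ) ∈ consecPos τ} : Finset _) = #(consecPos τ) := by
    rw [← card_map Fin.valEmbedding]
    congr 1
    ext p
    simp only [mem_map, mem_filter, mem_univ, true_and, Fin.valEmbedding_apply]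
    constructor
    · rintro ⟨j, hj, rfl⟩; exact hj
    · intro hp
      have := (mem_consecPos τ p).1 hp
      exact ⟨⟨p, by omega⟩, hp, rfl⟩
  omega

/-- The merged orders of the edges of the identity path and of the path `τ`, as pairs of sets of
places in a chain of length `2 (n - 1) - k`, where `k` is the number of shared edges. -/
def words {n : ℕ} (τ : Equiv.Perm (Fin n)) : Set (Finset ℕ × Finset ℕ) :=
  {x | #x.1 = n - 1 ∧ #x.2 = n - 1 ∧ x.1 ∪ x.2 = range (2 * (n - 1) - #(consecPos τ)) ∧
    ∀ p ∈ x.1 ∩ x.2, SharedEdge τ (below x.1 p) (below x.2 p)}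

theorem words_eq_merges {n : ℕ} (τ : Equiv.Perm (Fin n)) :
    words τ = merges (pathEdge 1) (pathEdge τ) (2 * (n - 1) - #(consecPos τ)) := by
  ext ⟨A, B⟩
  simp only [words, merges, Set.mem_ofPred_eq]
  refine and_congr_right fun hA => and_congr_right fun hB => and_congr_right fun _ => ?_
  refine forall₂_congr fun p hp => ?_
  rw [mem_inter] at hp
  constructor
  · intro h i j hi hj
    rw [pathEdge_one_eq_iff, ← hi, ← hj]
    exact h
  · intro h
    have := h ⟨_, hA ▸ below_lt_card hp.1⟩ ⟨_, hB ▸ below_lt_card hp.2⟩ rfl rfl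
    rwa [pathEdge_one_eq_iff] at this

theorem words_finite {n : ℕ} (τ : Equiv.Perm (Fin n)) : (words τ).Finite := by
  rw [words_eq_merges]
  exact merges_finite _ _ _

open Classical in
/-- The probability that the identity path and the path `τ` are both increasing. -/
theorem card_isIncreasing_pair {n : ℕ} (τ : Equiv.Perm (Fin n)) :
    #{f : EdgeOrdering n | IsIncreasing f 1 ∧ IsIncreasing f τ} *
      (2 * (n - 1) - #(consecPos τ)).factorial = (n.choose 2).factorial * (words τ).ncard := by
  rw [← card_edgeOrdering, words_eq_merges]
  convert card_strictMono_pair (L := Finset.Icc 1 (n.choose 2)) (e₁ := pathEdge 1)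
    (e₂ := pathEdge τ) ?_
  · exact Iff.rfl
  · exact Iff.rfl
  · convert card_union_pathEdge τ

/-! ### Sets of places as unions of runs -/

section Runs

variable {c : ℕ}

/-- The total length of the runs before the `j`-th one. -/
def runOffset (ℓ : Fin c → ℕ) (j : Fin c) : ℕ := ∑ i ∈ Iio j, ℓ i

/-- The place where the `j`-th run starts, when the runs of lengths `ℓ` are inserted into the
slots `P` of a word (the slot `s` follows the first `s` letters of the word). -/
def runStart (ℓ P : Fin c → ℕ) (j : Fin c) : ℕ := P j + runOffset ℓ j

/-- The places occupied by runs of lengths `ℓ` that are inserted into the slots `P`. -/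
def runSet (ℓ P : Fin c → ℕ) : Finset ℕ :=
  univ.biUnion fun j => Ico (runStart ℓ P j) (runStart ℓ P j + ℓ j)

theorem runOffset_add_le (ℓ : Fin c → ℕ) {i j : Fin c} (h : i < j) :
    runOffset ℓ i + ℓ i ≤ runOffset ℓ j := by
  have : insert i (Iio i) ⊆ Iio j := by
    intro x hx
    rw [mem_insert, mem_Iio] at hx
    rw [mem_Iio]
    rcases hx with rfl | hx
    · exact h
    · exact hx.trans h
  have h2 := sum_le_sum_of_subset (f := ℓ) this
  rw [sum_insert (by simp)] at h2
  unfold runOffset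
  omega

theorem runOffset_add_le_sum (ℓ : Fin c → ℕ) (j : Fin c) :
    runOffset ℓ j + ℓ j ≤ ∑ i, ℓ i := by
  have h2 := sum_le_sum_of_subset (f := ℓ) (subset_univ (insert j (Iio j)))
  rw [sum_insert (by simp)] at h2
  unfold runOffset
  omega

theorem runStart_add_le (ℓ P : Fin c → ℕ) {i j : Fin c} (h : i < j) :
    runStart ℓ P i + ℓ i + P j ≤ runStart ℓ P j + P i := by
  have := runOffset_add_le ℓ h
  unfold runStart
  omega

theorem mem_runSet {ℓ P : Fin c → ℕ} {p : ℕ} :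
    p ∈ runSet ℓ P ↔ ∃ j, ∃ i < ℓ j, p = runStart ℓ P j + i := by
  simp only [runSet, mem_biUnion, mem_univ, true_and, mem_Ico]
  refine exists_congr fun j => ⟨fun h => ⟨p - runStart ℓ P j, by omega, by omega⟩, ?_⟩
  rintro ⟨i, hi, rfl⟩
  omega

theorem runSet_pairwiseDisjoint (ℓ : Fin c → ℕ) {P : Fin c → ℕ} (hP : Monotone P)
    (S : Set (Fin c)) :
    S.PairwiseDisjoint fun j => Ico (runStart ℓ P j) (runStart ℓ P j + ℓ j) := by
  intro i _ j _ hij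
  rw [Function.onFun, Finset.disjoint_left]
  intro x hx hx'
  rw [mem_Ico] at hx hx'
  rcases lt_or_gt_of_ne hij with h | h
  · have := runStart_add_le ℓ P h
    have := hP h.le
    omega
  · have := runStart_add_le ℓ P h
    have := hP h.le
    omega

theorem card_runSet (ℓ : Fin c → ℕ) {P : Fin c → ℕ} (hP : Monotone P) :
    #(runSet ℓ P) = ∑ j, ℓ j := by
  rw [runSet, card_biUnion (runSet_pairwiseDisjoint ℓ hP _)]
  simp

theorem runSet_subset_range {ℓ P : Fin c → ℕ} {N : ℕ} (hPN : ∀ j, P j ≤ N) :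
    runSet ℓ P ⊆ range (N + ∑ j, ℓ j) := by
  intro p hp
  obtain ⟨j, i, hi, rfl⟩ := mem_runSet.1 hp
  have := runOffset_add_le_sum ℓ j
  have := hPN j
  rw [mem_range]
  unfold runStart
  omega

theorem below_runSet (ℓ : Fin c → ℕ) {P : Fin c → ℕ} (hP : Monotone P) (j : Fin c) {i : ℕ}
    (hi : i ≤ ℓ j) : below (runSet ℓ P) (runStart ℓ P j + i) = runOffset ℓ j + i := by
  have : {q ∈ runSet ℓ P | q < runStart ℓ P j + i} =
      ((Iio j).biUnion fun j' => Ico (runStart ℓ P j') (runStart ℓ P j' + ℓ j')) ∪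
        Ico (runStart ℓ P j) (runStart ℓ P j + i) := by
    ext q
    simp only [mem_filter, mem_runSet, mem_union, mem_biUnion, mem_Iio, mem_Ico]
    constructor
    · rintro ⟨⟨j', i', hi', rfl⟩, h⟩
      rcases lt_trichotomy j' j with h1 | h1 | h1
      · exact Or.inl ⟨j', h1, by omega⟩
      · subst h1; exact Or.inr (by omega)
      · have := runStart_add_le ℓ P h1
        have := hP h1.le
        omega
    · rintro (⟨j', h1, h2⟩ | h)
      · have := runStart_add_le ℓ P h1
        have := hP h1.le
        exact ⟨⟨j', q - runStart ℓ P j', by omega, by omega⟩, by omega⟩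
      · exact ⟨⟨j, q - runStart ℓ P j, by omega, by omega⟩, by omega⟩
  rw [below, this, card_union_of_disjoint, card_biUnion (runSet_pairwiseDisjoint ℓ hP _)]
  · simp [runOffset]
  · rw [Finset.disjoint_left]
    intro x hx hx'
    simp only [mem_biUnion, mem_Iio, mem_Ico] at hx hx'
    obtain ⟨j', h1, h2⟩ := hx
    have := runStart_add_le ℓ P h1
    have := hP h1.le
    omega

/-- The slot of the place `p`: the number of places below `p` outside `D`. -/
def slotOf (D : Finset ℕ) (p : ℕ) : ℕ := p - below D p

theorem below_le (D : Finset ℕ) (p : ℕ) : below D p ≤ p := by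
  have : {q ∈ D | q < p} ⊆ range p := fun x hx => mem_range.2 (mem_filter.1 hx).2
  simpa [below] using card_le_card this

theorem slotOf_eq_card (D : Finset ℕ) (p : ℕ) : slotOf D p = #(range p \ D) := by
  have h := card_sdiff_add_card_inter (range p) D
  have h2 : range p ∩ D = {q ∈ D | q < p} := by
    ext q
    simp only [mem_inter, mem_range, mem_filter]
    tauto
  rw [h2, card_range] at h
  unfold slotOf below
  omega

theorem slotOf_mono (D : Finset ℕ) : Monotone (slotOf D) := by
  intro p q h
  rw [slotOf_eq_card, slotOf_eq_card]
  exact card_le_card (sdiff_subset_sdiff (range_subset_range.2 h) subset_rfl)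

theorem slotOf_runSet (ℓ : Fin c → ℕ) {P : Fin c → ℕ} (hP : Monotone P) (j : Fin c) {i : ℕ}
    (hi : i ≤ ℓ j) : slotOf (runSet ℓ P) (runStart ℓ P j + i) = P j := by
  rw [slotOf, below_runSet ℓ hP j hi, runStart]
  omega

theorem image_slotOf_runSet {ℓ : Fin c → ℕ} (hℓ : ∀ j, 0 < ℓ j) {P : Fin c → ℕ}
    (hP : Monotone P) : (runSet ℓ P).image (slotOf (runSet ℓ P)) = univ.image P := by
  ext s
  simp only [mem_image, mem_univ, true_and]
  constructor
  · rintro ⟨p, hp, rfl⟩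
    obtain ⟨j, i, hi, rfl⟩ := mem_runSet.1 hp
    exact ⟨j, (slotOf_runSet ℓ hP j hi.le).symm⟩
  · rintro ⟨j, rfl⟩
    exact ⟨runStart ℓ P j + 0, mem_runSet.2 ⟨j, 0, hℓ j, rfl⟩, slotOf_runSet ℓ hP j (Nat.zero_le _)⟩

theorem card_slotOf_eq {ℓ : Fin c → ℕ} {P : Fin c → ℕ} (hP : StrictMono P) (j : Fin c) :
    #{p ∈ runSet ℓ P | slotOf (runSet ℓ P) p = P j} = ℓ j := by
  have : {p ∈ runSet ℓ P | slotOf (runSet ℓ P) p = P j} =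
      Ico (runStart ℓ P j) (runStart ℓ P j + ℓ j) := by
    ext p
    rw [mem_filter, mem_Ico]
    constructor
    · rintro ⟨hp, h⟩
      obtain ⟨j', i, hi, rfl⟩ := mem_runSet.1 hp
      rw [slotOf_runSet ℓ hP.monotone j' hi.le] at h
      rw [hP.injective h] at hi ⊢
      omega
    · intro h
      obtain ⟨i, rfl⟩ : ∃ i, p = runStart ℓ P j + i := ⟨p - runStart ℓ P j, by omega⟩
      exact ⟨mem_runSet.2 ⟨j, i, by omega, rfl⟩, slotOf_runSet ℓ hP.monotone j (by omega)⟩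
  rw [this]
  simp

theorem strictMono_eq_of_image_eq {α : Type*} [LinearOrder α] {P P' : Fin c → α}
    (hP : StrictMono P) (hP' : StrictMono P') (h : univ.image P = univ.image P') : P = P' := by
  refine (hP.range_inj hP').1 ?_
  have h2 : ((univ.image P : Finset α) : Set α) = (univ.image P' : Finset α) := by rw [h]
  simpa using h2

/-- A set of places determines its maximal runs and their slots. -/
theorem runSet_injective {ℓ ℓ' P P' : Fin c → ℕ} (hℓ : ∀ j, 0 < ℓ j) (hℓ' : ∀ j, 0 < ℓ' j)
    (hP : StrictMono P) (hP' : StrictMono P') (h : runSet ℓ P = runSet ℓ' P') :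
    ℓ = ℓ' ∧ P = P' := by
  have h1 := image_slotOf_runSet hℓ hP.monotone
  rw [h, image_slotOf_runSet hℓ' hP'.monotone] at h1
  have hPP : P = P' := strictMono_eq_of_image_eq hP hP' h1.symm
  subst hPP
  refine ⟨funext fun j => ?_, rfl⟩
  rw [← card_slotOf_eq (ℓ := ℓ) hP j, h, card_slotOf_eq hP j]

theorem card_eq_of_runSet_eq {c' : ℕ} {ℓ P : Fin c → ℕ} {ℓ' P' : Fin c' → ℕ}
    (hℓ : ∀ j, 0 < ℓ j) (hℓ' : ∀ j, 0 < ℓ' j)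
    (hP : StrictMono P) (hP' : StrictMono P') (h : runSet ℓ P = runSet ℓ' P') : c = c' := by
  have h1 := image_slotOf_runSet hℓ hP.monotone
  rw [h, image_slotOf_runSet hℓ' hP'.monotone] at h1
  have h2 := congrArg card h1
  rw [card_image_of_injective _ hP.injective, card_image_of_injective _ hP'.injective] at h2
  simpa using h2.symm

/-- Every set of places is a union of runs inserted into distinct slots. -/
theorem exists_runSet_eq {N : ℕ} {D : Finset ℕ} (hD : D ⊆ range (N + #D)) :
    ∃ (c : ℕ) (ℓ P : Fin c → ℕ), (∀ j, 0 < ℓ j) ∧ StrictMono P ∧ (∀ j, P j ≤ N) ∧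
      runSet ℓ P = D := by
  set S := D.image (slotOf D) with hS
  set P : Fin #S → ℕ := fun j => S.orderEmbOfFin rfl j with hPdef
  have hP : StrictMono P := (S.orderEmbOfFin rfl).strictMono
  have hPS : ∀ j, ∃ p ∈ D, slotOf D p = P j := fun j =>
    mem_image.1 (S.orderEmbOfFin_mem rfl j)
  have hSP : ∀ p ∈ D, ∃ j, P j = slotOf D p := fun p hp => by
    have h1 : slotOf D p ∈ Set.range (S.orderEmbOfFin rfl) := by
      rw [Finset.range_orderEmbOfFin]
      exact mem_coe.2 (mem_image_of_mem _ hp)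
    exact h1
  set ℓ : Fin #S → ℕ := fun j => #{p ∈ D | slotOf D p = P j} with hℓ
  have hsum : ∀ I : Finset (Fin #S), ∑ j ∈ I, ℓ j = #{p ∈ D | ∃ j ∈ I, slotOf D p = P j} := by
    intro I
    rw [← card_biUnion]
    · congr 1
      ext p
      simp only [mem_biUnion, mem_filter]
      constructor
      · rintro ⟨j, hj, h1, h2⟩; exact ⟨h1, j, hj, h2⟩
      · rintro ⟨h1, j, hj, h2⟩; exact ⟨j, hj, h1, h2⟩
    · intro i _ j _ hij
      rw [Function.onFun, Finset.disjoint_left]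
      intro p hp hp'
      rw [mem_filter] at hp hp'
      exact hij (hP.injective (hp.2.symm.trans hp'.2))
  have htot : ∑ j, ℓ j = #D := by
    rw [hsum, filter_true_of_mem]
    intro p hp
    obtain ⟨j, hj⟩ := hSP p hp
    exact ⟨j, mem_univ j, hj.symm⟩
  refine ⟨#S, ℓ, P, ?_, hP, ?_, ?_⟩
  · intro j
    obtain ⟨p, hp, h⟩ := hPS j
    exact card_pos.2 ⟨p, mem_filter.2 ⟨hp, h⟩⟩
  · intro j
    obtain ⟨p, hp, h⟩ := hPS j
    rw [← h, slotOf_eq_card]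
    have h1 : range p \ D ⊆ range (N + #D) \ D :=
      sdiff_subset_sdiff (range_subset_range.2 (mem_range.1 (hD hp)).le) subset_rfl
    have h2 := card_le_card h1
    rw [card_sdiff_of_subset hD, card_range] at h2
    omega
  · symm
    refine eq_of_subset_of_card_le ?_ (by rw [card_runSet ℓ hP.monotone, htot])
    intro p hp
    obtain ⟨j, hj⟩ := hSP p hp
    have hoff : runOffset ℓ j ≤ below D p := by
      rw [runOffset, hsum]
      refine card_le_card fun q hq => ?_
      rw [mem_filter] at hq ⊢
      obtain ⟨hq1, i, hi, hq2⟩ := hq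
      refine ⟨hq1, ?_⟩
      by_contra hpq
      have h1 := slotOf_mono D (not_lt.1 hpq)
      rw [hq2, ← hj] at h1
      have h2 := hP (mem_Iio.1 hi)
      omega
    have hoff' : below D p < runOffset ℓ j + ℓ j := by
      have : runOffset ℓ j + ℓ j = ∑ i ∈ insert j (Iio j), ℓ i := by
        rw [sum_insert (by simp), runOffset, add_comm]
      rw [this, hsum]
      refine card_lt_card ⟨fun q hq => ?_, fun hsub => ?_⟩
      · rw [mem_filter] at hq ⊢
        refine ⟨hq.1, ?_⟩
        obtain ⟨i, hi⟩ := hSP q hq.1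
        refine ⟨i, ?_, hi.symm⟩
        have h1 := slotOf_mono D hq.2.le
        rw [← hi, ← hj, hP.le_iff_le] at h1
        rw [mem_insert, mem_Iio]
        exact h1.eq_or_lt
      · have := hsub (mem_filter.2 ⟨hp, j, mem_insert_self _ _, hj.symm⟩)
        exact lt_irrefl _ (mem_filter.1 this).2
    have hpe : p = P j + below D p := by
      rw [hj, slotOf]
      have := below_le D p
      omega
    exact mem_runSet.2 ⟨j, below D p - runOffset ℓ j, by omega, by unfold runStart; omega⟩

end Runs

/-- In a run of consecutive places of `A` the rank increases by one at each step. -/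
theorem below_add {A : Finset ℕ} {p l : ℕ} (h : ∀ i < l, p + i ∈ A) {i : ℕ} (hi : i ≤ l) :
    below A (p + i) = below A p + i := by
  induction i with
  | zero => simp
  | succ i ih =>
    have h1 : {q ∈ A | q < p + (i + 1)} = insert (p + i) {q ∈ A | q < p + i} := by
      ext q
      simp only [mem_filter, mem_insert]
      constructor
      · rintro ⟨h1, h2⟩
        rcases Nat.lt_succ_iff_lt_or_eq.1 h2 with h3 | h3
        · exact Or.inr ⟨h1, h3⟩
        · exact Or.inl h3
      · rintro (rfl | ⟨h1, h2⟩)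
        · exact ⟨h i (by omega), by omega⟩
        · exact ⟨h1, by omega⟩
    have h2 := ih (by omega)
    unfold below at h2 ⊢
    rw [h1, card_insert_of_notMem (by simp), h2]
    ring

/-! ### Blocks of shared edges and the type of a merged order -/

/-- Blocks of shared edges are encoded by natural numbers: `0` is a single edge traversed in
opposite directions, and `a ≥ 1` is a run of `a` edges traversed in the same direction. This is the
number of edges of the block. -/
def blockLen (a : ℕ) : ℕ := max 1 a

/-- The `i`-th vertex of a block, in the order of the second path, is this far from the first
vertex of the block in the order of the first path. -/
def blockVert (a i : ℕ) : ℕ := if a = 0 then 1 - i else i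

theorem blockLen_pos (a : ℕ) : 0 < blockLen a := by unfold blockLen; omega

/-- The type of a merged order: the sequence of blocks of shared edges. -/
abbrev WordType : Type := Σ c : ℕ, Fin c → ℕ

/-- The number of shared edges in a sequence of blocks. -/
def totalLen {c : ℕ} (t : Fin c → ℕ) : ℕ := ∑ j, blockLen (t j)

/-- The places of the shared edges when the blocks `t` are inserted into the slots `P`. -/
def blockSet {c : ℕ} (t P : Fin c → ℕ) : Finset ℕ := runSet (blockLen ∘ t) P

/-- In the word `(A, B)`, the path `τ` follows the identity path along each block, in the
prescribed direction. -/
def BlockFit {n c : ℕ} (τ : Equiv.Perm (Fin n)) (t P : Fin c → ℕ) (A B : Finset ℕ) : Prop :=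
  ∀ j, ∀ i ≤ blockLen (t j), permVal τ (below B (runStart (blockLen ∘ t) P j) + i) =
    below A (runStart (blockLen ∘ t) P j) + blockVert (t j) i

/-- The merged order `x` of `τ` with the identity path has type `T`. -/
def HasType {n : ℕ} (τ : Equiv.Perm (Fin n)) (x : Finset ℕ × Finset ℕ) (T : WordType) : Prop :=
  ∃ P : Fin T.1 → ℕ, StrictMono P ∧ x.1 ∩ x.2 = blockSet T.2 P ∧ BlockFit τ T.2 P x.1 x.2

/-- Consecutive shared edges are traversed forward, unless there is only one. -/
theorem exists_block_of_sharedEdges {n : ℕ} (τ : Equiv.Perm (Fin n)) {a b l : ℕ} (hl : 0 < l)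
    (h : ∀ i < l, SharedEdge τ (a + i) (b + i)) :
    ∃ s, blockLen s = l ∧ ∀ i ≤ l, permVal τ (b + i) = a + blockVert s i := by
  rcases Nat.lt_or_ge 1 l with h1 | h1
  · have key : ∀ i, i + 1 < l → permVal τ (b + i) = a + i ∧ permVal τ (b + i + 1) = a + i + 1 ∧
        permVal τ (b + i + 2) = a + i + 2 := by
      intro i hi
      have e1 := h i (by omega)
      have e2 := h (i + 1) hi
      unfold SharedEdge at e1 e2
      rw [show b + (i + 1) + 1 = b + i + 2 by ring, show b + (i + 1) = b + i + 1 by ring] at e2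
      omega
    refine ⟨l, by unfold blockLen; omega, fun i hi => ?_⟩
    have hb : blockVert l i = i := if_neg (by omega)
    rw [hb]
    rcases Nat.lt_or_ge (i + 1) l with h2 | h2
    · exact (key i h2).1
    · rcases Nat.eq_or_lt_of_le hi with h3 | h3
      · obtain ⟨i', rfl⟩ : ∃ i', i = i' + 2 := ⟨i - 2, by omega⟩
        have := (key i' (by omega)).2.2
        rw [← Nat.add_assoc b, this]
        ring
      · obtain ⟨i', rfl⟩ : ∃ i', i = i' + 1 := ⟨i - 1, by omega⟩
        have := (key i' (by omega)).2.1
        rw [← Nat.add_assoc b, this]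
        ring
  · have hl1 : l = 1 := by omega
    subst hl1
    have e := h 0 (by omega)
    unfold SharedEdge at e
    simp only [Nat.add_zero] at e
    rcases e with e | e
    · refine ⟨1, rfl, fun i hi => ?_⟩
      have : i = 0 ∨ i = 1 := by omega
      rcases this with rfl | rfl <;> simp [blockVert, e.1, e.2]
    · refine ⟨0, rfl, fun i hi => ?_⟩
      have : i = 0 ∨ i = 1 := by omega
      rcases this with rfl | rfl <;> simp [blockVert, e.1, e.2]

theorem card_inter_of_mem_words {n : ℕ} {τ : Equiv.Perm (Fin n)} {x : Finset ℕ × Finset ℕ}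
    (hx : x ∈ words τ) : #(x.1 ∩ x.2) = #(consecPos τ) := by
  obtain ⟨h1, h2, h3, -⟩ := hx
  have := card_union_add_card_inter x.1 x.2
  rw [h1, h2, h3, card_range] at this
  have := card_consecPos_le τ
  omega

/-- Every merged order has a type: cut the set of common places into its maximal runs. -/
theorem exists_hasType {n : ℕ} {τ : Equiv.Perm (Fin n)} {x : Finset ℕ × Finset ℕ}
    (hx : x ∈ words τ) : ∃ T, HasType τ x T := by
  have hcard := card_inter_of_mem_words hx
  have hle := card_consecPos_le τ
  obtain ⟨A, B⟩ := x
  obtain ⟨hA, hB, hU, hS⟩ := hx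
  simp only at hA hB hU hS hcard
  have hD : A ∩ B ⊆ range (2 * (n - 1 - #(consecPos τ)) + #(A ∩ B)) := by
    have h1 : A ∩ B ⊆ range (2 * (n - 1) - #(consecPos τ)) := by
      rw [← hU]; exact inter_subset_left.trans subset_union_left
    have h2 : 2 * (n - 1) - #(consecPos τ) = 2 * (n - 1 - #(consecPos τ)) + #(A ∩ B) := by omega
    rwa [h2] at h1
  obtain ⟨c, ℓ, P, hℓ, hP, -, hrun⟩ := exists_runSet_eq hD
  have hblock : ∀ j, ∃ s, blockLen s = ℓ j ∧ ∀ i ≤ ℓ j,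
      permVal τ (below B (runStart ℓ P j) + i) = below A (runStart ℓ P j) + blockVert s i := by
    intro j
    have hmem : ∀ i < ℓ j, runStart ℓ P j + i ∈ A ∩ B := fun i hi => by
      rw [← hrun]; exact mem_runSet.2 ⟨j, i, hi, rfl⟩
    refine exists_block_of_sharedEdges τ (hℓ j) fun i hi => ?_
    have := hS _ (hmem i hi)
    rwa [below_add (fun i hi => (mem_inter.1 (hmem i hi)).1) hi.le,
      below_add (fun i hi => (mem_inter.1 (hmem i hi)).2) hi.le] at this
  choose t ht1 ht2 using hblock
  have htl : blockLen ∘ t = ℓ := funext ht1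
  refine ⟨⟨c, t⟩, P, hP, ?_, ?_⟩
  · simp only [blockSet, htl, hrun]
  · intro j i hi
    simp only [htl] at hi ⊢
    rw [ht1] at hi
    exact ht2 j i hi

theorem hasType_unique {n : ℕ} {τ : Equiv.Perm (Fin n)} {x : Finset ℕ × Finset ℕ}
    {T T' : WordType} (h : HasType τ x T) (h' : HasType τ x T') : T = T' := by
  obtain ⟨c, t⟩ := T
  obtain ⟨c', t'⟩ := T'
  obtain ⟨P, hP, hD, hF⟩ := h
  obtain ⟨P', hP', hD', hF'⟩ := h'
  simp only at P P' hP hP' hD hD' hF hF'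
  rw [hD] at hD'
  have hpos : ∀ j, 0 < (blockLen ∘ t) j := fun j => blockLen_pos _
  have hpos' : ∀ j, 0 < (blockLen ∘ t') j := fun j => blockLen_pos _
  have hc : c = c' := card_eq_of_runSet_eq hpos hpos' hP hP' hD'
  subst hc
  obtain ⟨hl, rfl⟩ := runSet_injective hpos hpos' hP hP' hD'
  congr 1
  funext j
  have e1 := congrFun hl j
  have e2 := hF j 0 (Nat.zero_le _)
  have e3 := hF' j 0 (Nat.zero_le _)
  rw [← hl] at e3
  rw [e2] at e3
  simp only [Function.comp, blockLen, blockVert] at e1 e3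
  split_ifs at e3 <;> omega

/-- The permutations with exactly `totalLen t` shared edges, which follow the blocks `t` inserted
at the slots `P` into the word whose remaining letters of the first path are `A'`. -/
noncomputable def fitPerms (n : ℕ) {c : ℕ} (t P : Fin c → ℕ) (A' : Finset ℕ) :
    Finset (Equiv.Perm (Fin n)) := by
  classical
  exact {τ | #(consecPos τ) = totalLen t ∧
    BlockFit τ t P (A' ∪ blockSet t P) (range (2 * (n - 1) - totalLen t) \ A')}

theorem mem_fitPerms {n c : ℕ} {t P : Fin c → ℕ} {A' : Finset ℕ} {τ : Equiv.Perm (Fin n)} :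
    τ ∈ fitPerms n t P A' ↔ #(consecPos τ) = totalLen t ∧
      BlockFit τ t P (A' ∪ blockSet t P) (range (2 * (n - 1) - totalLen t) \ A') := by
  simp [fitPerms]

/-- The strictly increasing choices of `c` slots out of `M`. -/
def slotChoices (c M : ℕ) : Finset (Fin c → Fin M) := {P | ∀ i j, i < j → P i < P j}

theorem mem_slotChoices {c M : ℕ} {P : Fin c → Fin M} : P ∈ slotChoices c M ↔ StrictMono P := by
  simp [slotChoices, StrictMono]

theorem card_slotChoices (c M : ℕ) : #(slotChoices c M) = M.choose c := by
  have h : #(powersetCard c (univ : Finset (Fin M))) = M.choose c := by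
    rw [card_powersetCard, card_univ, Fintype.card_fin]
  rw [← h]
  refine card_bij (fun P _ => univ.image P) ?_ ?_ ?_
  · intro P hP
    rw [mem_slotChoices] at hP
    rw [mem_powersetCard, card_image_of_injective _ hP.injective]
    simp
  · intro P hP P' hP' h
    rw [mem_slotChoices] at hP hP'
    exact strictMono_eq_of_image_eq hP hP' h
  · intro S hS
    rw [mem_powersetCard] at hS
    exact ⟨S.orderEmbOfFin hS.2, mem_slotChoices.2 (S.orderEmbOfFin hS.2).strictMono,
      S.image_orderEmbOfFin_univ hS.2⟩

/-- The possible sets of places for the letters that belong to the first path only. -/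
def letterChoices {c : ℕ} (m : ℕ) (t P : Fin c → ℕ) : Finset (Finset ℕ) :=
  powersetCard m (range (2 * m + totalLen t) \ blockSet t P)

/-- The pairs of a permutation and a merged order of it with the identity path. -/
noncomputable def permWords (n : ℕ) : Finset (Σ _ : Equiv.Perm (Fin n), Finset ℕ × Finset ℕ) :=
  univ.sigma fun τ => (words_finite τ).toFinset

theorem mem_permWords {n : ℕ} {y : Σ _ : Equiv.Perm (Fin n), Finset ℕ × Finset ℕ} :
    y ∈ permWords n ↔ y.2 ∈ words y.1 := by
  simp [permWords]

open Classical in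
/-- The number of pairs of a permutation and a merged order of type `T`. -/
noncomputable def typeCount (n : ℕ) (T : WordType) : ℕ := #{y ∈ permWords n | HasType y.1 y.2 T}

theorem totalLen_eq_of_hasType {n : ℕ} {τ : Equiv.Perm (Fin n)} {x : Finset ℕ × Finset ℕ}
    {T : WordType} (hx : x ∈ words τ) (h : HasType τ x T) : totalLen T.2 = #(consecPos τ) := by
  obtain ⟨P, hP, hD, -⟩ := h
  rw [← card_inter_of_mem_words hx, hD, blockSet, card_runSet _ hP.monotone]
  rfl

theorem typeCount_eq_zero {n : ℕ} {T : WordType} (h : n - 1 < totalLen T.2) :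
    typeCount n T = 0 := by
  classical
  rw [typeCount, card_eq_zero, filter_eq_empty_iff]
  intro y hy hT
  rw [mem_permWords] at hy
  have h1 := totalLen_eq_of_hasType hy hT
  have h2 := card_consecPos_le y.1
  omega

open Classical in
/-- The second moment as a sum over the types of merged orders. -/
theorem sum_card_isIncreasing_pair (n : ℕ) :
    ∑ τ : Equiv.Perm (Fin n),
        (#{f : EdgeOrdering n | IsIncreasing f 1 ∧ IsIncreasing f τ} : ℝ)
          / (n.choose 2).factorial
      = ∑' T : WordType, (typeCount n T : ℝ) / (2 * (n - 1) - totalLen T.2).factorial := by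
  have h1 : ∀ τ : Equiv.Perm (Fin n),
      (#{f : EdgeOrdering n | IsIncreasing f 1 ∧ IsIncreasing f τ} : ℝ) / (n.choose 2).factorial
        = ∑ x ∈ (words_finite τ).toFinset,
          (1 : ℝ) / (2 * (n - 1) - #(consecPos τ)).factorial := by
    intro τ
    have h := card_isIncreasing_pair τ
    rw [Set.ncard_eq_toFinset_card _ (words_finite τ)] at h
    have h' : (#{f : EdgeOrdering n | IsIncreasing f 1 ∧ IsIncreasing f τ} : ℝ) *
        (2 * (n - 1) - #(consecPos τ)).factorial =
          (n.choose 2).factorial * #(words_finite τ).toFinset := by exact_mod_cast h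
    rw [sum_const, nsmul_eq_mul, mul_one_div, div_eq_div_iff (by positivity) (by positivity), h']
    ring
  have hex : ∀ y : Σ _ : Equiv.Perm (Fin n), Finset ℕ × Finset ℕ, ∃ T : WordType,
      y ∈ permWords n → HasType y.1 y.2 T := by
    intro y
    by_cases hy : y ∈ permWords n
    · obtain ⟨T, hT⟩ := exists_hasType (mem_permWords.1 hy)
      exact ⟨T, fun _ => hT⟩
    · exact ⟨⟨0, Fin.elim0⟩, fun h => absurd h hy⟩
  choose ty hty using hex
  have hfib : ∀ T, typeCount n T = #{y ∈ permWords n | ty y = T} := by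
    intro T
    rw [typeCount]
    congr 1
    refine filter_congr fun y hy => ?_
    constructor
    · intro h
      exact hasType_unique (hty y hy) h
    · rintro rfl
      exact hty y hy
  simp_rw [h1]
  rw [← sum_sigma (s := univ) (t := fun τ => (words_finite τ).toFinset)
    (f := fun y => (1 : ℝ) / (2 * (n - 1) - #(consecPos y.1)).factorial)]
  change ∑ y ∈ permWords n, (1 : ℝ) / (2 * (n - 1) - #(consecPos y.1)).factorial = _
  have h2 : ∀ y ∈ permWords n, (1 : ℝ) / (2 * (n - 1) - #(consecPos y.1)).factorial =
      (fun T : WordType => (1 : ℝ) / (2 * (n - 1) - totalLen T.2).factorial) (ty y) := by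
    intro y hy
    simp only
    rw [totalLen_eq_of_hasType (mem_permWords.1 hy) (hty y hy)]
  rw [sum_congr rfl h2, sum_comp (fun T : WordType =>
    (1 : ℝ) / (2 * (n - 1) - totalLen T.2).factorial) ty, tsum_eq_sum (s := (permWords n).image ty)]
  · refine sum_congr rfl fun T _ => ?_
    rw [hfib, nsmul_eq_mul, mul_one_div]
  · intro T hT
    rw [hfib, card_eq_zero.2, Nat.cast_zero, zero_div]
    rw [filter_eq_empty_iff]
    intro y hy h
    exact hT (mem_image.2 ⟨y, hy, h⟩)

/-- Every choice of slots, letters and a permutation that fits them comes from a merged order. -/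
theorem mem_words_of_blockFit {n c : ℕ} {t P : Fin c → ℕ} {A' : Finset ℕ} {m : ℕ}
    (hn : n - 1 = m + totalLen t) (hP : StrictMono P) (hPm : ∀ j, P j ≤ 2 * m)
    (hA' : A' ∈ letterChoices m t P) {τ : Equiv.Perm (Fin n)} (hτ : τ ∈ fitPerms n t P A') :
    (A' ∪ blockSet t P) ∩ (range (2 * m + totalLen t) \ A') = blockSet t P ∧
    (A' ∪ blockSet t P, range (2 * m + totalLen t) \ A') ∈ words τ ∧
    HasType τ (A' ∪ blockSet t P, range (2 * m + totalLen t) \ A') ⟨c, t⟩ := by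
  rw [mem_fitPerms, show 2 * (n - 1) - totalLen t = 2 * m + totalLen t by omega] at hτ
  rw [letterChoices, mem_powersetCard] at hA'
  have hD : blockSet t P ⊆ range (2 * m + totalLen t) := runSet_subset_range hPm
  have hDc : #(blockSet t P) = totalLen t := card_runSet _ hP.monotone
  have hdisj : Disjoint A' (blockSet t P) := by
    rw [Finset.disjoint_left]
    intro x hx
    exact (mem_sdiff.1 (hA'.1 hx)).2
  have hA'r : A' ⊆ range (2 * m + totalLen t) := hA'.1.trans sdiff_subset
  have hinter : (A' ∪ blockSet t P) ∩ (range (2 * m + totalLen t) \ A') = blockSet t P := by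
    ext x
    simp only [mem_inter, mem_union, mem_sdiff]
    constructor
    · rintro ⟨h1 | h1, h2, h3⟩
      · exact absurd h1 h3
      · exact h1
    · intro h
      exact ⟨Or.inr h, hD h, fun h' => Finset.disjoint_left.1 hdisj h' h⟩
  refine ⟨hinter, ⟨?_, ?_, ?_, ?_⟩, P, hP, hinter, hτ.2⟩
  · simp only
    rw [card_union_of_disjoint hdisj, hDc, hA'.2, hn]
  · simp only
    rw [card_sdiff_of_subset hA'r, card_range, hA'.2]
    omega
  · simp only
    rw [hτ.1, show 2 * (n - 1) - totalLen t = 2 * m + totalLen t by omega]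
    ext x
    simp only [mem_union, mem_sdiff]
    constructor
    · rintro ((h | h) | h)
      · exact hA'r h
      · exact hD h
      · exact h.1
    · intro h
      by_cases h' : x ∈ A'
      · exact Or.inl (Or.inl h')
      · exact Or.inr ⟨h, h'⟩
  · intro p hp
    simp only at hp ⊢
    rw [hinter] at hp
    obtain ⟨j, i, hi, rfl⟩ := mem_runSet.1 hp
    have hmem : ∀ i < (blockLen ∘ t) j, runStart (blockLen ∘ t) P j + i ∈
        (A' ∪ blockSet t P) ∩ (range (2 * m + totalLen t) \ A') := fun i hi => by
      rw [hinter]; exact mem_runSet.2 ⟨j, i, hi, rfl⟩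
    rw [below_add (fun i hi => (mem_inter.1 (hmem i hi)).1) hi.le,
      below_add (fun i hi => (mem_inter.1 (hmem i hi)).2) hi.le]
    have e1 := hτ.2 j i hi.le
    have e2 := hτ.2 j (i + 1) hi
    simp only [Function.comp, blockLen] at hi
    unfold SharedEdge
    unfold blockVert at e1 e2
    rw [← Nat.add_assoc] at e2
    split_ifs at e1 e2 <;> omega

/-- A permutation together with a merged order of type `t` amounts to a choice of slots for the
blocks, of the places that belong to the first path only, and of a permutation that fits. -/
theorem typeCount_eq {n c m : ℕ} (t : Fin c → ℕ) (hn : n - 1 = m + totalLen t) :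
    typeCount n ⟨c, t⟩ = ∑ P ∈ slotChoices c (2 * m + 1),
      ∑ A' ∈ letterChoices m t (fun j => (P j : ℕ)), #(fitPerms n t (fun j => (P j : ℕ)) A') := by
  classical
  rw [← sum_congr rfl fun P _ => card_sigma _ _, ← card_sigma, typeCount]
  symm
  have hcast : ∀ P ∈ slotChoices c (2 * m + 1), StrictMono (fun j => (P j : ℕ)) :=
    fun P hP i j hij => Fin.lt_def.1 (mem_slotChoices.1 hP hij)
  have hle : ∀ (P : Fin c → Fin (2 * m + 1)) j, (P j : ℕ) ≤ 2 * m := fun P j => by omega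
  refine card_bij (fun z _ => ⟨z.2.2, (z.2.1 ∪ blockSet t (fun j => (z.1 j : ℕ)),
    range (2 * m + totalLen t) \ z.2.1)⟩) ?_ ?_ ?_
  · rintro ⟨P, A', τ⟩ hz
    simp only [mem_sigma] at hz
    obtain ⟨-, h1, h2⟩ := mem_words_of_blockFit hn (hcast P hz.1) (hle P) hz.2.1 hz.2.2
    exact mem_filter.2 ⟨mem_permWords.2 h1, h2⟩
  · rintro ⟨P, A', τ⟩ hz ⟨P₂, A'₂, τ₂⟩ hz₂ h
    simp only [mem_sigma] at hz hz₂
    simp only [Sigma.mk.injEq, heq_eq_eq, Prod.mk.injEq] at h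
    obtain ⟨rfl, h1, h2⟩ := h
    have i1 := (mem_words_of_blockFit hn (hcast P hz.1) (hle P) hz.2.1 hz.2.2).1
    have i2 := (mem_words_of_blockFit hn (hcast P₂ hz₂.1) (hle P₂) hz₂.2.1 hz₂.2.2).1
    rw [h1, h2, i2] at i1
    have hPP := (runSet_injective (fun j => blockLen_pos _) (fun j => blockLen_pos _)
      (hcast P₂ hz₂.1) (hcast P hz.1) i1).2
    have hPP' : P = P₂ := funext fun j => Fin.ext (congrFun hPP j).symm
    subst hPP'
    have r1 := (mem_powersetCard.1 hz.2.1).1.trans sdiff_subset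
    have r2 := (mem_powersetCard.1 hz₂.2.1).1.trans sdiff_subset
    have : A' = A'₂ := by
      rw [← Finset.sdiff_sdiff_eq_self r1, h2, Finset.sdiff_sdiff_eq_self r2]
    subst this
    rfl
  · rintro ⟨τ, A, B⟩ hy
    rw [mem_filter, mem_permWords] at hy
    obtain ⟨hw, hT⟩ := hy
    simp only at hw hT
    have hlen := totalLen_eq_of_hasType hw hT
    obtain ⟨P, hP, hD, hF⟩ := hT
    obtain ⟨hA, hB, hU, -⟩ := hw
    simp only at P hP hD hF hA hB hU hlen
    have hu : 2 * (n - 1) - #(consecPos τ) = 2 * m + totalLen t := by omega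
    rw [hu] at hU
    have hAr : A ⊆ range (2 * m + totalLen t) := hU ▸ subset_union_left
    have hBr : B ⊆ range (2 * m + totalLen t) := hU ▸ subset_union_right
    have hDc : #(blockSet t P) = totalLen t := card_runSet _ hP.monotone
    have hPm : ∀ j, P j ≤ 2 * m := by
      intro j
      have hsub : blockSet t P ⊆ range (2 * m + totalLen t) := by
        rw [← hD]; exact inter_subset_left.trans hAr
      have h1 := slotOf_runSet (blockLen ∘ t) hP.monotone j (Nat.zero_le _)
      rw [slotOf_eq_card] at h1
      have h2 : runStart (blockLen ∘ t) P j + 0 ∈ range (2 * m + totalLen t) :=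
        hsub (mem_runSet.2 ⟨j, 0, blockLen_pos _, rfl⟩)
      have h3 : range (runStart (blockLen ∘ t) P j + 0) \ runSet (blockLen ∘ t) P ⊆
          range (2 * m + totalLen t) \ blockSet t P :=
        sdiff_subset_sdiff (range_subset_range.2 (mem_range.1 h2).le) subset_rfl
      have h4 := card_le_card h3
      rw [card_sdiff_of_subset hsub, card_range, hDc, h1] at h4
      omega
    have hA'A : A \ B ∪ blockSet t P = A := by
      rw [← hD]; exact sdiff_union_inter A B
    have hrA : range (2 * m + totalLen t) \ (A \ B) = B := by
      rw [← hU]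
      ext x
      simp only [mem_sdiff, mem_union]
      tauto
    have hA'm : A \ B ∈ letterChoices m t P := by
      rw [letterChoices, mem_powersetCard]
      constructor
      · intro x hx
        rw [mem_sdiff] at hx
        rw [mem_sdiff, ← hD]
        exact ⟨hAr hx.1, fun h => hx.2 (mem_inter.1 h).2⟩
      · have h1 := card_sdiff_add_card_inter A B
        rw [hD, hDc, hA] at h1
        omega
    have hfit : τ ∈ fitPerms n t P (A \ B) := by
      rw [mem_fitPerms, show 2 * (n - 1) - totalLen t = 2 * m + totalLen t by omega, hA'A, hrA]
      exact ⟨hlen.symm, hF⟩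
    refine ⟨⟨fun j => ⟨P j, Nat.lt_succ_of_le (hPm j)⟩, A \ B, τ⟩, ?_, ?_⟩
    · rw [mem_sigma, mem_sigma]
      refine ⟨mem_slotChoices.2 fun i j hij => ?_, hA'm, hfit⟩
      rw [Fin.lt_def]
      exact hP hij
    · simp only [hA'A, hrA]

/-! ### Permutations that follow given blocks -/

theorem below_le_card (A : Finset ℕ) (p : ℕ) : below A p ≤ #A := card_filter_le _ _

/-- The positions visited by the blocks in the second path, given the positions `b` at which the
blocks start and their lengths. -/
def blockPositions {c : ℕ} (ℓ b : Fin c → ℕ) : Finset ℕ :=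
  univ.biUnion fun j => Icc (b j) (b j + ℓ j)

theorem mem_blockPositions {c : ℕ} {ℓ b : Fin c → ℕ} {q : ℕ} :
    q ∈ blockPositions ℓ b ↔ ∃ j, ∃ i ≤ ℓ j, q = b j + i := by
  simp only [blockPositions, mem_biUnion, mem_univ, true_and, mem_Icc]
  refine exists_congr fun j => ⟨fun h => ⟨q - b j, by omega, by omega⟩, ?_⟩
  rintro ⟨i, hi, rfl⟩
  omega

theorem eq_of_block_eq {c : ℕ} {ℓ b : Fin c → ℕ} (hb : ∀ i j, i < j → b i + ℓ i < b j)
    {j j' : Fin c} {i i' : ℕ} (hi : i ≤ ℓ j) (hi' : i' ≤ ℓ j') (h : b j + i = b j' + i') :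
    j = j' ∧ i = i' := by
  rcases lt_trichotomy j j' with h1 | h1 | h1
  · have := hb _ _ h1; omega
  · subst h1; exact ⟨rfl, by omega⟩
  · have := hb _ _ h1; omega

theorem card_blockPositions {c : ℕ} {ℓ b : Fin c → ℕ} (hb : ∀ i j, i < j → b i + ℓ i < b j) :
    #(blockPositions ℓ b) = (∑ j, ℓ j) + c := by
  rw [blockPositions, card_biUnion]
  · simp only [Nat.card_Icc]
    rw [sum_congr rfl (g := fun j => ℓ j + 1) fun j _ => by omega, sum_add_distrib]
    simp
  · intro i _ j _ hij
    rw [Function.onFun, Finset.disjoint_left]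
    intro x hx hx'
    rw [mem_Icc] at hx hx'
    exact hij (eq_of_block_eq hb (j := i) (j' := j) (i := x - b i) (i' := x - b j) (by omega)
      (by omega) (by omega)).1

/-- The path `τ` follows blocks `t` starting at positions `b` of `τ` and at vertices `a`. -/
def FollowsBlocks {n c : ℕ} (τ : Equiv.Perm (Fin n)) (t a b : Fin c → ℕ) : Prop :=
  ∀ j, ∀ i ≤ blockLen (t j), permVal τ (b j + i) = a j + blockVert (t j) i

theorem blockVert_le {s i : ℕ} (hi : i ≤ blockLen s) : blockVert s i ≤ blockLen s := by
  unfold blockVert blockLen at *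
  split_ifs <;> omega

theorem blockVert_injOn {s i i' : ℕ} (hi : i ≤ blockLen s) (hi' : i' ≤ blockLen s)
    (h : blockVert s i = blockVert s i') : i = i' := by
  unfold blockVert blockLen at *
  split_ifs at h <;> omega

/-- The elements of a finite set of natural numbers, as elements of `Fin n`. -/
def finPart (n : ℕ) (S : Finset ℕ) : Finset (Fin n) := {q | (q : ℕ) ∈ S}

theorem image_finPart {n : ℕ} {S : Finset ℕ} (hS : S ⊆ range n) :
    (finPart n S).image Fin.val = S := by
  ext x
  simp only [mem_image, finPart, mem_filter, mem_univ, true_and]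
  constructor
  · rintro ⟨q, hq, rfl⟩; exact hq
  · intro hx
    exact ⟨⟨x, mem_range.1 (hS hx)⟩, hx, rfl⟩

theorem card_finPart {n : ℕ} {S : Finset ℕ} (hS : S ⊆ range n) : #(finPart n S) = #S := by
  rw [← card_image_of_injective _ Fin.val_injective, image_finPart hS]

section Blocks

variable {n c : ℕ} {t a b : Fin c → ℕ}

theorem blockPositions_subset_range (hbn : ∀ j, b j + blockLen (t j) < n) :
    blockPositions (blockLen ∘ t) b ⊆ range n := by
  intro q hq
  obtain ⟨j, i, hi, rfl⟩ := mem_blockPositions.1 hq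
  have := hbn j
  simp only [Function.comp] at hi
  rw [mem_range]; omega

/-- Following the blocks means taking prescribed values at the block positions. -/
theorem followsBlocks_iff {τ φ : Equiv.Perm (Fin n)} (hbn : ∀ j, b j + blockLen (t j) < n)
    (hφ : FollowsBlocks φ t a b) :
    FollowsBlocks τ t a b ↔ τ ∈ agreeing (finPart n (blockPositions (blockLen ∘ t) b)) φ := by
  rw [mem_agreeing]
  constructor
  · intro h p hp
    rw [finPart, mem_filter] at hp
    obtain ⟨j, i, hi, hpe⟩ := mem_blockPositions.1 hp.2
    rw [Fin.ext_iff, ← permVal_coe, ← permVal_coe, hpe, h j i hi, hφ j i hi]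
  · intro h j i hi
    have hn : b j + i < n := by have := hbn j; omega
    rw [← hφ j i hi, permVal_of_lt τ hn, permVal_of_lt φ hn, h]
    exact mem_filter.2 ⟨mem_univ _, mem_blockPositions.2 ⟨j, i, hi, rfl⟩⟩

theorem exists_followsBlocks (hbn : ∀ j, b j + blockLen (t j) < n)
    (han : ∀ j, a j + blockLen (t j) < n) (hb : ∀ i j, i < j → b i + blockLen (t i) < b j)
    (ha : ∀ i j, i < j → a i + blockLen (t i) < a j) :
    ∃ φ : Equiv.Perm (Fin n), FollowsBlocks φ t a b := by
  have hex : ∀ q : ℕ, ∃ v : ℕ, ∀ j, ∀ i ≤ blockLen (t j), q = b j + i →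
      v = a j + blockVert (t j) i := by
    intro q
    by_cases hq : ∃ j, ∃ i ≤ blockLen (t j), q = b j + i
    · obtain ⟨j, i, hi, rfl⟩ := hq
      refine ⟨a j + blockVert (t j) i, fun j' i' hi' h => ?_⟩
      obtain ⟨rfl, rfl⟩ := eq_of_block_eq (ℓ := blockLen ∘ t) hb hi hi' h
      rfl
    · exact ⟨0, fun j i hi h => absurd ⟨j, i, hi, h⟩ hq⟩
  choose g hg using hex
  set Q := finPart n (blockPositions (blockLen ∘ t) b)
  have hQ : ∀ q ∈ Q, ∃ j, ∃ i ≤ blockLen (t j), (q : ℕ) = b j + i ∧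
      g q = a j + blockVert (t j) i := by
    intro q hq
    obtain ⟨j, i, hi, h⟩ := mem_blockPositions.1 (mem_filter.1 hq).2
    exact ⟨j, i, hi, h, hg q j i hi h⟩
  obtain ⟨e, he⟩ := Finset.exists_equiv_extend_of_card_eq (t := range n) (s := Q)
    (f := fun q : Fin n => g q) (by simp) (by
      intro v hv
      obtain ⟨q, hq, rfl⟩ := mem_image.1 hv
      obtain ⟨j, i, hi, -, h⟩ := hQ q hq
      have := blockVert_le hi
      have := han j
      simp only [h, mem_range]
      omega) (by
      intro q hq q' hq' h
      obtain ⟨j, i, hi, h1, h2⟩ := hQ q (mem_coe.1 hq)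
      obtain ⟨j', i', hi', h1', h2'⟩ := hQ q' (mem_coe.1 hq')
      simp only [h2, h2'] at h
      obtain ⟨rfl, h3⟩ := eq_of_block_eq (ℓ := blockLen ∘ t) ha (blockVert_le hi)
        (blockVert_le hi') h
      have := blockVert_injOn hi hi' h3
      exact Fin.ext (by omega))
  let φ : Fin n → Fin n := fun q => ⟨e q, mem_range.1 (e q).2⟩
  have hφ : Function.Injective φ := by
    intro q q' h
    exact e.injective (Subtype.ext (Fin.ext_iff.1 h))
  refine ⟨Equiv.ofBijective φ (Finite.injective_iff_bijective.1 hφ), fun j i hi => ?_⟩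
  have hn : b j + i < n := by have := hbn j; omega
  rw [permVal_of_lt _ hn]
  have hmem : (⟨b j + i, hn⟩ : Fin n) ∈ Q :=
    mem_filter.2 ⟨mem_univ _, mem_blockPositions.2 ⟨j, i, hi, rfl⟩⟩
  exact (he _ hmem).trans (hg _ j i hi rfl)

/-- The positions of the shared edges that the blocks force. -/
theorem runs_subset_consecPos (hbn : ∀ j, b j + blockLen (t j) < n) {τ : Equiv.Perm (Fin n)}
    (hτ : FollowsBlocks τ t a b) {j : Fin c} {i : ℕ} (hi : i < blockLen (t j)) :
    b j + i ∈ consecPos τ := by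
  rw [mem_consecPos]
  refine ⟨by have := hbn j; omega, ?_⟩
  have e1 := hτ j i hi.le
  have e2 := hτ j (i + 1) hi
  rw [← Nat.add_assoc] at e2
  rw [e1, e2]
  unfold blockVert blockLen Consec at *
  split_ifs <;> omega

/-- If the blocks are well separated in both paths, then having no shared edges besides those in
the blocks means that all shared edges lie between block positions. -/
theorem card_consecPos_eq_iff (hbn : ∀ j, b j + blockLen (t j) < n)
    (hb : ∀ i j, i < j → b i + blockLen (t i) < b j)
    (ha : ∀ i j, i < j → a i + blockLen (t i) + 1 < a j) {τ : Equiv.Perm (Fin n)}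
    (hτ : FollowsBlocks τ t a b) :
    #(consecPos τ) = totalLen t ↔ ∀ p ∈ consecPos τ,
      p ∈ blockPositions (blockLen ∘ t) b ∧ p + 1 ∈ blockPositions (blockLen ∘ t) b := by
  set R : Finset ℕ := univ.biUnion fun j => Ico (b j) (b j + blockLen (t j)) with hR
  have hmem : ∀ p, p ∈ R ↔ ∃ j, ∃ i < blockLen (t j), p = b j + i := by
    intro p
    simp only [hR, mem_biUnion, mem_univ, true_and, mem_Ico]
    refine exists_congr fun j => ⟨fun h => ⟨p - b j, by omega, by omega⟩, ?_⟩
    rintro ⟨i, hi, rfl⟩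
    omega
  have hRc : #R = totalLen t := by
    rw [hR, card_biUnion]
    · simp [totalLen]
    · intro i _ j _ hij
      rw [Function.onFun, Finset.disjoint_left]
      intro x hx hx'
      rw [mem_Ico] at hx hx'
      exact hij (eq_of_block_eq (ℓ := blockLen ∘ t) hb (j := i) (j' := j) (i := x - b i)
        (i' := x - b j) (by simp only [Function.comp]; omega)
        (by simp only [Function.comp]; omega) (by omega)).1
  have hRsub : R ⊆ consecPos τ := by
    intro p hp
    obtain ⟨j, i, hi, rfl⟩ := (hmem p).1 hp
    exact runs_subset_consecPos hbn hτ hi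
  constructor
  · intro h p hp
    rw [← eq_of_subset_of_card_le hRsub (by omega)] at hp
    obtain ⟨j, i, hi, rfl⟩ := (hmem p).1 hp
    exact ⟨mem_blockPositions.2 ⟨j, i, hi.le, rfl⟩, mem_blockPositions.2 ⟨j, i + 1, hi, by ring⟩⟩
  · intro h
    rw [← hRc]
    congr 1
    refine Subset.antisymm (fun p hp => ?_) hRsub
    obtain ⟨h1, h2⟩ := h p hp
    obtain ⟨j, i, hi, rfl⟩ := mem_blockPositions.1 h1
    obtain ⟨j', i', hi', he⟩ := mem_blockPositions.1 h2
    simp only [Function.comp] at hi hi'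
    have hcon := ((mem_consecPos _ _).1 hp).2
    rcases lt_trichotomy j j' with h3 | h3 | h3
    · exfalso
      rw [hτ j i hi, he, hτ j' i' hi'] at hcon
      have := blockVert_le hi
      have := ha j j' h3
      unfold Consec at hcon
      omega
    · subst h3
      exact (hmem _).2 ⟨j, i, by omega, rfl⟩
    · have := hb j' j h3
      omega

end Blocks

/-- The first vertices of the blocks inserted into a word with letters `A'`. -/
def blockVertexStart {c : ℕ} (t P : Fin c → ℕ) (A' : Finset ℕ) (j : Fin c) : ℕ :=
  below (A' ∪ blockSet t P) (runStart (blockLen ∘ t) P j)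

/-- The first positions of the blocks inserted into a word with letters `A'`. -/
def blockPosStart {c : ℕ} (m : ℕ) (t P : Fin c → ℕ) (A' : Finset ℕ) (j : Fin c) : ℕ :=
  below (range (2 * m + totalLen t) \ A') (runStart (blockLen ∘ t) P j)

/-- The places between the end of the `i`-th and the start of the `j`-th block that do not belong
to any block. -/
def gapPlaces {c : ℕ} (t P : Fin c → ℕ) (i j : Fin c) : Finset ℕ :=
  Ico (runStart (blockLen ∘ t) P i + blockLen (t i)) (runStart (blockLen ∘ t) P j) \ blockSet t P

theorem card_gapPlaces {c : ℕ} (t : Fin c → ℕ) {P : Fin c → ℕ} (hP : StrictMono P)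
    {i j : Fin c} (hij : i < j) : #(gapPlaces t P i j) = P j - P i := by
  have h1 := slotOf_runSet (blockLen ∘ t) hP.monotone i le_rfl
  have h2 := slotOf_runSet (blockLen ∘ t) hP.monotone j (Nat.zero_le _)
  rw [slotOf_eq_card] at h1 h2
  have hle : runStart (blockLen ∘ t) P i + blockLen (t i) ≤ runStart (blockLen ∘ t) P j := by
    have := runStart_add_le (blockLen ∘ t) P hij
    have := hP hij
    simp only [Function.comp] at *
    omega
  have h3 : gapPlaces t P i j = (range (runStart (blockLen ∘ t) P j + 0) \ runSet (blockLen ∘ t) P)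
      \ (range (runStart (blockLen ∘ t) P i + (blockLen ∘ t) i) \ runSet (blockLen ∘ t) P) := by
    ext x
    simp only [gapPlaces, blockSet, mem_sdiff, mem_Ico, mem_range, Function.comp]
    constructor
    · rintro ⟨⟨h1, h2⟩, h3⟩
      exact ⟨⟨by omega, h3⟩, fun h => by omega⟩
    · rintro ⟨⟨h1, h2⟩, h3⟩
      refine ⟨⟨?_, by omega⟩, h2⟩
      by_contra h
      exact h3 ⟨by omega, h2⟩
  rw [h3, card_sdiff_of_subset, h1, h2]
  refine sdiff_subset_sdiff (range_subset_range.2 ?_) subset_rfl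
  simpa using hle

theorem card_add_below_le {A S : Finset ℕ} {p q : ℕ} (hS : S ⊆ A) (hpq : ∀ x ∈ S, p ≤ x ∧ x < q)
    (h : p ≤ q) : below A p + #S ≤ below A q := by
  rw [below, ← card_union_of_disjoint]
  · refine card_le_card fun x hx => ?_
    rw [mem_filter]
    rcases mem_union.1 hx with h1 | h1
    · rw [mem_filter] at h1
      exact ⟨h1.1, h1.2.trans_le h⟩
    · exact ⟨hS h1, (hpq x h1).2⟩
  · rw [Finset.disjoint_left]
    intro x hx hx'
    have := (mem_filter.1 hx).2
    have := (hpq x hx').1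
    omega

section Words

variable {n c m : ℕ} {t P : Fin c → ℕ} {A' : Finset ℕ}

theorem mem_fitPerms_iff (hn : n - 1 = m + totalLen t) {τ : Equiv.Perm (Fin n)} :
    τ ∈ fitPerms n t P A' ↔ #(consecPos τ) = totalLen t ∧
      FollowsBlocks τ t (blockVertexStart t P A') (blockPosStart m t P A') := by
  rw [mem_fitPerms, show 2 * (n - 1) - totalLen t = 2 * m + totalLen t by omega]
  rfl

theorem letters_subset (hA' : A' ∈ letterChoices m t P) :
    A' ⊆ range (2 * m + totalLen t) ∧ Disjoint A' (blockSet t P) ∧ #A' = m := by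
  rw [letterChoices, mem_powersetCard] at hA'
  refine ⟨hA'.1.trans sdiff_subset, ?_, hA'.2⟩
  rw [Finset.disjoint_left]
  intro x hx
  exact (mem_sdiff.1 (hA'.1 hx)).2

theorem blockSet_subset_range (hPm : ∀ j, P j ≤ 2 * m) :
    blockSet t P ⊆ range (2 * m + totalLen t) := runSet_subset_range hPm

theorem blockSet_subset_sdiff (hPm : ∀ j, P j ≤ 2 * m) (hA' : A' ∈ letterChoices m t P) :
    blockSet t P ⊆ range (2 * m + totalLen t) \ A' := fun _ hx =>
  mem_sdiff.2 ⟨blockSet_subset_range hPm hx, fun h =>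
    Finset.disjoint_left.1 (letters_subset hA').2.1 h hx⟩

theorem below_block_end {A : Finset ℕ} (hA : blockSet t P ⊆ A) (j : Fin c) :
    below A (runStart (blockLen ∘ t) P j + blockLen (t j)) =
      below A (runStart (blockLen ∘ t) P j) + blockLen (t j) :=
  below_add (fun i hi => hA (mem_runSet.2 ⟨j, i, hi, rfl⟩)) le_rfl

theorem runStart_gap (hP : StrictMono P) {i j : Fin c} (hij : i < j) :
    runStart (blockLen ∘ t) P i + blockLen (t i) < runStart (blockLen ∘ t) P j := by
  have := runStart_add_le (blockLen ∘ t) P hij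
  have := hP hij
  simp only [Function.comp] at *
  omega

/-- The letters of the first path between two blocks separate them in the first path. -/
theorem blockVertexStart_gap (hP : StrictMono P) {i j : Fin c} (hij : i < j) :
    blockVertexStart t P A' i + blockLen (t i) + #(A' ∩ gapPlaces t P i j) ≤
      blockVertexStart t P A' j := by
  unfold blockVertexStart
  rw [← below_block_end subset_union_right]
  refine card_add_below_le (inter_subset_left.trans subset_union_left) (fun x hx => ?_)
    (runStart_gap hP hij).le
  exact mem_Ico.1 (mem_sdiff.1 (mem_inter.1 hx).2).1

/-- The letters of the second path between two blocks separate them in the second path. -/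
theorem blockPosStart_gap (hP : StrictMono P) (hPm : ∀ j, P j ≤ 2 * m)
    (hA' : A' ∈ letterChoices m t P) {i j : Fin c} (hij : i < j) :
    blockPosStart m t P A' i + blockLen (t i) + #(gapPlaces t P i j \ A') ≤
      blockPosStart m t P A' j := by
  unfold blockPosStart
  rw [← below_block_end (blockSet_subset_sdiff hPm hA')]
  refine card_add_below_le (fun x hx => ?_) (fun x hx => ?_) (runStart_gap hP hij).le
  · rw [mem_sdiff] at hx ⊢
    refine ⟨?_, hx.2⟩
    have h1 := (mem_Ico.1 (mem_sdiff.1 hx.1).1).2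
    have h2 := blockSet_subset_range (t := t) hPm
      (mem_runSet.2 ⟨j, 0, blockLen_pos _, rfl⟩ : runStart (blockLen ∘ t) P j + 0 ∈ blockSet t P)
    rw [mem_range] at h2 ⊢
    omega
  · exact mem_Ico.1 (mem_sdiff.1 (mem_sdiff.1 hx).1).1

theorem blockVertexStart_lt (hn1 : 1 ≤ n) (hn : n - 1 = m + totalLen t) (hP : StrictMono P)
    (hA' : A' ∈ letterChoices m t P) (j : Fin c) :
    blockVertexStart t P A' j + blockLen (t j) < n := by
  unfold blockVertexStart
  rw [← below_block_end subset_union_right]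
  have h1 := below_le_card (A' ∪ blockSet t P) (runStart (blockLen ∘ t) P j + blockLen (t j))
  obtain ⟨-, hd, hm⟩ := letters_subset hA'
  have hD : #(blockSet t P) = totalLen t := card_runSet _ hP.monotone
  rw [card_union_of_disjoint hd, hm, hD] at h1
  omega

theorem blockPosStart_lt (hn1 : 1 ≤ n) (hn : n - 1 = m + totalLen t)
    (hPm : ∀ j, P j ≤ 2 * m) (hA' : A' ∈ letterChoices m t P) (j : Fin c) :
    blockPosStart m t P A' j + blockLen (t j) < n := by
  unfold blockPosStart
  rw [← below_block_end (blockSet_subset_sdiff hPm hA')]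
  have h1 := below_le_card (range (2 * m + totalLen t) \ A')
    (runStart (blockLen ∘ t) P j + blockLen (t j))
  obtain ⟨hs, -, hm⟩ := letters_subset hA'
  rw [card_sdiff_of_subset hs, card_range, hm] at h1
  omega

/-- Prescribing the blocks leaves a permutation of the free places: there are `m + 1 - c` of
these. -/
theorem card_fitPerms_le (hn1 : 1 ≤ n) (hn : n - 1 = m + totalLen t) (hP : StrictMono P)
    (hPm : ∀ j, P j ≤ 2 * m) (hA' : A' ∈ letterChoices m t P) :
    #(fitPerms n t P A') ≤ if c ≤ m + 1 then (m + 1 - c).factorial else 0 := by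
  rcases (fitPerms n t P A').eq_empty_or_nonempty with h | ⟨φ, hφ⟩
  · rw [h]; simp
  · have hbn := blockPosStart_lt hn1 hn hPm hA'
    have hφ' := ((mem_fitPerms_iff hn).1 hφ).2
    -- two blocks cannot share a position: they would send it to different vertices
    have hb : ∀ i j, i < j →
        blockPosStart m t P A' i + (blockLen ∘ t) i < blockPosStart m t P A' j := by
      intro i j hij
      have h1 := blockPosStart_gap hP hPm hA' hij
      have h2 := blockVertexStart_gap (t := t) (A' := A') hP hij
      have h3 := card_gapPlaces t hP hij
      have h4 := hP hij
      have h5 := card_sdiff_add_card_inter (gapPlaces t P i j) A'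
      rw [inter_comm] at h5
      by_contra hlt
      simp only [Function.comp] at hlt
      have e1 := hφ' i _ le_rfl
      have e2 := hφ' j 0 (Nat.zero_le _)
      rw [show blockPosStart m t P A' i + blockLen (t i) = blockPosStart m t P A' j + 0 by omega,
        e2] at e1
      have := blockVert_le (le_refl (blockLen (t i)))
      omega
    have hsub := blockPositions_subset_range hbn
    have hcard : #(finPart n (blockPositions (blockLen ∘ t) (blockPosStart m t P A'))) =
        totalLen t + c := by
      rw [card_finPart hsub, card_blockPositions hb]
      rfl
    have hle : totalLen t + c ≤ n := by
      rw [← hcard]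
      simpa using card_le_univ (finPart n (blockPositions (blockLen ∘ t) (blockPosStart m t P A')))
    rw [if_pos (by omega)]
    calc #(fitPerms n t P A') ≤ #(agreeing (finPart n (blockPositions (blockLen ∘ t)
          (blockPosStart m t P A'))) φ) := by
          refine card_le_card fun τ hτ => ?_
          exact (followsBlocks_iff hbn hφ').1 ((mem_fitPerms_iff hn).1 hτ).2
      _ = (m + 1 - c).factorial := by
          rw [card_agreeing_perm, hcard]
          congr 1
          omega

/-- Any two blocks are separated by at least two letters of either kind. -/
def WellSeparated {c : ℕ} (t P : Fin c → ℕ) (A' : Finset ℕ) : Prop :=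
  ∀ i j, i < j → 2 ≤ #(A' ∩ gapPlaces t P i j) ∧ 2 ≤ #(gapPlaces t P i j \ A')

/-- For well separated blocks, the permutations that fit are those that take certain prescribed
values and have no shared edge besides the prescribed ones. -/
theorem exists_fitPerms_eq (hn1 : 1 ≤ n) (hn : n - 1 = m + totalLen t) (hP : StrictMono P)
    (hPm : ∀ j, P j ≤ 2 * m) (hA' : A' ∈ letterChoices m t P) (hsep : WellSeparated t P A') :
    ∃ (Q : Finset (Fin n)) (φ : Equiv.Perm (Fin n)), #Q = totalLen t + c ∧
      fitPerms n t P A' = tightExtensions Q φ := by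
  have hbn := blockPosStart_lt hn1 hn hPm hA'
  have han := blockVertexStart_lt hn1 hn hP hA'
  have hb : ∀ i j, i < j →
      blockPosStart m t P A' i + blockLen (t i) < blockPosStart m t P A' j := by
    intro i j hij
    have h1 := blockPosStart_gap hP hPm hA' hij
    have h2 := (hsep i j hij).2
    omega
  have ha : ∀ i j, i < j →
      blockVertexStart t P A' i + blockLen (t i) + 1 < blockVertexStart t P A' j := by
    intro i j hij
    have h1 := blockVertexStart_gap (t := t) (A' := A') hP hij
    have h2 := (hsep i j hij).1
    omega
  obtain ⟨φ, hφ⟩ := exists_followsBlocks hbn han hb fun i j hij => by have := ha i j hij; omega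
  have hsub := blockPositions_subset_range hbn
  refine ⟨finPart n (blockPositions (blockLen ∘ t) (blockPosStart m t P A')), φ, ?_, ?_⟩
  · rw [card_finPart hsub, card_blockPositions (ℓ := blockLen ∘ t) hb]
    rfl
  · ext τ
    rw [mem_fitPerms_iff hn, tightExtensions, mem_filter, image_finPart hsub,
      ← followsBlocks_iff hbn hφ, and_comm]
    exact and_congr_right fun hτ => card_consecPos_eq_iff hbn hb ha hτ

end Words

/-! ### Most insertions separate the blocks -/

/-- Sets that meet `I` in at most one element are few when `I` is large. -/
theorem card_powerset_inter_le_one {V I : Finset ℕ} (hI : I ⊆ V) :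
    #{S ∈ V.powerset | #(S ∩ I) ≤ 1} ≤ (#I + 1) * 2 ^ (#V - #I) := by
  have h1 : #(powersetCard 0 I ∪ powersetCard 1 I) ≤ #I + 1 := by
    refine (card_union_le _ _).trans ?_
    simp [add_comm]
  have h2 : #(V \ I).powerset = 2 ^ (#V - #I) := by
    rw [card_powerset, card_sdiff_of_subset hI]
  rw [← h2]
  refine le_trans ?_ (Nat.mul_le_mul_right _ h1)
  rw [← card_product]
  refine card_le_card_of_injOn (fun S => (S ∩ I, S \ I)) ?_ ?_
  · intro S hS
    rw [mem_coe, mem_filter, mem_powerset] at hS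
    rw [mem_coe, mem_product, mem_union, mem_powersetCard, mem_powersetCard, mem_powerset]
    refine ⟨?_, sdiff_subset_sdiff hS.1 subset_rfl⟩
    have : #(S ∩ I) = 0 ∨ #(S ∩ I) = 1 := by omega
    rcases this with h | h
    · exact Or.inl ⟨inter_subset_right, h⟩
    · exact Or.inr ⟨inter_subset_right, h⟩
  · intro S _ S' _ h
    simp only [Prod.mk.injEq] at h
    rw [← sdiff_union_inter S I, h.1, h.2, sdiff_union_inter]

theorem card_powerset_sdiff_le_one {V I : Finset ℕ} (hI : I ⊆ V) :
    #{S ∈ V.powerset | #(I \ S) ≤ 1} ≤ (#I + 1) * 2 ^ (#V - #I) := by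
  refine le_trans ?_ (card_powerset_inter_le_one hI)
  refine card_le_card_of_injOn (fun S => V \ S) ?_ ?_
  · intro S hS
    rw [mem_coe, mem_filter, mem_powerset] at hS ⊢
    refine ⟨sdiff_subset, ?_⟩
    have : V \ S ∩ I = I \ S := by
      ext x
      simp only [mem_inter, mem_sdiff]
      exact ⟨fun h => ⟨h.2, h.1.2⟩, fun h => ⟨⟨hI h.1, h.2⟩, h.1⟩⟩
    rw [this]
    exact hS.2
  · intro S hS S' hS' h
    rw [mem_coe, mem_filter, mem_powerset] at hS hS'
    simp only at h
    rw [← Finset.sdiff_sdiff_eq_self hS.1, h, Finset.sdiff_sdiff_eq_self hS'.1]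

/-- Slots `i` and `j` closer than `g` leave `g` choices for the `j`-th slot, given the others. -/
theorem card_close_slots_le {c M : ℕ} (g : ℕ) {i j : Fin c} (hij : i < j) :
    #{P ∈ slotChoices c M | (P j : ℕ) - P i < g} ≤ g * M ^ (c - 1) := by
  have h : #(range g ×ˢ (univ : Finset ({x : Fin c // x ≠ j} → Fin M))) = g * M ^ (c - 1) := by
    rw [card_product, card_range, card_univ, Fintype.card_fun, Fintype.card_fin]
    simp
  rw [← h]
  refine card_le_card_of_injOn (fun P => ((P j : ℕ) - P i, fun x => P x)) ?_ ?_
  · intro P hP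
    rw [mem_coe, mem_filter] at hP
    simpa using hP.2
  · intro P hP P' hP' h
    rw [mem_coe, mem_filter, mem_slotChoices] at hP hP'
    simp only [Prod.mk.injEq] at h
    have h1 := hP.1 hij
    have h2 := hP'.1 hij
    rw [Fin.lt_def] at h1 h2
    funext x
    by_cases hx : x = j
    · subst hx
      have h3 := congrFun h.2 ⟨i, hij.ne⟩
      simp only at h3
      rw [h3] at h h1
      exact Fin.ext (by omega)
    · exact congrFun h.2 ⟨x, hx⟩

theorem card_letterChoices {c m : ℕ} (t : Fin c → ℕ) {P : Fin c → ℕ} (hP : StrictMono P)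
    (hPm : ∀ j, P j ≤ 2 * m) : #(letterChoices m t P) = (2 * m).choose m := by
  rw [letterChoices, card_powersetCard, card_sdiff_of_subset (blockSet_subset_range hPm),
    card_range, blockSet, card_runSet _ hP.monotone]
  congr 1
  have : ∑ j, (blockLen ∘ t) j = totalLen t := rfl
  omega

open Classical in
/-- The number of ways to insert the blocks `t` into a word such that two blocks are not well
separated. -/
noncomputable def badCount {c : ℕ} (m : ℕ) (t : Fin c → ℕ) : ℕ :=
  ∑ P ∈ slotChoices c (2 * m + 1),
    #{A' ∈ letterChoices m t (fun j => (P j : ℕ)) | ¬ WellSeparated t (fun j => (P j : ℕ)) A'}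

/-- Two blocks are rarely close: either their slots are close, which is rare among the choices of
slots, or a long gap contains at most one letter of one kind, which is rare among the words. -/
theorem badCount_le {c : ℕ} (m g : ℕ) (t : Fin c → ℕ) :
    badCount m t ≤ c ^ 2 * (g * (2 * m + 1) ^ (c - 1) * (2 * m).choose m +
      (2 * m + 1).choose c * (2 * ((2 * m + 1) * 2 ^ (2 * m - g)))) := by
  classical
  set F : ℕ := 2 * ((2 * m + 1) * 2 ^ (2 * m - g)) with hF
  have key : ∀ P ∈ slotChoices c (2 * m + 1),
      #{A' ∈ letterChoices m t (fun j => (P j : ℕ)) | ¬ WellSeparated t (fun j => (P j : ℕ)) A'} ≤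
      ∑ z : Fin c × Fin c, if z.1 < z.2 ∧ (P z.2 : ℕ) - P z.1 < g then (2 * m).choose m else F := by
    intro P hP
    have hPs : StrictMono fun j => (P j : ℕ) := fun i j hij =>
      Fin.lt_def.1 (mem_slotChoices.1 hP hij)
    have hPm : ∀ j, (P j : ℕ) ≤ 2 * m := fun j => by omega
    set P' : Fin c → ℕ := fun j => (P j : ℕ) with hP'
    have hsub : {A' ∈ letterChoices m t P' | ¬ WellSeparated t P' A'} ⊆
        (univ : Finset (Fin c × Fin c)).biUnion fun z => {A' ∈ letterChoices m t P' |
          z.1 < z.2 ∧ (#(A' ∩ gapPlaces t P' z.1 z.2) ≤ 1 ∨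
            #(gapPlaces t P' z.1 z.2 \ A') ≤ 1)} := by
      intro A' hA'
      rw [mem_filter] at hA'
      have h := hA'.2
      unfold WellSeparated at h
      push Not at h
      obtain ⟨i, j, hij, h⟩ := h
      refine mem_biUnion.2 ⟨(i, j), mem_univ _, mem_filter.2 ⟨hA'.1, hij, ?_⟩⟩
      simp only
      omega
    refine (card_le_card hsub).trans (card_biUnion_le.trans (sum_le_sum fun z _ => ?_))
    split_ifs with hz
    · rw [← card_letterChoices t hPs hPm]
      exact card_le_card (filter_subset _ _)
    · rcases lt_or_ge z.1 z.2 with hlt | hge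
      · have hI : gapPlaces t P' z.1 z.2 ⊆ range (2 * m + totalLen t) \ blockSet t P' := by
          intro x hx
          rw [gapPlaces, mem_sdiff, mem_Ico] at hx
          refine mem_sdiff.2 ⟨?_, hx.2⟩
          have h2 := blockSet_subset_range (t := t) hPm
            (mem_runSet.2 ⟨z.2, 0, blockLen_pos _, rfl⟩ :
              runStart (blockLen ∘ t) P' z.2 + 0 ∈ blockSet t P')
          rw [mem_range] at h2 ⊢
          omega
        have hVc : #(range (2 * m + totalLen t) \ blockSet t P') = 2 * m := by
          rw [card_sdiff_of_subset (blockSet_subset_range hPm),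
            card_range, blockSet, card_runSet _ hPs.monotone]
          have : ∑ j, (blockLen ∘ t) j = totalLen t := rfl
          omega
        have hIc := card_gapPlaces t hPs hlt
        have hg : g ≤ #(gapPlaces t P' z.1 z.2) := by
          rw [hIc]
          by_contra h
          exact hz ⟨hlt, by simpa [hP'] using h⟩
        have hI2 : #(gapPlaces t P' z.1 z.2) ≤ 2 * m := by
          rw [← hVc]; exact card_le_card hI
        have hbound : (#(gapPlaces t P' z.1 z.2) + 1) * 2 ^ (2 * m - #(gapPlaces t P' z.1 z.2)) ≤
            (2 * m + 1) * 2 ^ (2 * m - g) := by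
          refine Nat.mul_le_mul (by omega) (Nat.pow_le_pow_right (by norm_num) (by omega))
        have e1 := card_powerset_inter_le_one hI
        have e2 := card_powerset_sdiff_le_one hI
        rw [hVc] at e1 e2
        have hsub2 : {A' ∈ letterChoices m t P' | z.1 < z.2 ∧
            (#(A' ∩ gapPlaces t P' z.1 z.2) ≤ 1 ∨ #(gapPlaces t P' z.1 z.2 \ A') ≤ 1)} ⊆
            {S ∈ (range (2 * m + totalLen t) \ blockSet t P').powerset |
              #(S ∩ gapPlaces t P' z.1 z.2) ≤ 1} ∪
            {S ∈ (range (2 * m + totalLen t) \ blockSet t P').powerset |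
              #(gapPlaces t P' z.1 z.2 \ S) ≤ 1} := by
          intro A' hA'
          rw [mem_filter, letterChoices, mem_powersetCard] at hA'
          rw [mem_union, mem_filter, mem_filter, mem_powerset]
          rcases hA'.2.2 with h | h
          · exact Or.inl ⟨hA'.1.1, h⟩
          · exact Or.inr ⟨hA'.1.1, h⟩
        have e3 := (card_le_card hsub2).trans (card_union_le _ _)
        omega
      · rw [filter_false_of_mem (fun _ _ h => absurd h.1 (not_lt.2 hge)), card_empty]
        exact Nat.zero_le _
  refine (sum_le_sum key).trans ?_
  rw [sum_comm]
  have hpair : ∀ z : Fin c × Fin c, (∑ P ∈ slotChoices c (2 * m + 1),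
      if z.1 < z.2 ∧ (P z.2 : ℕ) - P z.1 < g then (2 * m).choose m else F) ≤
      g * (2 * m + 1) ^ (c - 1) * (2 * m).choose m + (2 * m + 1).choose c * F := by
    intro z
    rw [sum_ite, sum_const, sum_const, smul_eq_mul, smul_eq_mul]
    refine Nat.add_le_add (Nat.mul_le_mul_right _ ?_) (Nat.mul_le_mul_right _ ?_)
    · by_cases hz : z.1 < z.2
      · simp only [hz, true_and]
        exact card_close_slots_le g hz
      · simp [hz]
    · rw [← card_slotChoices]
      exact card_filter_le _ _
  refine (sum_le_sum fun z _ => hpair z).trans ?_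
  rw [sum_const, card_univ, Fintype.card_prod, Fintype.card_fin, smul_eq_mul, sq]

/-- The number of ways to insert `c` blocks into a word times the number of permutations
following given blocks. -/
noncomputable def relaxedCount (c m : ℕ) : ℝ :=
  (2 * m + 1).choose c * (2 * m).choose m * (m + 1 - c).factorial

/-- The bound `relaxedCount`, and the vanishing of the count when the blocks do not fit. -/
theorem typeCount_le {n c m : ℕ} (t : Fin c → ℕ) (hn1 : 1 ≤ n) (hn : n - 1 = m + totalLen t) :
    typeCount n ⟨c, t⟩ ≤ (2 * m + 1).choose c * (2 * m).choose m *
      if c ≤ m + 1 then (m + 1 - c).factorial else 0 := by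
  rw [typeCount_eq t hn, ← card_slotChoices, mul_assoc]
  refine sum_le_card_nsmul _ _ _ fun P hP => ?_
  have hPs : StrictMono fun j => (P j : ℕ) := fun i j hij =>
    Fin.lt_def.1 (mem_slotChoices.1 hP hij)
  have hPm : ∀ j, (P j : ℕ) ≤ 2 * m := fun j => by omega
  rw [← card_letterChoices t hPs hPm]
  refine sum_le_card_nsmul _ _ _ fun A' hA' => ?_
  exact card_fitPerms_le hn1 hn hPs hPm hA'

open Filter Topology in
/-- The count of a type is `e⁻²` times the relaxed count, up to the badly separated insertions. -/
theorem eventually_abs_typeCount_sub_le {c : ℕ} (t : Fin c → ℕ) {ε : ℝ} (hε : 0 < ε) :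
    ∀ᶠ m : ℕ in atTop, |(typeCount (m + totalLen t + 1) ⟨c, t⟩ : ℝ) -
      Real.exp (-2) * relaxedCount c m| ≤
        ε * relaxedCount c m + badCount m t * (m + 1 - c).factorial := by
  classical
  have h1 := eventually_card_tightExtensions (totalLen t + c) hε
  have h2 : Tendsto (fun m : ℕ => m + totalLen t + 1) atTop atTop :=
    tendsto_atTop_mono (fun m => by simp only [id]; omega) tendsto_id
  filter_upwards [h2.eventually h1, eventually_ge_atTop c] with m hm hmc
  set n := m + totalLen t + 1 with hn
  have hn' : n - 1 = m + totalLen t := by omega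
  have hF : n - (totalLen t + c) = m + 1 - c := by omega
  rw [hF] at hm
  set F : ℝ := ((m + 1 - c).factorial : ℝ) with hFdef
  have hF0 : 0 ≤ F := by positivity
  have hexp : Real.exp (-2) ≤ 1 := Real.exp_le_one_iff.2 (by norm_num)
  have hexp0 : 0 ≤ Real.exp (-2) := (Real.exp_pos _).le
  have hrel : relaxedCount c m = ∑ P ∈ slotChoices c (2 * m + 1),
      ∑ A' ∈ letterChoices m t (fun j => (P j : ℕ)), F := by
    rw [sum_congr rfl (g := fun _ => (2 * m).choose m * F)]
    · rw [sum_const, card_slotChoices, nsmul_eq_mul, relaxedCount, ← mul_assoc]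
    · intro P hP
      rw [sum_const, nsmul_eq_mul, card_letterChoices t
        (fun i j hij => Fin.lt_def.1 (mem_slotChoices.1 hP hij)) (fun j => by omega)]
  have hbad : (badCount m t : ℝ) * F = ∑ P ∈ slotChoices c (2 * m + 1),
      ∑ A' ∈ letterChoices m t (fun j => (P j : ℕ)),
        if ¬ WellSeparated t (fun j => (P j : ℕ)) A' then F else 0 := by
    rw [badCount, Nat.cast_sum, sum_mul]
    refine sum_congr rfl fun P _ => ?_
    rw [← sum_filter, sum_const, nsmul_eq_mul]
  rw [typeCount_eq t hn', hrel, hbad, mul_sum, mul_sum]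
  push_cast
  rw [← sum_sub_distrib, ← sum_add_distrib]
  refine (abs_sum_le_sum_abs _ _).trans (sum_le_sum fun P hP => ?_)
  rw [mul_sum, mul_sum, ← sum_sub_distrib, ← sum_add_distrib]
  refine (abs_sum_le_sum_abs _ _).trans (sum_le_sum fun A' hA' => ?_)
  have hPs : StrictMono fun j => (P j : ℕ) := fun i j hij =>
    Fin.lt_def.1 (mem_slotChoices.1 hP hij)
  have hPm : ∀ j, (P j : ℕ) ≤ 2 * m := fun j => by omega
  by_cases hsep : WellSeparated t (fun j => (P j : ℕ)) A'
  swap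
  · rw [if_pos hsep]
    have hle := card_fitPerms_le (show 1 ≤ n by omega) hn' hPs hPm hA'
    rw [if_pos (by omega)] at hle
    have hle' : (#(fitPerms n t (fun j => (P j : ℕ)) A') : ℝ) ≤ F := by
      rw [hFdef]; exact_mod_cast hle
    have h0 : (0 : ℝ) ≤ #(fitPerms n t (fun j => (P j : ℕ)) A') := by positivity
    have h3 : Real.exp (-2) * F ≤ F := mul_le_of_le_one_left hF0 hexp
    have h4 : 0 ≤ Real.exp (-2) * F := by positivity
    have h5 : 0 ≤ ε * F := by positivity
    rw [abs_le]
    constructor <;> linarith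
  · rw [if_neg (not_not.2 hsep)]
    obtain ⟨Q, φ, hQ, he⟩ := exists_fitPerms_eq (show 1 ≤ n by omega) hn' hPs hPm hA' hsep
    rw [he, add_zero]
    exact hm Q φ hQ

open Filter Topology in
/-- The proportion of badly separated insertions tends to zero. -/
theorem tendsto_badCount_div {c : ℕ} (t : Fin c → ℕ) :
    Tendsto (fun m : ℕ => (badCount m t : ℝ) / ((2 * m + 1).choose c * (2 * m).choose m))
      atTop (𝓝 0) := by
  -- slots at distance less than `√m` are called close
  have hg : Tendsto (fun m : ℕ => Nat.sqrt m) atTop atTop := by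
    refine tendsto_atTop.2 fun b => ?_
    filter_upwards [eventually_ge_atTop (b * b)] with m hm
    exact Nat.le_sqrt.2 hm
  -- contribution of close slots
  have l1 : Tendsto (fun m : ℕ => (1 : ℝ) / Nat.sqrt m) atTop (𝓝 0) :=
    tendsto_one_div_atTop_nhds_zero_nat.comp hg
  -- contribution of unbalanced words
  have l2 : Tendsto (fun m : ℕ => ((Nat.sqrt m + 1 : ℕ) : ℝ) ^ 4 / 2 ^ (Nat.sqrt m + 1)) atTop
      (𝓝 0) := by
    have h := tendsto_pow_const_div_const_pow_of_one_lt 4 (show (1 : ℝ) < 2 by norm_num)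
    have h2 : Tendsto (fun m : ℕ => Nat.sqrt m + 1) atTop atTop :=
      tendsto_atTop_mono (fun m => Nat.le_succ _) hg
    exact h.comp h2
  set C1 : ℝ := (c : ℝ) ^ 2 * ((c.factorial : ℝ) * 3 ^ c) with hC1
  set C2 : ℝ := (c : ℝ) ^ 2 * 24 with hC2
  have hlim : Tendsto (fun m : ℕ => C1 * ((1 : ℝ) / Nat.sqrt m) +
      C2 * (((Nat.sqrt m + 1 : ℕ) : ℝ) ^ 4 / 2 ^ (Nat.sqrt m + 1))) atTop (𝓝 0) := by
    simpa using (l1.const_mul C1).add (l2.const_mul C2)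
  refine squeeze_zero' (Eventually.of_forall fun m => by positivity) ?_ hlim
  filter_upwards [eventually_ge_atTop 1, eventually_ge_atTop c] with m hm1 hmc
  set g := Nat.sqrt m with hgdef
  have hg1 : 1 ≤ g := Nat.le_sqrt.2 (by omega)
  have hgm : g * g ≤ m := Nat.sqrt_le m
  have hgm' : m < (g + 1) * (g + 1) := Nat.lt_succ_sqrt m
  have hgR : (0 : ℝ) < g := by exact_mod_cast hg1
  have hmR : (1 : ℝ) ≤ m := by exact_mod_cast hm1
  set X : ℝ := ((2 * m + 1).choose c : ℝ) with hX
  set Y : ℝ := ((2 * m).choose m : ℝ) with hY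
  have hX0 : 0 < X := by
    rw [hX]; exact_mod_cast Nat.choose_pos (by omega)
  have hY0 : 0 < Y := by
    rw [hY]; exact_mod_cast Nat.choose_pos (by omega)
  have hXl : (2 * m + 1 : ℝ) ^ c ≤ c.factorial * 3 ^ c * X := by
    have h1 : ((2 * m + 1 + 1 - c : ℕ) : ℝ) ^ c / c.factorial ≤ X := Nat.pow_le_choose c (2 * m + 1)
    rw [div_le_iff₀ (by positivity)] at h1
    have h2 : (2 * m + 1 : ℝ) ≤ 3 * ((2 * m + 1 + 1 - c : ℕ) : ℝ) := by
      have : 2 * m + 1 ≤ 3 * (2 * m + 1 + 1 - c) := by omega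
      exact_mod_cast this
    calc (2 * m + 1 : ℝ) ^ c ≤ (3 * ((2 * m + 1 + 1 - c : ℕ) : ℝ)) ^ c := by gcongr
      _ = 3 ^ c * ((2 * m + 1 + 1 - c : ℕ) : ℝ) ^ c := mul_pow _ _ _
      _ ≤ 3 ^ c * (X * c.factorial) := by gcongr
      _ = _ := by ring
  have hYl : (4 : ℝ) ^ m ≤ 2 * m * Y := by
    have := Nat.four_pow_le_two_mul_self_mul_centralBinom m (by omega)
    rw [Nat.centralBinom_eq_two_mul_choose] at this
    rw [hY]
    exact_mod_cast this
  have hb : (badCount m t : ℝ) ≤ (c : ℝ) ^ 2 * (g * (2 * m + 1) ^ (c - 1) * Y +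
      X * (2 * ((2 * m + 1) * 2 ^ (2 * m - g)))) := by
    rw [hX, hY]
    exact_mod_cast badCount_le m g t
  have e1 : (c : ℝ) ^ 2 * (g * (2 * m + 1) ^ (c - 1) * Y) ≤ C1 * (1 / g) * (X * Y) := by
    rcases Nat.eq_zero_or_pos c with rfl | hc
    · simp [hC1]
    · have h3 : (g : ℝ) * (2 * m + 1) ^ (c - 1) ≤ (c.factorial * 3 ^ c * X) * (1 / g) := by
        rw [mul_one_div, le_div_iff₀ hgR]
        refine le_trans ?_ hXl
        have h4 : (g : ℝ) * g ≤ 2 * m + 1 := by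
          have : g * g ≤ 2 * m + 1 := by omega
          exact_mod_cast this
        calc (g : ℝ) * (2 * m + 1) ^ (c - 1) * g = (2 * m + 1) ^ (c - 1) * (g * g) := by ring
          _ ≤ (2 * m + 1) ^ (c - 1) * (2 * m + 1) := by gcongr
          _ = (2 * m + 1) ^ c := by rw [← pow_succ, Nat.sub_add_cancel hc]
      calc (c : ℝ) ^ 2 * (g * (2 * m + 1) ^ (c - 1) * Y)
          ≤ (c : ℝ) ^ 2 * ((c.factorial * 3 ^ c * X) * (1 / g) * Y) := by gcongr
        _ = _ := by rw [hC1]; ring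
  have e2 : (c : ℝ) ^ 2 * (X * (2 * ((2 * m + 1) * 2 ^ (2 * m - g)))) ≤
      C2 * (((g + 1 : ℕ) : ℝ) ^ 4 / 2 ^ (g + 1)) * (X * Y) := by
    have hgle : g ≤ 2 * m := by nlinarith
    have h5 : (2 : ℝ) ^ (2 * m - g) * 2 ^ g = 4 ^ m := by
      rw [← pow_add, Nat.sub_add_cancel hgle, pow_mul]; norm_num
    have h6 : (m : ℝ) ≤ ((g + 1 : ℕ) : ℝ) ^ 2 := by
      rw [sq]; exact_mod_cast hgm'.le
    have h7 : (2 : ℝ) ^ (2 * m - g) ≤ 2 * m * Y / 2 ^ g := by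
      rw [le_div_iff₀ (by positivity), h5]; exact hYl
    have h8 : (2 * (m : ℝ) + 1) ≤ 3 * m := by linarith
    calc (c : ℝ) ^ 2 * (X * (2 * ((2 * m + 1) * 2 ^ (2 * m - g))))
        ≤ (c : ℝ) ^ 2 * (X * (2 * ((3 * m) * (2 * m * Y / 2 ^ g)))) := by gcongr
      _ = (c : ℝ) ^ 2 * 24 * ((m : ℝ) ^ 2 / 2 ^ (g + 1)) * (X * Y) := by
          rw [pow_succ]; field_simp; ring
      _ ≤ (c : ℝ) ^ 2 * 24 * ((((g + 1 : ℕ) : ℝ) ^ 2) ^ 2 / 2 ^ (g + 1)) * (X * Y) := by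
          gcongr
      _ = _ := by rw [hC2]; ring
  rw [div_le_iff₀ (by positivity)]
  calc (badCount m t : ℝ) ≤ _ := hb
    _ = (c : ℝ) ^ 2 * (g * (2 * m + 1) ^ (c - 1) * Y) +
        (c : ℝ) ^ 2 * (X * (2 * ((2 * m + 1) * 2 ^ (2 * m - g)))) := by ring
    _ ≤ C1 * (1 / g) * (X * Y) + C2 * (((g + 1 : ℕ) : ℝ) ^ 4 / 2 ^ (g + 1)) * (X * Y) :=
        add_le_add e1 e2
    _ = _ := by ring

end

section

open Finset Filter Topology
open scoped ENNReal

/-! ### The contribution of a type to the second moment -/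

/-- The product of `(m + i) / (2 m + i)` over `1 ≤ i ≤ k`: the factor which `k` shared edges contribute
to the second moment. -/
noncomputable def overlapWeight (k m : ℕ) : ℝ :=
  ((m + k).factorial * (2 * m).factorial) / (m.factorial * (2 * m + k).factorial)

/-- The number of ways to insert `c` blocks, relative to the loss `(m+1)!/(m+1-c)!` in the number
of permutations. -/
noncomputable def insertionWeight (c m : ℕ) : ℝ :=
  (2 * m + 1).choose c * (m + 1 - c).factorial / (m + 1).factorial

theorem overlapWeight_nonneg (k m : ℕ) : 0 ≤ overlapWeight k m := by
  unfold overlapWeight; positivity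

theorem insertionWeight_nonneg (c m : ℕ) : 0 ≤ insertionWeight c m := by
  unfold insertionWeight; positivity

theorem overlapWeight_zero (m : ℕ) : overlapWeight 0 m = 1 := by
  unfold overlapWeight
  rw [Nat.add_zero, Nat.add_zero]
  exact div_self (by positivity)

theorem overlapWeight_succ (k m : ℕ) :
    overlapWeight (k + 1) m = overlapWeight k m * ((m + k + 1) / (2 * m + k + 1)) := by
  unfold overlapWeight
  rw [← add_assoc, ← add_assoc, Nat.factorial_succ, Nat.factorial_succ]
  push_cast
  field_simp

theorem insertionWeight_zero (m : ℕ) : insertionWeight 0 m = 1 := by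
  unfold insertionWeight
  rw [Nat.choose_zero_right, Nat.sub_zero, Nat.cast_one, one_mul]
  exact div_self (by positivity)

theorem insertionWeight_succ {c m : ℕ} (h : c ≤ m) :
    insertionWeight (c + 1) m =
      insertionWeight c m * ((2 * m + 1 - c) / ((c + 1) * (m + 1 - c))) := by
  unfold insertionWeight
  obtain ⟨d, rfl⟩ := Nat.exists_eq_add_of_le h
  have h1 : ((2 * (c + d) + 1).choose (c + 1) : ℝ) * (c + 1) =
      (2 * (c + d) + 1).choose c * (2 * ((c + d : ℕ) : ℝ) + 1 - c) := by
    have := Nat.choose_succ_right_eq (2 * (c + d) + 1) c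
    have h2 : ((2 * (c + d) + 1 - c : ℕ) : ℝ) = 2 * ((c + d : ℕ) : ℝ) + 1 - c := by
      rw [Nat.cast_sub (by omega)]; push_cast; ring
    rw [← h2]
    exact_mod_cast this
  have h3 : c + d + 1 - c = d + 1 := by omega
  have h4 : c + d + 1 - (c + 1) = d := by omega
  have h5 : (((c + d : ℕ) : ℝ) + 1 - c) = d + 1 := by push_cast; ring
  rw [h3, h4, h5, Nat.factorial_succ d]
  push_cast at h1 ⊢
  field_simp
  linear_combination h1

theorem tendsto_overlapWeight (k : ℕ) :
    Tendsto (overlapWeight k) atTop (𝓝 ((1 / 2) ^ k)) := by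
  induction k with
  | zero => simp [funext overlapWeight_zero]
  | succ k ih =>
    rw [funext (overlapWeight_succ k), pow_succ]
    refine ih.mul ?_
    have h1 : Tendsto (fun m : ℕ => 1 - (m : ℝ) / (2 * m + (k + 1))) atTop (𝓝 (1 - 1 / 2)) := by
      refine tendsto_const_nhds.sub ?_
      have := tendsto_add_mul_div_add_mul_atTop_nhds (𝕜 := ℝ) 0 (k + 1) 1 (d := 2) (by norm_num)
      refine this.congr fun m => ?_
      rw [zero_add, one_mul, add_comm]
    rw [show (1 / 2 : ℝ) = 1 - 1 / 2 by norm_num]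
    refine h1.congr fun m => ?_
    have : (2 * (m : ℝ) + k + 1) ≠ 0 := by positivity
    field_simp
    ring

theorem tendsto_insertionWeight (c : ℕ) :
    Tendsto (insertionWeight c) atTop (𝓝 (2 ^ c / c.factorial)) := by
  induction c with
  | zero => simp [funext insertionWeight_zero]
  | succ c ih =>
    have h1 : Tendsto (fun m : ℕ => insertionWeight c m *
        (((1 - c) + 2 * (m : ℝ)) / (((c + 1) * (1 - c)) + (c + 1) * m))) atTop
        (𝓝 (2 ^ c / c.factorial * (2 / (c + 1)))) :=
      ih.mul (tendsto_add_mul_div_add_mul_atTop_nhds (𝕜 := ℝ) (1 - c) ((c + 1) * (1 - c)) 2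
        (d := c + 1) (by positivity))
    have h2 : (2 : ℝ) ^ c / c.factorial * (2 / (c + 1)) = 2 ^ (c + 1) / (c + 1).factorial := by
      rw [Nat.factorial_succ, pow_succ]; push_cast; field_simp
    rw [← h2]
    refine h1.congr' ?_
    filter_upwards [eventually_ge_atTop c] with m hm
    rw [insertionWeight_succ hm]
    congr 2 <;> ring

theorem overlapWeight_le_pow {k m : ℕ} (h : k ≤ 12 * m) :
    overlapWeight k m ≤ (13 / 14) ^ k := by
  induction k with
  | zero => rw [overlapWeight_zero, pow_zero]
  | succ k ih =>
    rw [overlapWeight_succ, pow_succ]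
    have h' : (k : ℝ) + 1 ≤ 12 * m := by exact_mod_cast h
    refine mul_le_mul (ih (by omega)) ?_ (by positivity) (by positivity)
    rw [div_le_iff₀ (by positivity)]
    linarith

/-- This bound is useful when `k` is much larger than `m`. -/
theorem overlapWeight_le_div_pow {k m : ℕ} (hk : 0 < k) :
    overlapWeight k m ≤ (2 * m / k) ^ m := by
  have h1 : ((2 * m).factorial : ℝ) ≤ m.factorial * (2 * m) ^ m := by
    have h := Nat.factorial_mul_ascFactorial m m
    have h' := Nat.ascFactorial_le_pow_add m m
    rw [← two_mul] at h h'
    rw [← h]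
    push_cast
    gcongr
    exact_mod_cast h'
  have h2 : ((m + k).factorial : ℝ) * k ^ m ≤ (2 * m + k).factorial := by
    have h := Nat.factorial_mul_pow_le_factorial (m := m + k) (n := m)
    rw [show m + k + m = 2 * m + k by ring] at h
    have h' : (m + k).factorial * k ^ m ≤ (m + k).factorial * (m + k + 1) ^ m := by
      gcongr; omega
    exact_mod_cast h'.trans h
  unfold overlapWeight
  have hk' : (0 : ℝ) < k := by exact_mod_cast hk
  rw [div_pow, div_le_div_iff₀ (by positivity) (by positivity)]
  calc ((m + k).factorial : ℝ) * (2 * m).factorial * k ^ m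
      = ((m + k).factorial * k ^ m) * (2 * m).factorial := by ring
    _ ≤ (2 * m + k).factorial * (m.factorial * (2 * m) ^ m) := by gcongr
    _ = _ := by ring

theorem insertionWeight_le {c m : ℕ} (h : c ≤ m + 1) :
    insertionWeight c m ≤ 16 ^ c / c.factorial := by
  have hkey : ((2 * m + 1).choose c : ℝ) ≤ 16 ^ c * (m + 1).choose c := by
    -- if `c` is a positive proportion of `m`, the bound `2 ^ (2 m + 1)` is good enough
    rcases le_or_gt (m + 1) (2 * c) with h1 | h1
    · have h2 : (2 * m + 1).choose c ≤ 2 ^ (2 * m + 1) := Nat.choose_le_two_pow _ _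
      have h3 : 2 ^ (2 * m + 1) ≤ 16 ^ c := by
        rw [show 16 = 2 ^ 4 by norm_num, ← pow_mul]
        exact Nat.pow_le_pow_right (by norm_num) (by omega)
      have h4 : 0 < (m + 1).choose c := Nat.choose_pos h
      exact_mod_cast (h2.trans h3).trans (Nat.le_mul_of_pos_right _ h4)
    · have h2 : ((2 * m + 1).choose c : ℝ) ≤ (2 * m + 1 : ℕ) ^ c / c.factorial :=
        Nat.choose_le_pow_div _ _
      have h3 : ((m + 1 + 1 - c : ℕ) : ℝ) ^ c / c.factorial ≤ (m + 1).choose c :=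
        Nat.pow_le_choose c (m + 1)
      refine h2.trans ?_
      calc ((2 * m + 1 : ℕ) : ℝ) ^ c / c.factorial
          ≤ (16 * ((m + 1 + 1 - c : ℕ) : ℝ)) ^ c / c.factorial := by
            gcongr
            have : 2 * m + 1 ≤ 16 * (m + 1 + 1 - c) := by omega
            exact_mod_cast this
        _ = 16 ^ c * (((m + 1 + 1 - c : ℕ) : ℝ) ^ c / c.factorial) := by
            rw [mul_pow, mul_div_assoc]
        _ ≤ _ := by gcongr
  have hch : ((m + 1).choose c : ℝ) * c.factorial * (m + 1 - c).factorial =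
      (m + 1).factorial := by exact_mod_cast Nat.choose_mul_factorial_mul_factorial h
  unfold insertionWeight
  rw [div_le_div_iff₀ (by positivity) (by positivity), ← hch]
  calc ((2 * m + 1).choose c : ℝ) * (m + 1 - c).factorial * c.factorial
      ≤ (16 ^ c * (m + 1).choose c) * (m + 1 - c).factorial * c.factorial := by gcongr
    _ = _ := by ring

/-- The contribution of the type `T` to the second moment divided by `n ^ 2`. -/
noncomputable def typeTerm (n : ℕ) (T : WordType) : ℝ :=
  n.factorial * (typeCount n T / (2 * (n - 1) - totalLen T.2).factorial) / n ^ 2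

theorem typeTerm_nonneg (n : ℕ) (T : WordType) : 0 ≤ typeTerm n T := by
  unfold typeTerm; positivity

theorem typeTerm_eq_zero {n : ℕ} {T : WordType} (h : typeCount n T = 0) : typeTerm n T = 0 := by
  unfold typeTerm; rw [h]; simp

theorem integral_numIncreasing_sq_div (n : ℕ) :
    (∫ f, (numIncreasing f : ℝ) ^ 2 ∂(randomOrdering n)) / n ^ 2 = ∑' T, typeTerm n T := by
  rw [integral_numIncreasing_sq, sum_card_isIncreasing_pair, ← tsum_mul_left, ← tsum_div_const]
  rfl

theorem relaxedCount_pos {c m : ℕ} (h : c ≤ 2 * m + 1) : 0 < relaxedCount c m := by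
  unfold relaxedCount
  have h1 : 0 < (2 * m + 1).choose c := Nat.choose_pos h
  have h2 : 0 < (2 * m).choose m := Nat.choose_pos (by omega)
  positivity

/-- The contribution of a type if `typeCount` were `relaxedCount`. -/
theorem relaxed_term_eq (c k m : ℕ) :
    ((m + k + 1).factorial : ℝ) * (relaxedCount c m / (2 * m + k).factorial) /
        ((m + k + 1 : ℕ) : ℝ) ^ 2 =
      (m + 1) / ((m + k + 1 : ℕ) : ℝ) * overlapWeight k m * insertionWeight c m := by
  have h := Nat.choose_mul_factorial_mul_factorial (n := 2 * m) (k := m) (by omega)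
  rw [show 2 * m - m = m by omega] at h
  have h' : ((2 * m).choose m : ℝ) * m.factorial * m.factorial = (2 * m).factorial := by
    exact_mod_cast h
  unfold relaxedCount overlapWeight insertionWeight
  rw [← h', Nat.factorial_succ, Nat.factorial_succ m]
  push_cast
  field_simp

theorem typeTerm_eq {m : ℕ} (T : WordType) (hc : T.1 ≤ 2 * m + 1) :
    typeTerm (m + totalLen T.2 + 1) T =
      typeCount (m + totalLen T.2 + 1) T / relaxedCount T.1 m *
        ((m + 1) / ((m + totalLen T.2 + 1 : ℕ) : ℝ) * overlapWeight (totalLen T.2) m *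
          insertionWeight T.1 m) := by
  rw [← relaxed_term_eq]
  have h := (relaxedCount_pos hc).ne'
  unfold typeTerm
  rw [show 2 * (m + totalLen T.2 + 1 - 1) - totalLen T.2 = 2 * m + totalLen T.2 by omega]
  field_simp

theorem typeTerm_le {m : ℕ} (T : WordType) :
    typeTerm (m + totalLen T.2 + 1) T ≤ (m + 1) / ((m + totalLen T.2 + 1 : ℕ) : ℝ) *
      overlapWeight (totalLen T.2) m * (16 ^ T.1 / T.1.factorial) := by
  have ho := overlapWeight_nonneg (totalLen T.2) m
  have hle := typeCount_le (m := m) T.2 (Nat.le_add_left 1 (m + totalLen T.2)) (by omega)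
  by_cases hc : T.1 ≤ m + 1
  · rw [typeTerm_eq T (by omega)]
    rw [if_pos hc] at hle
    have h1 : (typeCount (m + totalLen T.2 + 1) T : ℝ) / relaxedCount T.1 m ≤ 1 := by
      rw [div_le_one (relaxedCount_pos (by omega)), relaxedCount]
      exact_mod_cast hle
    have h2 := insertionWeight_le hc
    have h3 := insertionWeight_nonneg T.1 m
    refine (mul_le_of_le_one_left (by positivity) h1).trans ?_
    gcongr
  · rw [if_neg hc, mul_zero] at hle
    rw [typeTerm_eq_zero (Nat.le_zero.1 hle)]
    positivity

theorem typeTerm_eq_zero_of_lt {m : ℕ} (T : WordType) (h : m + 1 < T.1) :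
    typeTerm (m + totalLen T.2 + 1) T = 0 := by
  have hle := typeCount_le (m := m) T.2 (Nat.le_add_left 1 (m + totalLen T.2)) (by omega)
  rw [if_neg (by omega), mul_zero] at hle
  exact typeTerm_eq_zero (Nat.le_zero.1 hle)

/-- The limiting contribution of a type. -/
theorem tendsto_typeTerm (T : WordType) :
    Tendsto (fun n => typeTerm n T) atTop
      (𝓝 (Real.exp (-2) * ((1 / 2) ^ totalLen T.2 * (2 ^ T.1 / T.1.factorial)))) := by
  obtain ⟨c, t⟩ := T
  have hratio : Tendsto (fun m => (typeCount (m + totalLen t + 1) ⟨c, t⟩ : ℝ) / relaxedCount c m)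
      atTop (𝓝 (Real.exp (-2))) := by
    rw [Metric.tendsto_nhds]
    intro ε hε
    have h2 := (tendsto_badCount_div t).eventually_lt_const (half_pos hε)
    filter_upwards [eventually_abs_typeCount_sub_le t (half_pos (half_pos hε)), h2,
      eventually_ge_atTop c] with m h1 h2 hm
    have hpos : 0 < relaxedCount c m := relaxedCount_pos (by omega)
    have hF : (0 : ℝ) < (m + 1 - c).factorial := by positivity
    have hbad : (badCount m t : ℝ) * (m + 1 - c).factorial ≤ ε / 2 * relaxedCount c m := by
      have hp : (0 : ℝ) < (2 * m + 1).choose c * (2 * m).choose m := by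
        have h3 : 0 < (2 * m + 1).choose c := Nat.choose_pos (by omega)
        have h4 : 0 < (2 * m).choose m := Nat.choose_pos (by omega)
        positivity
      rw [div_lt_iff₀ hp] at h2
      unfold relaxedCount
      calc _ ≤ ε / 2 * ((2 * m + 1).choose c * (2 * m).choose m) * (m + 1 - c).factorial := by
            gcongr
        _ = _ := by ring
    rw [Real.dist_eq, div_sub' hpos.ne', abs_div, abs_of_pos hpos, div_lt_iff₀ hpos, mul_comm
      (relaxedCount c m)]
    have := mul_pos hε hpos
    linarith
  rw [← tendsto_add_atTop_iff_nat (totalLen t + 1)]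
  have hfrac : Tendsto (fun m : ℕ => ((m : ℝ) + 1) / ((m + totalLen t + 1 : ℕ) : ℝ)) atTop
      (𝓝 1) := by
    have := tendsto_add_mul_div_add_mul_atTop_nhds (𝕜 := ℝ) 1 (totalLen t + 1) 1 (d := 1)
      one_ne_zero
    rw [div_one] at this
    refine this.congr fun m => ?_
    push_cast
    congr 1 <;> ring
  have := hratio.mul ((hfrac.mul (tendsto_overlapWeight (totalLen t))).mul
    (tendsto_insertionWeight c))
  rw [one_mul] at this
  refine this.congr' ?_
  filter_upwards [eventually_ge_atTop c] with m hm
  exact (typeTerm_eq (m := m) ⟨c, t⟩ (by simp only; omega)).symm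

/-! ### Summation over all types -/

theorem totalLen_cons {d : ℕ} (a : ℕ) (t : Fin d → ℕ) :
    totalLen (Fin.cons a t : Fin (d + 1) → ℕ) = blockLen a + totalLen t := by
  unfold totalLen
  rw [Fin.sum_univ_succ]
  simp

theorem hasSum_pow_blockLen {r : ℝ} (h0 : 0 ≤ r) (h1 : r < 1) :
    HasSum (fun a => r ^ blockLen a) (r + r / (1 - r)) := by
  rw [← hasSum_nat_add_iff' 1]
  have h := (hasSum_geometric_of_lt_one h0 h1).mul_left r
  simp only [range_one, sum_singleton, blockLen]
  rw [show r + r / (1 - r) - r ^ max 1 0 = r * (1 - r)⁻¹ by simp [div_eq_mul_inv]]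
  refine h.congr_fun fun a => ?_
  rw [max_eq_right (by omega), pow_succ']

theorem hasSum_pow_totalLen {r : ℝ} (h0 : 0 ≤ r) (h1 : r < 1) (c : ℕ) :
    HasSum (fun t : Fin c → ℕ => r ^ totalLen t) ((r + r / (1 - r)) ^ c) := by
  induction c with
  | zero =>
    rw [pow_zero]
    convert hasSum_fintype (fun t : Fin 0 → ℕ => r ^ totalLen t)
    simp [totalLen]
  | succ d ih =>
    have hb := hasSum_pow_blockLen h0 h1
    have hp : Summable fun x : ℕ × (Fin d → ℕ) => r ^ blockLen x.1 * r ^ totalLen x.2 :=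
      Summable.mul_of_nonneg (f := fun a => r ^ blockLen a) (g := fun t => r ^ totalLen t)
        hb.summable ih.summable (fun _ => pow_nonneg h0 _) fun _ => pow_nonneg h0 _
    have hs := HasSum.mul hb ih hp
    rw [pow_succ', ← (Fin.consEquiv fun _ : Fin (d + 1) => ℕ).hasSum_iff]
    refine hs.congr_fun fun x => ?_
    simp only [Function.comp, Fin.consEquiv, Equiv.coe_fn_mk]
    rw [totalLen_cons, pow_add]

/-- The generating function of the types, by total length and exponentially by the number of
blocks. -/
theorem hasSum_types {r x : ℝ} (h0 : 0 ≤ r) (h1 : r < 1) (hx : 0 ≤ x) :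
    HasSum (fun T : WordType => r ^ totalLen T.2 * (x ^ T.1 / T.1.factorial))
      (Real.exp (x * (r + r / (1 - r)))) := by
  have hf : ∀ c : ℕ, HasSum (fun t : Fin c → ℕ => r ^ totalLen t * (x ^ c / c.factorial))
      ((r + r / (1 - r)) ^ c * (x ^ c / c.factorial)) := fun c =>
    (hasSum_pow_totalLen h0 h1 c).mul_right _
  have he : HasSum (fun c : ℕ => (r + r / (1 - r)) ^ c * (x ^ c / c.factorial))
      (Real.exp (x * (r + r / (1 - r)))) := by
    rw [Real.exp_eq_exp_ℝ]
    refine (NormedSpace.expSeries_div_hasSum_exp (x * (r + r / (1 - r)))).congr_fun fun c => ?_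
    rw [mul_pow]; ring
  refine HasSum.sigma_of_hasSum he hf ?_
  rw [summable_sigma_of_nonneg fun T => by positivity]
  exact ⟨fun c => (hf c).summable, he.summable.congr fun c => (hf c).tsum_eq.symm⟩

theorem sum_antidiagonal_choose (d s : ℕ) :
    ∑ p ∈ antidiagonal s, p.2.choose d = (s + 1).choose (d + 1) := by
  rw [Nat.sum_antidiagonal_eq_sum_range_succ_mk, ← Finset.sum_range_reflect]
  induction s with
  | zero => simp [Nat.choose_succ_succ]
  | succ s ih =>
    rw [Nat.choose_succ_succ (s + 1), ← ih, sum_range_succ, add_comm]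
    congr 1
    · congr 1; omega
    · refine sum_congr rfl fun i hi => ?_
      have := mem_range.1 hi
      congr 1; omega

theorem tsum_totalLen_succ (d : ℕ) (F : ℕ → ℝ≥0∞) :
    ∑' t : Fin (d + 1) → ℕ, F (totalLen t) =
      ∑' a, ∑' t : Fin d → ℕ, F (blockLen a + totalLen t) := by
  rw [← ENNReal.tsum_prod, ← (Fin.consEquiv fun _ : Fin (d + 1) => ℕ).tsum_eq]
  refine tsum_congr fun x => ?_
  simp only [Fin.consEquiv, Equiv.coe_fn_mk, totalLen_cons]

/-- There are at most `2 ^ (d + 1) * k.choose d` sequences of `d + 1` blocks of total length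
`k + 1`: this many compositions, with two kinds of blocks of length one. -/
theorem tsum_totalLen_le (d : ℕ) (F : ℕ → ℝ≥0∞) :
    ∑' t : Fin (d + 1) → ℕ, F (totalLen t) ≤ 2 ^ (d + 1) * ∑' k, (k.choose d : ℝ≥0∞) * F (k + 1) := by
  have hblock : ∀ G : ℕ → ℝ≥0∞, ∑' a, G (blockLen a) ≤ 2 * ∑' a, G (a + 1) := fun G => by
    rw [tsum_eq_zero_add' (f := fun a => G (blockLen a)) ENNReal.summable, two_mul]
    refine add_le_add (le_trans (le_of_eq ?_) (ENNReal.le_tsum 0)) (ENNReal.tsum_le_tsum fun a => ?_)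
    · simp [blockLen]
    · rw [blockLen, max_eq_right (by omega)]
  induction d generalizing F with
  | zero =>
    rw [tsum_totalLen_succ]
    simp only [tsum_fintype, Fintype.univ_ofSubsingleton, sum_singleton, Nat.choose_zero_right,
      Nat.cast_one, one_mul, zero_add, pow_one]
    have : ∀ t : Fin 0 → ℕ, totalLen t = 0 := fun t => by simp [totalLen]
    simpa [this] using hblock F
  | succ d ih =>
    rw [tsum_totalLen_succ]
    refine (hblock fun l => ∑' t : Fin (d + 1) → ℕ, F (l + totalLen t)).trans ?_
    rw [pow_succ', mul_assoc]
    gcongr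
    refine (ENNReal.tsum_le_tsum fun a => ih fun l => F (a + 1 + l)).trans ?_
    rw [ENNReal.tsum_mul_left]
    refine mul_le_mul_right ?_ _
    rw [← ENNReal.tsum_prod (f := fun a k => (k.choose d : ℝ≥0∞) * F (a + 1 + (k + 1))),
      ← Finset.HasAntidiagonal.sigmaAntidiagonalEquivProd.tsum_eq, ENNReal.tsum_sigma']
    rw [tsum_eq_zero_add' (f := fun k => (k.choose (d + 1) : ℝ≥0∞) * F (k + 1))
      ENNReal.summable]
    refine le_trans (ENNReal.tsum_le_tsum fun s => ?_) le_add_self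
    rw [tsum_fintype, ← sum_antidiagonal_choose, Nat.cast_sum, Finset.sum_mul,
      ← Finset.sum_coe_sort (antidiagonal s)]
    refine le_of_eq (sum_congr rfl fun p _ => ?_)
    have := mem_antidiagonal.1 p.2
    simp only [Finset.HasAntidiagonal.sigmaAntidiagonalEquivProd_apply]
    congr 2
    omega

theorem summable_and_tsum_le_of_ofReal {ι : Type*} {f : ι → ℝ} {B : ℝ} (hf : ∀ i, 0 ≤ f i)
    (hB : 0 ≤ B) (h : ∑' i, ENNReal.ofReal (f i) ≤ ENNReal.ofReal B) :
    Summable f ∧ ∑' i, f i ≤ B := by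
  have hs : ∀ s : Finset ι, ∑ i ∈ s, f i ≤ B := fun s => by
    rw [← ENNReal.ofReal_le_ofReal_iff hB, ENNReal.ofReal_sum_of_nonneg fun i _ => hf i]
    exact (ENNReal.sum_le_tsum s).trans h
  have hsum := summable_of_sum_le hf hs
  exact ⟨hsum, hsum.tsum_le_of_sum_le hs⟩

theorem sum_range_succ_div_two_pow (N : ℕ) :
    ∑ j ∈ range N, ((j : ℝ) + 1) * (1 / 2) ^ j ≤ 4 := by
  have : ∀ N : ℕ, ∑ j ∈ range N, ((j : ℝ) + 1) * (1 / 2) ^ j = 4 - (2 * N + 4) * (1 / 2) ^ N := by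
    intro N
    induction N with
    | zero => norm_num
    | succ N ih => rw [sum_range_succ, ih, pow_succ]; push_cast; ring
  rw [this]
  have : (0 : ℝ) ≤ (2 * N + 4) * (1 / 2) ^ N := by positivity
  linarith

/-- When `k` is much larger than `m`, the number of sequences of `d + 1` blocks of total length
`k + 1`, which is `k.choose d` up to a factor `2 ^ (d + 1)`, is outweighed by the smallness of
`overlapWeight`. -/
theorem choose_mul_overlapWeight_le {d k m : ℕ} (hk : 12 * m < k + 1) (hd : d ≤ m) :
    (k.choose d : ℝ) * overlapWeight (k + 1) m ≤ 12 ^ d * (1 / 2) ^ m := by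
  obtain ⟨e, rfl⟩ := Nat.exists_eq_add_of_le hd
  set K : ℝ := ((k + 1 : ℕ) : ℝ) with hK
  have hK0 : 0 < K := by rw [hK]; positivity
  have hKm : 12 * ((d + e : ℕ) : ℝ) ≤ K := by rw [hK]; exact_mod_cast hk.le
  set M : ℝ := ((d + e : ℕ) : ℝ) with hM
  have hM0 : 0 ≤ M := by rw [hM]; positivity
  have h1 : (k.choose d : ℝ) ≤ K ^ d / d.factorial := by
    refine (Nat.choose_le_pow_div d k).trans ?_
    rw [hK]; gcongr; omega
  have h2 : overlapWeight (k + 1) (d + e) ≤ (2 * M / K) ^ (d + e) :=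
    overlapWeight_le_div_pow (Nat.succ_pos k)
  have h3 : M ^ d / d.factorial ≤ 3 ^ (d + e) := by
    have h4 : M ^ d / d.factorial ≤ Real.exp M := Real.pow_div_factorial_le_exp M hM0 d
    refine h4.trans ?_
    rw [← mul_one M, hM, Real.exp_nat_mul]
    gcongr
    linarith [Real.exp_one_lt_d9]
  have h5 : M / K ≤ 1 / 12 := by
    rw [div_le_div_iff₀ hK0 (by norm_num)]; linarith
  calc (k.choose d : ℝ) * overlapWeight (k + 1) (d + e)
      ≤ K ^ d / d.factorial * (2 * M / K) ^ (d + e) := by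
        gcongr
        exact overlapWeight_nonneg _ _
    _ = 2 ^ (d + e) * (M ^ d / d.factorial) * (M / K) ^ e := by
        rw [mul_div_assoc, mul_pow, pow_add (M / K), div_pow M K d]
        field_simp
    _ ≤ 2 ^ (d + e) * 3 ^ (d + e) * (1 / 12) ^ e := by gcongr
    _ = 12 ^ d * (1 / 2) ^ (d + e) := by
        rw [← mul_pow, show (2 * 3 : ℝ) = 12 * (1 / 2) by norm_num, mul_pow, pow_add (12 : ℝ),
          one_div_pow 12 e]
        field_simp

/-- The contribution of the types with `12 * m < k`, where `k` is the number of shared edges and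
`m = n - 1 - k`, and 0 for the other types. -/
noncomputable def tailTerm (n : ℕ) (T : WordType) : ℝ :=
  if 12 * (n - 1 - totalLen T.2) < totalLen T.2 then typeTerm n T else 0

theorem tailTerm_nonneg (n : ℕ) (T : WordType) : 0 ≤ tailTerm n T := by
  unfold tailTerm
  split_ifs
  exacts [typeTerm_nonneg n T, le_rfl]

/-- A bound for `tailTerm` at a type with `d + 1` blocks and total length `k`. -/
noncomputable def tailBound (n d k : ℕ) : ℝ :=
  if k ≤ n - 1 ∧ 12 * (n - 1 - k) < k ∧ d ≤ n - 1 - k then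
    ((n - 1 - k : ℕ) + 1 : ℝ) / n * overlapWeight k (n - 1 - k) *
      (16 ^ (d + 1) / (d + 1).factorial)
  else 0

theorem tailTerm_le {n d : ℕ} (hn : 1 ≤ n) (t : Fin (d + 1) → ℕ) :
    tailTerm n ⟨d + 1, t⟩ ≤ tailBound n d (totalLen t) := by
  have hnn : 0 ≤ tailBound n d (totalLen t) := by
    unfold tailBound
    split_ifs
    · have := overlapWeight_nonneg (totalLen t) (n - 1 - totalLen t)
      positivity
    · exact le_rfl
  unfold tailTerm
  split_ifs with h1
  · by_cases h2 : totalLen t ≤ n - 1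
    · obtain ⟨m, hm⟩ := Nat.exists_eq_add_of_le' h2
      obtain rfl : n = m + totalLen t + 1 := by omega
      have e : m + totalLen t + 1 - 1 - totalLen t = m := by omega
      by_cases h3 : d ≤ m
      · rw [tailBound, if_pos ⟨h2, h1, by omega⟩, e]
        exact typeTerm_le (m := m) ⟨d + 1, t⟩
      · rw [typeTerm_eq_zero_of_lt (m := m) ⟨d + 1, t⟩ (by simp only; omega)]
        exact hnn
    · rw [typeTerm_eq_zero (typeCount_eq_zero (by simp only; omega))]
      exact hnn
  · exact hnn

theorem two_pow_mul_choose_mul_tailBound_le (n d k : ℕ) :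
    2 ^ (d + 1) * (k.choose d * tailBound n d (k + 1)) ≤
      if k < n - 1 then (384 ^ (d + 1) / (d + 1).factorial : ℝ) / n *
        (((n - 1 - 1 - k : ℕ) + 1 : ℝ) * (1 / 2) ^ (n - 1 - 1 - k)) else 0 := by
  unfold tailBound
  by_cases h : k + 1 ≤ n - 1
  · rw [if_pos (show k < n - 1 by omega)]
    split_ifs with h'
    · rw [show n - 1 - (k + 1) = n - 1 - 1 - k by omega] at h' ⊢
      set m := n - 1 - 1 - k
      have hw := choose_mul_overlapWeight_le h'.2.1 h'.2.2
      calc (2 : ℝ) ^ (d + 1) * (k.choose d * (((m : ℝ) + 1) / n * overlapWeight (k + 1) m *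
              (16 ^ (d + 1) / (d + 1).factorial)))
          = 2 ^ (d + 1) * 16 ^ (d + 1) / (d + 1).factorial / n * ((m : ℝ) + 1) *
              (k.choose d * overlapWeight (k + 1) m) := by ring
        _ ≤ 2 ^ (d + 1) * 16 ^ (d + 1) / (d + 1).factorial / n * ((m : ℝ) + 1) *
              (12 ^ (d + 1) * (1 / 2) ^ m) := by
            refine mul_le_mul_of_nonneg_left (hw.trans ?_) (by positivity)
            gcongr
            · norm_num
            · omega
        _ = _ := by
            rw [show (384 : ℝ) = 2 * 16 * 12 by norm_num, mul_pow, mul_pow]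
            ring
    · rw [mul_zero, mul_zero]
      positivity
  · rw [if_neg (fun h' => h h'.1), if_neg (by omega), mul_zero, mul_zero]

/-- The types in the tail contribute `O(1 / n)` altogether. -/
theorem tsum_ofReal_tailTerm_le {n : ℕ} (hn : 1 ≤ n) :
    ∑' T, ENNReal.ofReal (tailTerm n T) ≤
      ENNReal.ofReal ((∑' c : ℕ, (384 ^ c / c.factorial : ℝ)) * 4 / n) := by
  have hsum : Summable fun c : ℕ => (384 ^ c / c.factorial : ℝ) * 4 / n := by
    exact ((Real.summable_pow_div_factorial 384).mul_right 4).div_const _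
  rw [ENNReal.tsum_sigma', ← tsum_mul_right, ← tsum_div_const,
    ENNReal.ofReal_tsum_of_nonneg (fun c => by positivity) hsum]
  refine ENNReal.tsum_le_tsum fun c => ?_
  -- the type without blocks has no shared edge and is not in the tail
  rcases c with _ | d
  · rw [ENNReal.tsum_eq_zero.2 fun t => ?_]
    · exact zero_le
    · simp [tailTerm, totalLen]
  refine (ENNReal.tsum_le_tsum fun t => ENNReal.ofReal_le_ofReal (tailTerm_le hn t)).trans ?_
  refine (tsum_totalLen_le d fun k => ENNReal.ofReal (tailBound n d k)).trans ?_
  rw [← ENNReal.tsum_mul_left]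
  have hterm : ∀ k : ℕ, (2 : ℝ≥0∞) ^ (d + 1) *
      ((k.choose d : ℝ≥0∞) * ENNReal.ofReal (tailBound n d (k + 1))) ≤
      if k < n - 1 then ENNReal.ofReal ((384 ^ (d + 1) / (d + 1).factorial : ℝ) / n *
        (((n - 1 - 1 - k : ℕ) + 1 : ℝ) * (1 / 2) ^ (n - 1 - 1 - k))) else 0 := fun k => by
    have h := ENNReal.ofReal_le_ofReal (two_pow_mul_choose_mul_tailBound_le n d k)
    rw [ENNReal.ofReal_mul (by positivity), ENNReal.ofReal_mul (by positivity),
      ENNReal.ofReal_natCast, ENNReal.ofReal_pow (by norm_num), ENNReal.ofReal_ofNat] at h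
    refine h.trans (le_of_eq ?_)
    split_ifs <;> simp
  refine (ENNReal.tsum_le_tsum hterm).trans ?_
  rw [tsum_eq_sum (s := range (n - 1)) fun k hk => if_neg fun h => hk (mem_range.2 h),
    sum_congr rfl fun k hk => if_pos (mem_range.1 hk),
    sum_range_reflect (fun j => ENNReal.ofReal ((384 ^ (d + 1) / (d + 1).factorial : ℝ) / n *
        (((j : ℕ) + 1 : ℝ) * (1 / 2) ^ j))), ← ENNReal.ofReal_sum_of_nonneg
      fun j _ => by positivity, ← mul_sum]
  refine ENNReal.ofReal_le_ofReal ?_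
  calc (384 ^ (d + 1) / (d + 1).factorial : ℝ) / n *
        ∑ j ∈ range (n - 1), (((j : ℕ) + 1 : ℝ) * (1 / 2) ^ j)
      ≤ (384 ^ (d + 1) / (d + 1).factorial : ℝ) / n * 4 := by
        gcongr
        exact sum_range_succ_div_two_pow _
    _ = _ := by ring

theorem summable_tailTerm {n : ℕ} (hn : 1 ≤ n) :
    Summable (tailTerm n) ∧
      ∑' T, tailTerm n T ≤ (∑' c : ℕ, (384 ^ c / c.factorial : ℝ)) * 4 / n :=
  summable_and_tsum_le_of_ofReal (tailTerm_nonneg n)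
    (by have : (0 : ℝ) ≤ ∑' c : ℕ, (384 ^ c / c.factorial : ℝ) := tsum_nonneg fun c => by positivity
        positivity)
    (tsum_ofReal_tailTerm_le hn)

theorem tendsto_tsum_tailTerm : Tendsto (fun n => ∑' T, tailTerm n T) atTop (𝓝 0) := by
  refine squeeze_zero' (Eventually.of_forall fun n => tsum_nonneg (tailTerm_nonneg n)) ?_
    (tendsto_const_div_atTop_nhds_zero_nat ((∑' c : ℕ, (384 ^ c / c.factorial : ℝ)) * 4))
  filter_upwards [eventually_ge_atTop 1] with n hn
  exact (summable_tailTerm hn).2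

/-- Domination of the types that are not in the tail. -/
theorem bulk_le {n : ℕ} (hn : 1 ≤ n) (T : WordType) :
    typeTerm n T - tailTerm n T ≤ (13 / 14) ^ totalLen T.2 * (16 ^ T.1 / T.1.factorial) := by
  unfold tailTerm
  split_ifs with h
  · rw [sub_self]; positivity
  · rw [sub_zero]
    by_cases h2 : totalLen T.2 ≤ n - 1
    · obtain ⟨m, hm⟩ := Nat.exists_eq_add_of_le' h2
      obtain rfl : n = m + totalLen T.2 + 1 := by omega
      have ho := overlapWeight_nonneg (totalLen T.2) m
      refine (typeTerm_le T).trans ?_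
      gcongr
      refine (mul_le_of_le_one_left ho ?_).trans (overlapWeight_le_pow (by omega))
      refine div_le_one_of_le₀ ?_ (by positivity)
      push_cast
      linarith [(Nat.cast_nonneg (totalLen T.2) : (0 : ℝ) ≤ _)]
    · rw [typeTerm_eq_zero (typeCount_eq_zero (by omega))]
      positivity

theorem bulk_nonneg (n : ℕ) (T : WordType) : 0 ≤ typeTerm n T - tailTerm n T := by
  unfold tailTerm
  split_ifs
  · rw [sub_self]
  · rw [sub_zero]; exact typeTerm_nonneg n T

theorem summable_geometric_types :
    Summable fun T : WordType => (13 / 14 : ℝ) ^ totalLen T.2 * (16 ^ T.1 / T.1.factorial) :=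
  (hasSum_types (by norm_num) (by norm_num) (by norm_num)).summable

theorem tendsto_tsum_bulk :
    Tendsto (fun n => ∑' T, (typeTerm n T - tailTerm n T)) atTop (𝓝 (Real.exp 1)) := by
  have hlim : ∑' T : WordType, Real.exp (-2) * ((1 / 2) ^ totalLen T.2 * (2 ^ T.1 / T.1.factorial))
      = Real.exp 1 := by
    rw [tsum_mul_left, (hasSum_types (r := 1 / 2) (x := 2) (by norm_num) (by norm_num)
      (by norm_num)).tsum_eq, ← Real.exp_add]
    norm_num
  rw [← hlim]
  -- every type has `k ≤ 12 m` eventually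
  refine tendsto_tsum_of_dominated_convergence summable_geometric_types (fun T => ?_) ?_
  · refine (tendsto_typeTerm T).congr' ?_
    filter_upwards [eventually_ge_atTop (2 * totalLen T.2 + 1)] with n hn
    rw [tailTerm, if_neg (by omega), sub_zero]
  · filter_upwards [eventually_ge_atTop 1] with n hn T
    rw [Real.norm_of_nonneg (bulk_nonneg n T)]
    exact bulk_le hn T

/-- The second moment is asymptotic to `e * n ^ 2`. -/
theorem tendsto_integral_numIncreasing_sq_div :
    Tendsto (fun n : ℕ => (∫ f, (numIncreasing f : ℝ) ^ 2 ∂(randomOrdering n)) / (n : ℝ) ^ 2) atTop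
      (𝓝 (Real.exp 1)) := by
  have h := tendsto_tsum_bulk.add tendsto_tsum_tailTerm
  rw [add_zero] at h
  refine h.congr' ?_
  filter_upwards [eventually_ge_atTop 1] with n hn
  have hb : Summable fun T => typeTerm n T - tailTerm n T :=
    summable_geometric_types.of_nonneg_of_le (bulk_nonneg n) (bulk_le hn)
  rw [integral_numIncreasing_sq_div, ← hb.tsum_add (summable_tailTerm hn).1]
  exact tsum_congr fun T => sub_add_cancel _ _

end

/-! ### The two moments and the probability of existence -/

theorem theorem2 :
    -- an increasing Hamiltonian path exists with probability at least `1/e + o(1)`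
    (∃ ε : ℕ → ℝ, Filter.Tendsto ε Filter.atTop (nhds 0) ∧
      ∀ n : ℕ, 1 / Real.exp 1 + ε n ≤
        (randomOrdering n).real {f | ∃ σ : Equiv.Perm (Fin n), IsIncreasing f σ}) ∧
    -- the first moment of the number of increasing Hamiltonian paths
    (∀ n : ℕ, 1 ≤ n → ∫ f, (numIncreasing f : ℝ) ∂(randomOrdering n) = n) ∧
    -- its second moment is `(1 + o(1)) e n ^ 2`
    Asymptotics.IsEquivalent Filter.atTop
      (fun n : ℕ => ∫ f, (numIncreasing f : ℝ) ^ 2 ∂(randomOrdering n))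
      (fun n : ℕ => Real.exp 1 * (n : ℝ) ^ 2) := by
  have hlim := tendsto_integral_numIncreasing_sq_div
  have he := (Real.exp_pos 1).ne'
  refine ⟨⟨fun n => ((∫ f, (numIncreasing f : ℝ) ^ 2 ∂(randomOrdering n)) / (n : ℝ) ^ 2)⁻¹ -
    1 / Real.exp 1, ?_, fun n => ?_⟩, integral_numIncreasing, ?_⟩
  · have h := (hlim.inv₀ he).sub_const (1 / Real.exp 1)
    rwa [one_div, sub_self, ← one_div] at h
  · rw [add_sub_cancel, inv_div]
    have hI : 0 ≤ ∫ f, (numIncreasing f : ℝ) ^ 2 ∂(randomOrdering n) :=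
      integral_nonneg fun f => by positivity
    refine div_le_of_le_mul₀ hI measureReal_nonneg ?_
    -- for `n = 0` the bound is `0`, the value of a division by zero
    rcases Nat.eq_zero_or_pos n with rfl | hn
    · rw [Nat.cast_zero, zero_pow two_ne_zero]
      exact mul_nonneg measureReal_nonneg hI
    · have h := sq_integral_numIncreasing_le n
      rw [integral_numIncreasing n hn] at h
      linarith
  · refine Asymptotics.isEquivalent_of_tendsto_one ?_
    have h := hlim.div_const (Real.exp 1)
    rw [div_self he] at h
    refine h.congr fun n => ?_
    rw [Pi.div_apply, div_div, mul_comm]
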